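/- Let $Q(\vec y) \leftarrow R_1(\vec x_1),\dots,R_\ell(\vec x_\ell)$, $\ell\ge 1$, be a conjunctive query (self-joins allowed) with set of variables $\vec x=\bigcup_i \vec x_i$ and free variables $\vec y\subseteq\vec x$. Assume that $Q$ is *free-connex acyclic*: the hypergraph with vertex set $\vec x$ and hyperedges $\vec x_1,\dots,\vec x_\ell$ is $\alpha$-acyclic (it has a join tree, i.e. a tree on the hyperedges in which the hyperedges containing any fixed vertex induce a connected subtree), and it remains $\alpha$-acyclic when the hyperedge $\vec y$ is added. Let $(W,\oplus,\otimes,\bar 0,\bar 1)$ be a selective dioid with commutative $\otimes$, i.e. a commutative semiring with $x\oplus y\in\{x,y\}$ for all $x,y$, totally ordered by $x\le y \iff x\oplus y=x$. Let $D$ be a database in which every tuple of every relation carries a weight in $W$, and let $n$ be the maximal cardinality of a relation referenced in $Q$. The weight of an answer $r'$ of the full query $Q(\vec x)$ with witness $(r_1,\dots,r_\ell)$, $r_i\in R_i$, is $\bigotimes_{i=1}^{\ell} w(r_i)$. Under min-weight-projection semantics the answers of $Q(\vec y)$ are the projections $\pi_{\vec y}(r')$ of the answers $r'$ of $Q(\vec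 x)$, each of them once, and the weight of an answer $r$ is $w(r)=\min\{w(r') : r'\in Q(\vec x),\ \pi_{\vec y}(r')=r\}$. Computations are on a unit-cost RAM on which $\oplus$, $\otimes$ and comparisons of weights take constant time, reading, storing or outputting a tuple of $i$ elements takes time $O(i)$, and memory can be addressed by tuples, so that tuple lookups take constant time. Then there are a program and a constant $C$, both depending only on $Q$ (data complexity), such that for all such $W$ and $D$ the program outputs all answers of $Q(\vec y)$ on $D$ together with their weights, each answer exactly once, in non-decreasing order of weight, and then halts, with $$\mathrm{TTF}\le C\cdot\max(n,1) = O(n) \qquad\text{and}\qquad \mathrm{Delay}(k)\le C\cdot\log_2 k = O(\log k)\quad (k\ge 2),$$ where $\mathrm{TTF}$ is the time until the first output, $\mathrm{Delay}(k)$ is the time between the $(k-1)$-st and the $k$-th output, and halting counts as one further output after the last answer. -/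

import Mathlib

universe u v

namespace RankedEnum

/-! ### Conjunctive queries, acyclicity, free-connexity -/

/-- A conjunctive query `Q(y) :- g_1(x_1), ..., g_ℓ(x_ℓ)`. The variables are `Fin numVars`; each
atom `i` refers to a relation symbol `rel i` (several atoms may refer to the same symbol) and lists
its variables; `head` lists the free variables. Every variable occurs in some atom. -/
structure CQ where
  numVars : ℕ
  numRels : ℕ
  arity : Fin numRels → ℕ
  numAtoms : ℕ
  rel : Fin numAtoms → Fin numRels
  args : (i : Fin numAtoms) → Fin (arity (rel i)) → Fin numVars
  head : List (Fin numVars)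
  covered : ∀ x, ∃ i j, args i j = x

/-- `T` is a join tree of the hypergraph with the (indexed) hyperedges `E`: a tree on the
hyperedges in which the hyperedges containing any given vertex form a connected subtree. -/
def IsJoinTree {ι V : Type} (E : ι → Set V) (T : SimpleGraph ι) : Prop :=
  T.IsTree ∧ ∀ x : V, (T.induce {i | x ∈ E i}).Preconnected

/-- Alpha-acyclicity of a hypergraph: it has a join tree. -/
def AlphaAcyclic {ι V : Type} (E : ι → Set V) : Prop :=
  ∃ T : SimpleGraph ι, IsJoinTree E T

namespace CQ

variable (Q : CQ)

/-- The hyperedge of an atom: its set of variables. -/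
def edge (i : Fin Q.numAtoms) : Set (Fin Q.numVars) := Set.range (Q.args i)

/-- The hyperedges of the query together with one additional hyperedge (index `none`) that
consists of the free variables. -/
def edgeWithHead : Option (Fin Q.numAtoms) → Set (Fin Q.numVars)
  | none => {x | x ∈ Q.head}
  | some i => Q.edge i

def Acyclic : Prop := AlphaAcyclic Q.edge

/-- The query is acyclic, and it stays acyclic when the head is added as a hyperedge. -/
def FreeConnexAcyclic : Prop := Q.Acyclic ∧ AlphaAcyclic Q.edgeWithHead

end CQ

/-! ### Selective dioids -/

/-- `⊕` (written `+`) always returns one of its operands. -/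
def IsSelective (W : Type v) [Add W] : Prop := ∀ x y : W, x + y = x ∨ x + y = y

/-- The order of a selective dioid: `x ≤ y` iff `x ⊕ y = x`. -/
def DLe {W : Type v} [Add W] (x y : W) : Prop := x + y = x

/-! ### Databases and answers -/

/-- A database with weighted tuples. Each relation is a finite set of tuples, listed without
repetition, and every tuple has a weight. -/
structure Database (Q : CQ) (α : Type u) (W : Type v) where
  size : Fin Q.numRels → ℕ
  tuple : (R : Fin Q.numRels) → Fin (size R) → Fin (Q.arity R) → α
  tuple_injective : ∀ R, Function.Injective (tuple R)
  weight : (R : Fin Q.numRels) → Fin (size R) → W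

namespace Database

variable {Q : CQ} {α : Type u} {W : Type v} (D : Database Q α W)

/-- `n`: the maximal cardinality of a relation that is referenced in the query. -/
def n : ℕ := Finset.univ.sup fun i : Fin Q.numAtoms => D.size (Q.rel i)

/-- `a` is an answer of the full query (the query without projection), and `t` is its witness: the
tuple `t i` of the relation of atom `i` carries the values that `a` gives to the atom. -/
def IsWitness (a : Fin Q.numVars → α) (t : (i : Fin Q.numAtoms) → Fin (D.size (Q.rel i))) : Prop :=
  ∀ i j, D.tuple (Q.rel i) (t i) j = a (Q.args i j)

/-- The weight of a witness: the `⊗`-product of the weights of its tuples. -/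
def witnessWeight [CommSemiring W] (t : (i : Fin Q.numAtoms) → Fin (D.size (Q.rel i))) : W :=
  ∏ i, D.weight (Q.rel i) (t i)

/-- `r` is an answer of the query: the projection of an answer of the full query to the head. -/
def IsAnswer (r : List α) : Prop :=
  ∃ a t, D.IsWitness a t ∧ Q.head.map a = r

/-- Min-weight-projection semantics: `w` is the minimum weight over all answers of the full query
that project to `r`. -/
def IsMinWeight [CommSemiring W] (r : List α) (w : W) : Prop :=
  (∃ a t, D.IsWitness a t ∧ Q.head.map a = r ∧ D.witnessWeight t = w) ∧
    ∀ a t, D.IsWitness a t → Q.head.map a = r → DLe w (D.witnessWeight t)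

end Database

/-! ### The machine model

A random access machine. A word is a natural number or an element of the domain of the database;
domain elements are opaque (they can be copied, tested for equality, used in lookups, and output).
Weights are opaque elements of the dioid, kept apart from the words; the only operations on them
are `⊕`, `⊗`, the two constants and the comparison in the order of the dioid.
Memory is addressed by tuples of words, which provides arrays and constant-time tuple lookup.
There is no multiplication of numbers. -/

inductive Word (α : Type u) where
  | num (k : ℕ)
  | val (a : α)

/-- The number in a word (`0` for a domain element). -/
def Word.toNat {α : Type u} : Word α → ℕ
  | .num k => k
  | .val _ => 0

/-- Instructions. Natural numbers `r`, `s`, `t` denote registers, lists `key` denote lists of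
registers whose contents form an address, and `l` denotes a jump target. -/
inductive Instr where
  /-- `reg r := c` -/
  | const (r c : ℕ)
  /-- `reg r := reg s` -/
  | move (r s : ℕ)
  /-- `reg r := reg s + reg t` -/
  | add (r s t : ℕ)
  /-- `reg r := reg s - reg t` (truncated) -/
  | sub (r s t : ℕ)
  /-- `reg r := ⌊reg s / 2⌋` -/
  | half (r s : ℕ)
  /-- `reg r := mem[key]` -/
  | load (r : ℕ) (key : List ℕ)
  /-- `mem[key] := reg r` -/
  | store (key : List ℕ) (r : ℕ)
  /-- weight register `r` becomes the zero of the dioid -/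
  | wzero (r : ℕ)
  /-- weight register `r` becomes the one of the dioid -/
  | wone (r : ℕ)
  /-- copy a weight register -/
  | wmove (r s : ℕ)
  /-- `wreg r := wreg s ⊕ wreg t` -/
  | wadd (r s t : ℕ)
  /-- `wreg r := wreg s ⊗ wreg t` -/
  | wmul (r s t : ℕ)
  /-- `wreg r := wmem[key]` -/
  | wload (r : ℕ) (key : List ℕ)
  /-- `wmem[key] := wreg r` -/
  | wstore (key : List ℕ) (r : ℕ)
  /-- jump to `l` -/
  | jmp (l : ℕ)
  /-- jump to `l` if the words in registers `r` and `s` are equal -/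
  | jeq (r s l : ℕ)
  /-- jump to `l` if the number in `r` is smaller than the number in `s` -/
  | jlt (r s l : ℕ)
  /-- jump to `l` if `wreg r ≤ wreg s` in the order of the dioid -/
  | wjle (r s l : ℕ)
  /-- output the tuple of words in the registers `rs` with the weight in `wreg w` -/
  | emit (rs : List ℕ) (w : ℕ)

/-- The cost of an instruction: one unit, plus one unit per component of an accessed address or of
an output tuple. -/
def Instr.cost : Instr → ℕ
  | .load _ key => 1 + key.length
  | .store key _ => 1 + key.length
  | .wload _ key => 1 + key.length
  | .wstore key _ => 1 + key.length
  | .emit rs _ => 1 + rs.length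
  | _ => 1

/-- A program is a finite list of instructions; it halts when the program counter leaves it. -/
abbrev Program := List Instr

/-- An output: the time when it is completed, the tuple, and its weight. -/
structure Output (α : Type u) (W : Type v) where
  time : ℕ
  tuple : List (Word α)
  weight : W

/-- A configuration of the machine. `clock` is the total cost so far and `log` lists the outputs
so far, in order. The program cannot access these two. -/
structure Config (α : Type u) (W : Type v) where
  pc : ℕ
  reg : ℕ → Word α
  wreg : ℕ → W
  mem : List (Word α) → Word α
  wmem : List (Word α) → W
  clock : ℕ
  log : List (Output α W)

section Semantics

variable {α : Type u} {W : Type v} [CommSemiring W]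

open Classical in
/-- The effect of one instruction, apart from the clock. -/
noncomputable def Instr.exec (ins : Instr) (c : Config α W) : Config α W :=
  match ins with
  | .const r k => { c with pc := c.pc + 1, reg := Function.update c.reg r (.num k) }
  | .move r s => { c with pc := c.pc + 1, reg := Function.update c.reg r (c.reg s) }
  | .add r s t =>
      { c with
        pc := c.pc + 1
        reg := Function.update c.reg r (.num ((c.reg s).toNat + (c.reg t).toNat)) }
  | .sub r s t =>
      { c with
        pc := c.pc + 1
        reg := Function.update c.reg r (.num ((c.reg s).toNat - (c.reg t).toNat)) }
  | .half r s =>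
      { c with
        pc := c.pc + 1
        reg := Function.update c.reg r (.num ((c.reg s).toNat / 2)) }
  | .load r key =>
      { c with pc := c.pc + 1, reg := Function.update c.reg r (c.mem (key.map c.reg)) }
  | .store key r =>
      { c with pc := c.pc + 1, mem := Function.update c.mem (key.map c.reg) (c.reg r) }
  | .wzero r => { c with pc := c.pc + 1, wreg := Function.update c.wreg r 0 }
  | .wone r => { c with pc := c.pc + 1, wreg := Function.update c.wreg r 1 }
  | .wmove r s => { c with pc := c.pc + 1, wreg := Function.update c.wreg r (c.wreg s) }
  | .wadd r s t =>
      { c with pc := c.pc + 1, wreg := Function.update c.wreg r (c.wreg s + c.wreg t) }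
  | .wmul r s t =>
      { c with pc := c.pc + 1, wreg := Function.update c.wreg r (c.wreg s * c.wreg t) }
  | .wload r key =>
      { c with pc := c.pc + 1, wreg := Function.update c.wreg r (c.wmem (key.map c.reg)) }
  | .wstore key r =>
      { c with pc := c.pc + 1, wmem := Function.update c.wmem (key.map c.reg) (c.wreg r) }
  | .jmp l => { c with pc := l }
  | .jeq r s l => { c with pc := if c.reg r = c.reg s then l else c.pc + 1 }
  | .jlt r s l => { c with pc := if (c.reg r).toNat < (c.reg s).toNat then l else c.pc + 1 }
  | .wjle r s l => { c with pc := if DLe (c.wreg r) (c.wreg s) then l else c.pc + 1 }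
  | .emit rs w =>
      { c with
        pc := c.pc + 1
        log := c.log ++ [⟨c.clock + (Instr.emit rs w).cost, rs.map c.reg, c.wreg w⟩] }

/-- One step of the machine; nothing happens once the program has halted. -/
noncomputable def step (P : Program) (c : Config α W) : Config α W :=
  match P[c.pc]? with
  | none => c
  | some ins => { ins.exec c with clock := c.clock + ins.cost }

/-- Started in `c`, the program `P` halts, and `c'` is its final configuration. -/
def HaltsWith (P : Program) (c c' : Config α W) : Prop :=
  P.length ≤ c'.pc ∧ ∃ s : ℕ, (step P)^[s] c = c'

variable {Q : CQ} (D : Database Q α W)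

/-- The input memory: address `(R)` holds the cardinality of the relation `R`, and address
`(R, i, j)` holds the `j`-th value of its `i`-th tuple. All other cells hold `0`. -/
def inputMem : List (Word α) → Word α
  | [.num R] => if hR : R < Q.numRels then .num (D.size ⟨R, hR⟩) else .num 0
  | [.num R, .num i, .num j] =>
      if hR : R < Q.numRels then
        if hi : i < D.size ⟨R, hR⟩ then
          if hj : j < Q.arity ⟨R, hR⟩ then .val (D.tuple ⟨R, hR⟩ ⟨i, hi⟩ ⟨j, hj⟩) else .num 0
        else .num 0
      else .num 0
  | _ => .num 0

/-- The input weights: address `(R, i)` holds the weight of the `i`-th tuple of the relation `R`. -/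
def inputWMem : List (Word α) → W
  | [.num R, .num i] =>
      if hR : R < Q.numRels then
        if hi : i < D.size ⟨R, hR⟩ then D.weight ⟨R, hR⟩ ⟨i, hi⟩ else 0
      else 0
  | _ => 0

/-- The initial configuration on input `D`. -/
def initial : Config α W where
  pc := 0
  reg := fun _ => .num 0
  wreg := fun _ => 0
  mem := inputMem D
  wmem := inputWMem D
  clock := 0
  log := []

/-! ### Ranked enumeration -/

/-- The outputs in `log` are exactly the answers of the query on `D`, each of them once, each with
its minimum weight, by non-decreasing weight. -/
def IsRankedEnumeration (log : List (Output α W)) : Prop :=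
  (∃ answers : List (List α),
    log.map Output.tuple = answers.map (List.map Word.val) ∧
    answers.Nodup ∧
    (∀ r, r ∈ answers ↔ D.IsAnswer r)) ∧
  (∀ o ∈ log, ∀ r : List α, o.tuple = r.map Word.val → D.IsMinWeight r o.weight) ∧
  log.Pairwise (fun o o' => DLe o.weight o'.weight)

/-- The times of the events of a halting run: the times of the outputs, in order, and finally the
time of halting, by which the end of the enumeration is announced. -/
def Config.eventTimes (c : Config α W) : List ℕ :=
  c.log.map Output.time ++ [c.clock]

/-- The first event happens within time `O(n)` (with constant `C`; for `n = 0` the bound is `C`). -/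
def TTFBound (C n : ℕ) (times : List ℕ) : Prop :=
  ∀ t, times[0]? = some t → t ≤ C * max n 1

/-- For every `k ≥ 2` the time between the `(k-1)`-st and the `k`-th event is `O(log k)` (with
constant `C`; `Nat.log 2` is the binary logarithm rounded down, which is at least `1` here). -/
def DelayBound (C : ℕ) (times : List ℕ) : Prop :=
  ∀ k s t, 2 ≤ k → times[k - 2]? = some s → times[k - 1]? = some t → t ≤ s + C * Nat.log 2 k

/-- On input `D` the program `P` performs ranked enumeration under min-weight-projection semantics
with `TTF ≤ C n` and `Delay(k) ≤ C log k`. -/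
def Enumerates (P : Program) (C : ℕ) : Prop :=
  ∃ c : Config α W, HaltsWith P (initial D) c ∧
    IsRankedEnumeration D c.log ∧
    TTFBound C D.n c.eventTimes ∧
    DelayBound C c.eventTimes

end Semantics

end RankedEnum

/-! Free-connexity provides two join trees, one of the query and one of the query with the head as
an extra hyperedge. `CQ.FreeConnexAcyclic.nonempty_plan` glues them into a single tree with the
running intersection property. Its upper part consists of `m` nodes, the atoms cut down to the free
variables; its lower part consists of the atoms themselves, and only these contribute tuple weights.
An answer is then a consistent choice of one projected tuple at each upper node, and its minimum
weight is the product of the optima over the lower subtrees that hang from the upper part.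

Dynamic programming from the leaves gives every node a table: its distinct projected tuples that
have partners in all children, grouped by the key shared with the parent, together with the optimal
weight in the subtree. Sorting the groups would cost a logarithmic factor. Each group is made a
binary heap instead, in linear time overall (`sum_log_div_le`, `heapify_spec`): the best member is
at position `1`, and position `p` is never better than position `p / 2`.

An answer is coded by a vector of heap positions, one per upper node (`Plan.Rep`). Halving the last
coordinate that is not `1` yields the vector of another answer, of no larger weight
(`Plan.Rep.halve`): earlier coordinates are untouched, the group is the same, and all later nodes
take their optimum. So the answers form a tree with root `1, ..., 1`, with at most `2 * m` children
per vector, with unique parents (`childVec_inj`, `Valid.exists_parent`), and with weights that do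
not decrease away from the root. Best-first search pops them in order of weight and never creates a
vector twice. After `k` pops at most `1 + 2 * m * k` entries exist, so a queue operation takes time
`O(log k)`, independently of `n`. The weight of a new vector is recomputed from the tables in
constant time, hence `⊗` needs no inverse; monotonicity of `⊗` is mere distributivity
(`DLe.mul_left`).

Min-weight semantics rests on `Plan.prefixOpt`, which interpolates between the weight of an answer
(prefix `m`) and the weight of a full witness (prefix `N`). Lengthening the prefix never decreases
it and keeps it if position `1` is chosen; this gives `Plan.Rep.isMinWeight`.

The algorithm is written in a small structured language with a weakest-precondition calculus, whose
clock measures the time since the last output. `Cmd.sim` transfers runs to the machine at the price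
of a constant factor. The search is governed by `SearchInv` and `EnumInv`, and
`enumerates_enumerate` puts everything together. -/

namespace RankedEnum

set_option linter.unusedSectionVars false

/-! ### A structured language on top of the machine -/

/-- Scalar registers. -/
inductive Sc
  | one | zero | k | sz | ok | t | cn | kid | cur | ch | ch1 | ia | ib | ic | n | hs | next | cid | lp
deriving DecidableEq

/-- Registers: one for every query variable, one for every coordinate of a position vector, and
the scalar registers. -/
inductive Reg
  | var (x : ℕ) | pos (i : ℕ) | sc (a : Sc)
deriving DecidableEq

/-- Names of arrays. -/
inductive Tag
  | inp (R : ℕ) | cnt (i : ℕ) | heap (i : ℕ) | seen (i : ℕ) | hz (i : ℕ) | ow (i : ℕ)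
  | pv | pq | pw
deriving DecidableEq

/-- States of the structured language. The clock is the time since the last output. -/
structure St (α : Type u) (W : Type v) where
  reg : Reg → Word α
  wreg : ℕ → W
  arr : Tag → List (Word α) → Word α
  warr : Tag → List (Word α) → W
  clock : ℕ
  log : List (Output α W)

inductive Prim
  | const (r : Reg) (k : ℕ)
  | move (r s : Reg)
  | add (r s t : Reg)
  | sub (r s t : Reg)
  | half (r s : Reg)
  | load (r : Reg) (t : Tag) (key : List Reg)
  | store (t : Tag) (key : List Reg) (r : Reg)
  | wone (r : ℕ)
  | wmul (r s t : ℕ)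
  | wload (r : ℕ) (t : Tag) (key : List Reg)
  | wstore (t : Tag) (key : List Reg) (r : ℕ)
  | emit (rs : List Reg) (w : ℕ)

inductive Cond
  | eq (r s : Reg) | lt (r s : Reg) | wle (r s : ℕ)

/-- Structured commands; `loop b p` repeats `p` until `b` holds. -/
inductive Cmd
  | skip
  | prim (o : Prim)
  | seq (p q : Cmd)
  | ite (b : Cond) (p q : Cmd)
  | loop (b : Cond) (p : Cmd)

def seqs : List Cmd → Cmd
  | [] => .skip
  | p :: l => .seq p (seqs l)

section Semantics

variable {α : Type u} {W : Type v}

/-- One unit of time, the price of a test or a jump. The else branch of a conditional pays it twice,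
because its machine code ends with a jump over the then branch. -/
def St.tick (s : St α W) : St α W := { s with clock := s.clock + 1 }

@[simp] theorem St.tick_reg (s : St α W) : s.tick.reg = s.reg := rfl
@[simp] theorem St.tick_wreg (s : St α W) : s.tick.wreg = s.wreg := rfl
@[simp] theorem St.tick_arr (s : St α W) : s.tick.arr = s.arr := rfl
@[simp] theorem St.tick_warr (s : St α W) : s.tick.warr = s.warr := rfl
@[simp] theorem St.tick_log (s : St α W) : s.tick.log = s.log := rfl
@[simp] theorem St.tick_clock (s : St α W) : s.tick.clock = s.clock + 1 := rfl

variable [CommSemiring W]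

-- All primitives are charged one unit, whatever the length of an address or an output tuple;
-- `Prim.width` makes up for this in the simulation. An output records the elapsed gap and resets
-- the clock.
open Classical in
noncomputable def Prim.app (o : Prim) (s : St α W) : St α W :=
  match o with
  | .const r k => { s with clock := s.clock + 1, reg := Function.update s.reg r (.num k) }
  | .move r t => { s with clock := s.clock + 1, reg := Function.update s.reg r (s.reg t) }
  | .add r t t' =>
      { s with
        clock := s.clock + 1
        reg := Function.update s.reg r (.num ((s.reg t).toNat + (s.reg t').toNat)) }
  | .sub r t t' =>
      { s with
        clock := s.clock + 1
        reg := Function.update s.reg r (.num ((s.reg t).toNat - (s.reg t').toNat)) }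
  | .half r t =>
      { s with
        clock := s.clock + 1
        reg := Function.update s.reg r (.num ((s.reg t).toNat / 2)) }
  | .load r t key =>
      { s with clock := s.clock + 1, reg := Function.update s.reg r (s.arr t (key.map s.reg)) }
  | .store t key r =>
      { s with
        clock := s.clock + 1
        arr := Function.update s.arr t (Function.update (s.arr t) (key.map s.reg) (s.reg r)) }
  | .wone r => { s with clock := s.clock + 1, wreg := Function.update s.wreg r 1 }
  | .wmul r t t' =>
      { s with clock := s.clock + 1, wreg := Function.update s.wreg r (s.wreg t * s.wreg t') }
  | .wload r t key =>
      { s with clock := s.clock + 1, wreg := Function.update s.wreg r (s.warr t (key.map s.reg)) }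
  | .wstore t key r =>
      { s with
        clock := s.clock + 1
        warr := Function.update s.warr t (Function.update (s.warr t) (key.map s.reg) (s.wreg r)) }
  | .emit rs w =>
      { s with
        clock := 0
        log := s.log ++ [⟨s.clock + 1, rs.map s.reg, s.wreg w⟩] }

def Cond.holds (b : Cond) (s : St α W) : Prop :=
  match b with
  | .eq r t => s.reg r = s.reg t
  | .lt r t => (s.reg r).toNat < (s.reg t).toNat
  | .wle r t => DLe (s.wreg r) (s.wreg t)

/-- The loop condition is met after exactly `n` runs of the body, with `Q` afterwards. -/
def iterWp (b : St α W → Prop) (f : (St α W → Prop) → St α W → Prop) (Q : St α W → Prop) :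
    ℕ → St α W → Prop
  | 0, s => b s ∧ Q s.tick
  | n + 1, s => ¬ b s ∧ f (fun s' => iterWp b f Q n s'.tick) s.tick

/-- `p.wp Q s`: started in `s`, the command `p` terminates in a state that satisfies `Q`. -/
def Cmd.wp : Cmd → (St α W → Prop) → St α W → Prop
  | .skip, Q, s => Q s
  | .prim o, Q, s => Q (o.app s)
  | .seq p q, Q, s => p.wp (q.wp Q) s
  | .ite b p q, Q, s =>
      (b.holds s → p.wp Q s.tick) ∧ (¬ b.holds s → q.wp (fun s' => Q s'.tick) s.tick)
  | .loop b p, Q, s => ∃ n, iterWp b.holds (fun R s => p.wp R s) Q n s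

theorem Cmd.wp_mono (p : Cmd) : ∀ {Q R : St α W → Prop} {s : St α W},
    p.wp Q s → (∀ s', Q s' → R s') → p.wp R s := by
  induction p with
  | skip => intro Q R s h hQ; exact hQ _ h
  | prim o => intro Q R s h hQ; exact hQ _ h
  | seq p q ihp ihq => intro Q R s h hQ; exact ihp h fun s' h' => ihq h' hQ
  | ite b p q ihp ihq =>
    intro Q R s h hQ
    exact ⟨fun hb => ihp (h.1 hb) hQ, fun hb => ihq (h.2 hb) fun s' h' => hQ _ h'⟩
  | loop b p ih =>
    rintro Q R s ⟨n, h⟩ hQ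
    refine ⟨n, ?_⟩
    induction n generalizing s with
    | zero => exact ⟨h.1, hQ _ h.2⟩
    | succ n ihn => exact ⟨h.1, ih h.2 fun s' h' => ihn h'⟩

/-- Commands are deterministic, so an existential in the postcondition can be moved to the front.
The loop rule needs this: the number of remaining rounds is known only after the body has run, but
must be fixed before it. -/
theorem Cmd.wp_exists (p : Cmd) : ∀ {ι : Type} {Q : ι → St α W → Prop} {s : St α W},
    p.wp (fun s' => ∃ i, Q i s') s → ∃ i, p.wp (Q i) s := by
  induction p with
  | skip => intro ι Q s h; exact h
  | prim o => intro ι Q s h; exact h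
  | seq p q ihp ihq => intro ι Q s h; exact ihp (p.wp_mono h fun s' h' => ihq h')
  | ite b p q ihp ihq =>
    intro ι Q s h
    by_cases hb : b.holds s
    · obtain ⟨i, hi⟩ := ihp (h.1 hb)
      exact ⟨i, fun _ => hi, fun h => absurd hb h⟩
    · obtain ⟨i, hi⟩ := ihq (h.2 hb)
      exact ⟨i, fun h => absurd h hb, fun _ => hi⟩
  | loop b p ih =>
    rintro ι Q s ⟨n, h⟩
    suffices ∃ i, iterWp b.holds (fun R s => p.wp R s) (Q i) n s by
      obtain ⟨i, hi⟩ := this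
      exact ⟨i, n, hi⟩
    induction n generalizing s with
    | zero =>
      obtain ⟨i, hi⟩ := h.2
      exact ⟨i, h.1, hi⟩
    | succ n ihn =>
      obtain ⟨i, hi⟩ := ih (p.wp_mono h.2 fun s' h' => ihn h')
      exact ⟨i, h.1, hi⟩

/-! ### Frames and costs -/

/-- The union of `f o` over the primitive operations `o` of a command. -/
def Cmd.collect {β : Type} (f : Prim → Set β) : Cmd → Set β
  | .skip => ∅
  | .prim o => f o
  | .seq p q => p.collect f ∪ q.collect f
  | .ite _ p q => p.collect f ∪ q.collect f
  | .loop _ p => p.collect f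

def Prim.wr : Prim → Set Reg
  | .const r _ => {r}
  | .move r _ => {r}
  | .add r _ _ => {r}
  | .sub r _ _ => {r}
  | .half r _ => {r}
  | .load r _ _ => {r}
  | _ => ∅

def Prim.wwr : Prim → Set ℕ
  | .wone r => {r}
  | .wmul r _ _ => {r}
  | .wload r _ _ => {r}
  | _ => ∅

def Prim.wt : Prim → Set Tag
  | .store t _ _ => {t}
  | _ => ∅

def Prim.wwt : Prim → Set Tag
  | .wstore t _ _ => {t}
  | _ => ∅

def Prim.emits : Prim → Set Unit
  | .emit _ _ => {()}
  | _ => ∅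

/-- What a run of `p` from `s` to `s'` leaves unchanged. -/
structure Fr (p : Cmd) (s s' : St α W) : Prop where
  reg : ∀ r, r ∉ p.collect Prim.wr → s'.reg r = s.reg r
  wreg : ∀ r, r ∉ p.collect Prim.wwr → s'.wreg r = s.wreg r
  arr : ∀ t, t ∉ p.collect Prim.wt → s'.arr t = s.arr t
  warr : ∀ t, t ∉ p.collect Prim.wwt → s'.warr t = s.warr t
  log : () ∉ p.collect Prim.emits → s'.log = s.log

omit [CommSemiring W] in
theorem Fr.refl (p : Cmd) (s : St α W) : Fr p s s :=
  ⟨fun _ _ => rfl, fun _ _ => rfl, fun _ _ => rfl, fun _ _ => rfl, fun _ => rfl⟩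

omit [CommSemiring W] in
theorem Fr.trans {p : Cmd} {s s' s'' : St α W} (h : Fr p s s') (h' : Fr p s' s'') : Fr p s s'' :=
  ⟨fun r hr => (h'.reg r hr).trans (h.reg r hr), fun r hr => (h'.wreg r hr).trans (h.wreg r hr),
    fun t ht => (h'.arr t ht).trans (h.arr t ht), fun t ht => (h'.warr t ht).trans (h.warr t ht),
    fun ht => (h'.log ht).trans (h.log ht)⟩

omit [CommSemiring W] in
theorem Fr.tick_right {p : Cmd} {s s' : St α W} (h : Fr p s s') : Fr p s s'.tick :=
  ⟨h.reg, h.wreg, h.arr, h.warr, h.log⟩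

omit [CommSemiring W] in
theorem Fr.tick_left {p : Cmd} {s s' : St α W} (h : Fr p s.tick s') : Fr p s s' :=
  ⟨h.reg, h.wreg, h.arr, h.warr, h.log⟩

omit [CommSemiring W] in
theorem Fr.mono {p q : Cmd} {s s' : St α W} (h : Fr p s s')
    (hpq : ∀ {β : Type} (f : Prim → Set β), p.collect f ⊆ q.collect f) : Fr q s s' :=
  ⟨fun r hr => h.reg r fun h => hr (hpq _ h), fun r hr => h.wreg r fun h => hr (hpq _ h),
    fun t ht => h.arr t fun h => ht (hpq _ h), fun t ht => h.warr t fun h => ht (hpq _ h),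
    fun ht => h.log fun h => ht (hpq _ h)⟩

theorem Fr.prim (o : Prim) (s : St α W) : Fr (.prim o) s (o.app s) := by
  constructor <;> cases o <;>
    simp +contextual [Cmd.collect, Prim.app, Prim.wr, Prim.wwr, Prim.wt, Prim.wwt, Prim.emits]

/-- What a command leaves alone can be read off its syntax. Specifications therefore mention only
what changes. -/
theorem Cmd.wp_frame (p : Cmd) : ∀ {Q : St α W → Prop} {s : St α W},
    p.wp Q s → p.wp (fun s' => Q s' ∧ Fr p s s') s := by
  induction p with
  | skip => intro Q s h; exact ⟨h, .refl _ _⟩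
  | prim o => intro Q s h; exact ⟨h, .prim _ _⟩
  | seq p q ihp ihq =>
    intro Q s h
    refine p.wp_mono (ihp h) fun s' h' => q.wp_mono (ihq h'.1) fun s'' h'' => ⟨h''.1, ?_⟩
    exact (h'.2.mono fun f => Set.subset_union_left).trans
      (h''.2.mono fun f => Set.subset_union_right)
  | ite b p q ihp ihq =>
    intro Q s h
    refine ⟨fun hb => p.wp_mono (ihp (h.1 hb)) fun s' h' => ⟨h'.1, ?_⟩,
      fun hb => q.wp_mono (ihq (h.2 hb)) fun s' h' => ⟨h'.1, ?_⟩⟩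
    · exact h'.2.tick_left.mono fun f => Set.subset_union_left
    · exact h'.2.tick_left.tick_right.mono fun f => Set.subset_union_right
  | loop b p ih =>
    rintro Q s ⟨n, h⟩
    refine ⟨n, ?_⟩
    suffices ∀ s₀ : St α W, Fr p s₀ s →
        iterWp b.holds (fun R s => p.wp R s) (fun s' => Q s' ∧ Fr (.loop b p) s₀ s') n s from
      this s (.refl _ _)
    induction n generalizing s with
    | zero => intro s₀ h₀; exact ⟨h.1, h.2, h₀.tick_right.mono fun f => subset_rfl⟩
    | succ n ihn =>
      intro s₀ h₀
      exact ⟨h.1, p.wp_mono (ih h.2) fun s' h' =>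
        ihn h'.1 s₀ (h₀.trans h'.2.tick_left.tick_right)⟩

/-- Total correctness by a decreasing variant `n`. The frame relative to the initial state is
available in every round, so that invariants need not repeat it. -/
theorem Cmd.wp_loop {b : Cond} {p : Cmd} {Q : St α W → Prop} {s₀ : St α W}
    (Inv : ℕ → St α W → Prop) (n₀ : ℕ) (h₀ : Inv n₀ s₀)
    (hstep : ∀ n s, Fr p s₀ s → Inv n s → ¬ b.holds s →
      p.wp (fun s' => ∃ n' < n, Inv n' s'.tick) s.tick)
    (hexit : ∀ n s, Fr p s₀ s → Inv n s → b.holds s → Q s.tick) :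
    (Cmd.loop b p).wp Q s₀ := by
  suffices ∀ n s, Fr p s₀ s → Inv n s → (Cmd.loop b p).wp Q s from this n₀ s₀ (.refl _ _) h₀
  intro n
  induction n using Nat.strong_induction_on with
  | _ n ih =>
    intro s hfr hs
    by_cases hb : b.holds s
    · exact ⟨0, hb, hexit n s hfr hs hb⟩
    · have h1 := p.wp_frame (hstep n s hfr hs hb)
      have h2 : p.wp (fun s' => (Cmd.loop b p).wp Q s'.tick) s.tick :=
        p.wp_mono h1 fun s' ⟨⟨n', hn', hI⟩, hf⟩ =>
          ih n' hn' _ (hfr.trans hf.tick_left.tick_right) hI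
      obtain ⟨k, hk⟩ := p.wp_exists h2
      exact ⟨k + 1, hb, hk⟩

/-- Sequencing through a specification of the first command. -/
theorem Cmd.wp_use {p : Cmd} {Q R : St α W → Prop} {s : St α W} (h : p.wp Q s)
    (hR : ∀ s', Q s' → Fr p s s' → R s') : p.wp R s :=
  p.wp_mono (p.wp_frame h) fun s' h' => hR s' h'.1 h'.2

/-- No loops. -/
def Cmd.loopFree : Cmd → Prop
  | .skip => True
  | .prim _ => True
  | .seq p q => p.loopFree ∧ q.loopFree
  | .ite _ p q => p.loopFree ∧ q.loopFree
  | .loop _ _ => False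

/-- A bound on the running time of a command without loops. -/
def Cmd.cost : Cmd → ℕ
  | .skip => 0
  | .prim _ => 1
  | .seq p q => p.cost + q.cost
  | .ite _ p q => 2 + p.cost + q.cost
  | .loop _ _ => 0

/-- Only code without loops has a time bound that is determined by its syntax; the time of loops is
tracked inside their invariants. -/
theorem Cmd.wp_cost (p : Cmd) : ∀ {Q : St α W → Prop} {s : St α W}, p.loopFree →
    p.wp Q s → p.wp (fun s' => Q s' ∧ s'.clock ≤ s.clock + p.cost) s := by
  induction p with
  | skip => intro Q s _ h; exact ⟨h, le_rfl⟩
  | prim o =>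
    intro Q s _ h
    refine ⟨h, ?_⟩
    cases o <;> simp [Prim.app, Cmd.cost]
  | seq p q ihp ihq =>
    intro Q s hl h
    refine p.wp_mono (ihp hl.1 h) fun s' h' => q.wp_mono (ihq hl.2 h'.1) fun s'' h'' => ⟨h''.1, ?_⟩
    have := h'.2
    have := h''.2
    simp only [Cmd.cost]
    omega
  | ite b p q ihp ihq =>
    intro Q s hl h
    refine ⟨fun hb => p.wp_mono (ihp hl.1 (h.1 hb)) fun s' h' => ⟨h'.1, ?_⟩,
      fun hb => q.wp_mono (ihq hl.2 (h.2 hb)) fun s' h' => ⟨h'.1, ?_⟩⟩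
    all_goals
      have := h'.2
      simp only [Cmd.cost, St.tick_clock] at *
      omega
  | loop b p ih => intro Q s hl; exact hl.elim

theorem Cmd.wp_use_cost {p : Cmd} {Q R : St α W → Prop} {s : St α W} (hl : p.loopFree)
    (h : p.wp Q s) (hR : ∀ s', Q s' → Fr p s s' → s'.clock ≤ s.clock + p.cost → R s') :
    p.wp R s :=
  p.wp_mono (p.wp_frame (p.wp_cost hl h)) fun s' h' => hR s' h'.1.1 h'.2 h'.1.2

end Semantics

@[simp] theorem Word.toNat_num {α : Type u} (k : ℕ) : (Word.num k : Word α).toNat = k := rfl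

/-! ### Compilation -/

def Sc.code : Sc → ℕ
  | .one => 0 | .zero => 1 | .k => 2 | .sz => 3 | .ok => 4 | .t => 5 | .cn => 6 | .kid => 7
  | .cur => 8 | .ch => 9 | .ch1 => 10 | .ia => 11 | .ib => 12 | .ic => 13 | .n => 14 | .hs => 15
  | .next => 16 | .cid => 17 | .lp => 18

theorem Sc.code_injective : Function.Injective Sc.code := by
  intro a b h
  cases a <;> cases b <;> first | rfl | (simp [Sc.code] at h)

/-- Register `0` of the machine is reserved for array names. -/
def Reg.code : Reg → ℕ
  | .var x => 3 * x + 1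
  | .pos i => 3 * i + 2
  | .sc a => 3 * a.code + 3

theorem Reg.code_injective : Function.Injective Reg.code := by
  intro a b h
  cases a <;> cases b <;> simp only [Reg.code] at h <;> try omega
  · congr 1; omega
  · congr 1; omega
  · congr 1; exact Sc.code_injective (by omega)

theorem Reg.code_ne_zero (r : Reg) : r.code ≠ 0 := by
  cases r <;> simp [Reg.code]

/-- The first component of the addresses of an array; the numbers below `nR` belong to the input. -/
def Tag.code (nR : ℕ) : Tag → ℕ
  | .inp R => if R < nR then R else nR + 9 * R
  | .cnt i => nR + (9 * i + 1)
  | .heap i => nR + (9 * i + 2)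
  | .seen i => nR + (9 * i + 3)
  | .hz i => nR + (9 * i + 4)
  | .ow i => nR + (9 * i + 5)
  | .pv => nR + 6
  | .pq => nR + 7
  | .pw => nR + 8

theorem Tag.code_injective (nR : ℕ) : Function.Injective (Tag.code nR) := by
  intro a b h
  cases a <;> cases b <;> simp only [Tag.code] at h <;>
    first
    | rfl
    | (exfalso; split_ifs at h <;> omega)
    | (congr 1; split_ifs at h <;> omega)
    | (congr 1; omega)

def Prim.code (nR : ℕ) : Prim → List Instr
  | .const r k => [.const r.code k]
  | .move r s => [.move r.code s.code]
  | .add r s t => [.add r.code s.code t.code]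
  | .sub r s t => [.sub r.code s.code t.code]
  | .half r s => [.half r.code s.code]
  | .load r t key => [.const 0 (t.code nR), .load r.code (0 :: key.map Reg.code)]
  | .store t key r => [.const 0 (t.code nR), .store (0 :: key.map Reg.code) r.code]
  | .wone r => [.wone r]
  | .wmul r s t => [.wmul r s t]
  | .wload r t key => [.const 0 (t.code nR), .wload r (0 :: key.map Reg.code)]
  | .wstore t key r => [.const 0 (t.code nR), .wstore (0 :: key.map Reg.code) r]
  | .emit rs w => [.emit (rs.map Reg.code) w]

def Cond.jump : Cond → ℕ → Instr
  | .eq r s, l => .jeq r.code s.code l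
  | .lt r s, l => .jlt r.code s.code l
  | .wle r s, l => .wjle r s l

def Cmd.len (nR : ℕ) : Cmd → ℕ
  | .skip => 0
  | .prim o => (o.code nR).length
  | .seq p q => p.len nR + q.len nR
  | .ite _ p q => p.len nR + q.len nR + 2
  | .loop _ p => p.len nR + 2

/-- The machine code of a command, placed at address `o`. -/
def Cmd.code (nR : ℕ) : Cmd → ℕ → List Instr
  | .skip, _ => []
  | .prim p, _ => p.code nR
  | .seq p q, o => p.code nR o ++ q.code nR (o + p.len nR)
  | .ite b p q, o =>
      [b.jump (o + q.len nR + 2)] ++ q.code nR (o + 1) ++ [.jmp (o + q.len nR + 2 + p.len nR)] ++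
        p.code nR (o + q.len nR + 2)
  | .loop b p, o => [b.jump (o + p.len nR + 2)] ++ p.code nR (o + 1) ++ [.jmp o]

theorem Cmd.length_code (nR : ℕ) (p : Cmd) : ∀ o, (p.code nR o).length = p.len nR := by
  induction p with
  | skip => intro o; rfl
  | prim o => intro _; rfl
  | seq p q ihp ihq => intro o; simp [Cmd.code, Cmd.len, ihp, ihq]
  | ite b p q ihp ihq => intro o; simp [Cmd.code, Cmd.len, ihp, ihq]; omega
  | loop b p ih => intro o; simp [Cmd.code, Cmd.len, ih]

/-- `l` is the part of the program `P` that starts at address `o`. -/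
def CodeAt (P : Program) (o : ℕ) (l : List Instr) : Prop :=
  ∃ l₁ l₂, P = l₁ ++ l ++ l₂ ∧ l₁.length = o

theorem CodeAt.left {P : Program} {o : ℕ} {l l' : List Instr} (h : CodeAt P o (l ++ l')) :
    CodeAt P o l := by
  obtain ⟨l₁, l₂, rfl, h⟩ := h
  exact ⟨l₁, l' ++ l₂, by simp, h⟩

theorem CodeAt.right {P : Program} {o : ℕ} {l l' : List Instr} (h : CodeAt P o (l ++ l')) :
    CodeAt P (o + l.length) l' := by
  obtain ⟨l₁, l₂, rfl, h⟩ := h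
  exact ⟨l₁ ++ l, l₂, by simp, by simp [h]⟩

theorem CodeAt.get {P : Program} {o : ℕ} {i : Instr} (h : CodeAt P o [i]) : P[o]? = some i := by
  obtain ⟨l₁, l₂, rfl, rfl⟩ := h
  simp

/-! ### Comparison of event times on the two levels -/

/-- Every event happens at most `B` times its gap after its predecessor. -/
def GapsBound (B : ℕ) : ℕ → List ℕ → List ℕ → Prop
  | t₀, g :: gs, t :: ts => t ≤ t₀ + B * g ∧ GapsBound B t gs ts
  | _, [], [] => True
  | _, _, _ => False

/-- Running on without output only prolongs the last gap, the one that is still open. -/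
theorem GapsBound.last {B : ℕ} {t t' g d : ℕ} (ht : t' ≤ t + B * d) : ∀ {gs ts : List ℕ} {t₀ : ℕ},
    GapsBound B t₀ (gs ++ [g]) (ts ++ [t]) → GapsBound B t₀ (gs ++ [g + d]) (ts ++ [t'])
  | [], [], t₀, h => by
    simp only [List.nil_append, GapsBound, and_true] at h ⊢
    rw [mul_add]
    omega
  | [], [_], t₀, h => by simp [GapsBound] at h
  | [], _ :: _ :: _, t₀, h => by simp [GapsBound] at h
  | [_], [], t₀, h => by simp [GapsBound] at h
  | _ :: _ :: _, [], t₀, h => by simp [GapsBound] at h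
  | _ :: gs, _ :: ts, t₀, h => ⟨h.1, GapsBound.last ht h.2⟩

/-- An output closes the open gap and opens one of length zero at the same instant. -/
theorem GapsBound.snoc {B : ℕ} {t g : ℕ} : ∀ {gs ts : List ℕ} {t₀ : ℕ},
    GapsBound B t₀ (gs ++ [g]) (ts ++ [t]) →
      GapsBound B t₀ (gs ++ [g] ++ [0]) (ts ++ [t] ++ [t])
  | [], [], t₀, h => by simpa [GapsBound] using h
  | [], [_], t₀, h => by simp [GapsBound] at h
  | [], _ :: _ :: _, t₀, h => by simp [GapsBound] at h
  | [_], [], t₀, h => by simp [GapsBound] at h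
  | _ :: _ :: _, [], t₀, h => by simp [GapsBound] at h
  | _ :: gs, _ :: ts, t₀, h => ⟨h.1, GapsBound.snoc h.2⟩

theorem GapsBound.first {B t₀ t : ℕ} {gs ts : List ℕ} (h : GapsBound B t₀ gs ts)
    (ht : ts[0]? = some t) : ∃ g, gs[0]? = some g ∧ t ≤ t₀ + B * g := by
  cases gs <;> cases ts <;> simp_all [GapsBound]

theorem GapsBound.next {B s t : ℕ} : ∀ {k t₀ : ℕ} {gs ts : List ℕ}, GapsBound B t₀ gs ts →
    ts[k]? = some s → ts[k + 1]? = some t → ∃ g, gs[k + 1]? = some g ∧ t ≤ s + B * g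
  | k, t₀, [], [], h, hs, ht => by simp at hs
  | k, t₀, [], _ :: _, h, hs, ht => h.elim
  | k, t₀, _ :: _, [], h, hs, ht => h.elim
  | 0, t₀, g :: gs, t' :: ts, h, hs, ht => by
    simp only [List.getElem?_cons_zero, Option.some.injEq] at hs
    subst hs
    simpa using h.2.first (by simpa using ht)
  | k + 1, t₀, g :: gs, t' :: ts, h, hs, ht => by
    simpa using h.2.next (k := k) (by simpa using hs) (by simpa using ht)

def Prim.width : Prim → ℕ
  | .load _ _ key => key.length + 3
  | .store _ key _ => key.length + 3
  | .wload _ _ key => key.length + 3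
  | .wstore _ key _ => key.length + 3
  | .emit rs _ => rs.length + 1
  | _ => 1

/-- A bound on the cost of the primitive operations of a command. -/
def Cmd.width : Cmd → ℕ
  | .skip => 1
  | .prim o => o.width
  | .seq p q => max p.width q.width
  | .ite _ p q => max 1 (max p.width q.width)
  | .loop _ p => max 1 p.width

/-! ### Simulation of structured commands by the machine -/

section Simulation

variable {α : Type u} {W : Type v} [CommSemiring W]

/-- The machine configuration `c` represents the state `s`. -/
structure Sim (nR B : ℕ) (s : St α W) (c : Config α W) : Prop where
  reg : ∀ r : Reg, c.reg r.code = s.reg r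
  wreg : c.wreg = s.wreg
  arr : ∀ (t : Tag) (key), c.mem (.num (t.code nR) :: key) = s.arr t key
  warr : ∀ (t : Tag) (key), c.wmem (.num (t.code nR) :: key) = s.warr t key
  tuples : c.log.map Output.tuple = s.log.map Output.tuple
  weights : c.log.map Output.weight = s.log.map Output.weight
  gaps : GapsBound B 0 (s.log.map Output.time ++ [s.clock]) (c.log.map Output.time ++ [c.clock])

omit [CommSemiring W] in
theorem Sim.tick {nR B : ℕ} {s : St α W} {c : Config α W} (h : Sim nR B s c) (hB : 1 ≤ B) (o : ℕ) :
    Sim nR B s.tick { c with pc := o, clock := c.clock + 1 } :=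
  ⟨h.reg, h.wreg, h.arr, h.warr, h.tuples, h.weights, h.gaps.last (by simp only; omega)⟩

theorem step_eq {P : Program} {c : Config α W} {i : Instr} (h : P[c.pc]? = some i) :
    step P c = { i.exec c with clock := c.clock + i.cost } := by
  simp [step, h]

theorem Cond.jump_exec {nR B : ℕ} {s : St α W} {c : Config α W} (h : Sim nR B s c) (b : Cond)
    (l : ℕ) [Decidable (b.holds s)] :
    { (b.jump l).exec c with clock := c.clock + (b.jump l).cost } =
      { c with pc := if b.holds s then l else c.pc + 1, clock := c.clock + 1 } := by
  cases b <;> simp [Cond.jump, Instr.exec, Instr.cost, Cond.holds, h.reg, h.wreg] <;> congr <;>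
    simp [h.reg, h.wreg]

/-- Register `0` holds the name of an array during an access. No register of the structured language
is coded by `0`, so the rest of the address is unaffected. -/
theorem map_code_update_zero (g : ℕ → Word α) (w : Word α) (key : List Reg) :
    (key.map Reg.code).map (Function.update g 0 w) = (key.map Reg.code).map g := by
  rw [List.map_map, List.map_map]
  refine List.map_congr_left fun r _ => ?_
  simp [Reg.code_ne_zero]

omit [CommSemiring W] in
theorem Sim.map_reg {nR B : ℕ} {s : St α W} {c : Config α W} (h : Sim nR B s c) (key : List Reg) :
    (key.map Reg.code).map c.reg = key.map s.reg := by
  rw [List.map_map]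
  exact List.map_congr_left fun r _ => h.reg r

omit [CommSemiring W] in
theorem Sim.update_reg {nR B : ℕ} {s : St α W} {c : Config α W} (h : Sim nR B s c) (r : Reg)
    (w : Word α) (r' : Reg) :
    Function.update c.reg r.code w r'.code = Function.update s.reg r w r' := by
  by_cases hr : r' = r
  · subst hr; simp
  · rw [Function.update_of_ne hr, Function.update_of_ne (Reg.code_injective.ne hr), h.reg]

/-- The machine spends at most `o.width` units where the structured clock advances by one; this is
the source of the factor `B`. A memory access takes two instructions, the first of which loads the
name of the array. -/
theorem Prim.sim {nR B : ℕ} {P : Program} {s : St α W} {c : Config α W} (o : Prim)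
    (hB : o.width ≤ B) (hP : CodeAt P c.pc (o.code nR)) (h : Sim nR B s c) :
    ∃ k, Sim nR B (o.app s) ((step P)^[k] c) ∧
      ((step P)^[k] c).pc = c.pc + (o.code nR).length := by
  cases o with
  | const r k =>
    refine ⟨1, ?_⟩
    simp only [Prim.code] at hP
    rw [Function.iterate_one, step_eq hP.get]
    exact ⟨⟨h.update_reg r _, h.wreg, h.arr, h.warr, h.tuples, h.weights,
      h.gaps.last (by simp [Instr.cost, Prim.width] at *; omega)⟩, rfl⟩
  | move r t =>
    refine ⟨1, ?_⟩
    simp only [Prim.code] at hP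
    rw [Function.iterate_one, step_eq hP.get]
    simp only [Instr.exec, Prim.app, h.reg]
    exact ⟨⟨h.update_reg r _, h.wreg, h.arr, h.warr, h.tuples, h.weights,
      h.gaps.last (by simp [Instr.cost, Prim.width] at *; omega)⟩, rfl⟩
  | add r t t' =>
    refine ⟨1, ?_⟩
    simp only [Prim.code] at hP
    rw [Function.iterate_one, step_eq hP.get]
    simp only [Instr.exec, Prim.app, h.reg]
    exact ⟨⟨h.update_reg r _, h.wreg, h.arr, h.warr, h.tuples, h.weights,
      h.gaps.last (by simp [Instr.cost, Prim.width] at *; omega)⟩, rfl⟩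
  | sub r t t' =>
    refine ⟨1, ?_⟩
    simp only [Prim.code] at hP
    rw [Function.iterate_one, step_eq hP.get]
    simp only [Instr.exec, Prim.app, h.reg]
    exact ⟨⟨h.update_reg r _, h.wreg, h.arr, h.warr, h.tuples, h.weights,
      h.gaps.last (by simp [Instr.cost, Prim.width] at *; omega)⟩, rfl⟩
  | half r t =>
    refine ⟨1, ?_⟩
    simp only [Prim.code] at hP
    rw [Function.iterate_one, step_eq hP.get]
    simp only [Instr.exec, Prim.app, h.reg]
    exact ⟨⟨h.update_reg r _, h.wreg, h.arr, h.warr, h.tuples, h.weights,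
      h.gaps.last (by simp [Instr.cost, Prim.width] at *; omega)⟩, rfl⟩
  | wone r =>
    refine ⟨1, ?_⟩
    simp only [Prim.code] at hP
    rw [Function.iterate_one, step_eq hP.get]
    simp only [Instr.exec, Prim.app, h.wreg]
    exact ⟨⟨h.reg, rfl, h.arr, h.warr, h.tuples, h.weights,
      h.gaps.last (by simp [Instr.cost, Prim.width] at *; omega)⟩, rfl⟩
  | wmul r t t' =>
    refine ⟨1, ?_⟩
    simp only [Prim.code] at hP
    rw [Function.iterate_one, step_eq hP.get]
    simp only [Instr.exec, Prim.app, h.wreg]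
    exact ⟨⟨h.reg, rfl, h.arr, h.warr, h.tuples, h.weights,
      h.gaps.last (by simp [Instr.cost, Prim.width] at *; omega)⟩, rfl⟩
  | emit rs w =>
    refine ⟨1, ?_⟩
    simp only [Prim.code] at hP
    rw [Function.iterate_one, step_eq hP.get]
    simp only [Instr.exec, Prim.app, h.wreg, h.map_reg]
    refine ⟨⟨h.reg, rfl, h.arr, h.warr, by simp [h.tuples], by simp [h.weights], ?_⟩, rfl⟩
    have := (h.gaps.last (t' := c.clock + (Instr.emit (rs.map Reg.code) w).cost) (d := 1)
      (by simp [Instr.cost, Prim.width] at *; omega)).snoc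
    simpa using this
  | load r t key =>
    refine ⟨2, ?_⟩
    simp only [Prim.code] at hP
    rw [Function.iterate_succ_apply, Function.iterate_one, step_eq (c := c) (hP.left (l := [_])).get]
    rw [step_eq (by exact (hP.right (l := [_])).get)]
    simp only [Instr.exec, Prim.app, List.map_cons, map_code_update_zero, h.map_reg,
      Function.update_self, h.arr]
    refine ⟨⟨fun r' => ?_, h.wreg, h.arr, h.warr, h.tuples, h.weights,
      h.gaps.last (by simp [Instr.cost, Prim.width] at *; omega)⟩, rfl⟩
    simp only
    rw [Function.update_comm (Ne.symm r.code_ne_zero), Function.update_of_ne r'.code_ne_zero]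
    exact h.update_reg r _ r'
  | store t key r =>
    refine ⟨2, ?_⟩
    simp only [Prim.code] at hP
    rw [Function.iterate_succ_apply, Function.iterate_one, step_eq (c := c) (hP.left (l := [_])).get]
    rw [step_eq (by exact (hP.right (l := [_])).get)]
    simp only [Instr.exec, Prim.app, List.map_cons, map_code_update_zero, h.map_reg,
      Function.update_self, Function.update_of_ne r.code_ne_zero, h.reg]
    refine ⟨⟨fun r' => ?_, h.wreg, fun t' key' => ?_, h.warr, h.tuples, h.weights,
      h.gaps.last (by simp [Instr.cost, Prim.width] at *; omega)⟩, rfl⟩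
    · simp only [Function.update_of_ne r'.code_ne_zero, h.reg]
    · by_cases ht : t' = t
      · subst ht
        by_cases hk : key' = key.map s.reg <;> simp [hk, h.arr]
      · have := (Tag.code_injective nR).ne ht
        simp [h.arr, ht, this]
  | wload r t key =>
    refine ⟨2, ?_⟩
    simp only [Prim.code] at hP
    rw [Function.iterate_succ_apply, Function.iterate_one, step_eq (c := c) (hP.left (l := [_])).get]
    rw [step_eq (by exact (hP.right (l := [_])).get)]
    simp only [Instr.exec, Prim.app, List.map_cons, map_code_update_zero, h.map_reg,
      Function.update_self, h.warr, h.wreg]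
    refine ⟨⟨fun r' => ?_, rfl, h.arr, h.warr, h.tuples, h.weights,
      h.gaps.last (by simp [Instr.cost, Prim.width] at *; omega)⟩, rfl⟩
    simp only [Function.update_of_ne r'.code_ne_zero, h.reg]
  | wstore t key r =>
    refine ⟨2, ?_⟩
    simp only [Prim.code] at hP
    rw [Function.iterate_succ_apply, Function.iterate_one, step_eq (c := c) (hP.left (l := [_])).get]
    rw [step_eq (by exact (hP.right (l := [_])).get)]
    simp only [Instr.exec, Prim.app, List.map_cons, map_code_update_zero, h.map_reg,
      Function.update_self, h.wreg]
    refine ⟨⟨fun r' => ?_, rfl, h.arr, fun t' key' => ?_, h.tuples, h.weights,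
      h.gaps.last (by simp [Instr.cost, Prim.width] at *; omega)⟩, rfl⟩
    · simp only [Function.update_of_ne r'.code_ne_zero, h.reg]
    · by_cases ht : t' = t
      · subst ht
        by_cases hk : key' = key.map s.reg <;> simp [hk, h.warr]
      · have := (Tag.code_injective nR).ne ht
        simp [h.warr, ht, this]

/-- Machine code simulates structured commands. -/
theorem Cmd.sim {nR B : ℕ} {P : Program} (hB1 : 1 ≤ B) (p : Cmd) :
    ∀ {Q : St α W → Prop} {s : St α W} {c : Config α W}, p.width ≤ B →
      CodeAt P c.pc (p.code nR c.pc) → Sim nR B s c → p.wp Q s →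
      ∃ k s', Q s' ∧ Sim nR B s' ((step P)^[k] c) ∧ ((step P)^[k] c).pc = c.pc + p.len nR := by
  induction p with
  | skip => intro Q s c _ _ hs h; exact ⟨0, s, h, hs, rfl⟩
  | prim o =>
    intro Q s c hB hP hs h
    obtain ⟨k, h1, h2⟩ := o.sim hB hP hs
    exact ⟨k, _, h, h1, h2⟩
  | seq p q ihp ihq =>
    intro Q s c hB hP hs h
    simp only [Cmd.width, sup_le_iff] at hB
    simp only [Cmd.code] at hP
    obtain ⟨k, s', h', hs', hpc⟩ := ihp hB.1 hP.left hs h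
    have hP' := hP.right
    rw [Cmd.length_code, ← hpc] at hP'
    obtain ⟨k', s'', h'', hs'', hpc'⟩ := ihq hB.2 hP' hs' h'
    rw [← Function.iterate_add_apply] at hs'' hpc'
    exact ⟨k' + k, s'', h'', hs'', by rw [hpc', hpc, Cmd.len, add_assoc]⟩
  | ite b p q ihp ihq =>
    intro Q s c hB hP hs h
    classical
    simp only [Cmd.width, sup_le_iff] at hB
    simp only [Cmd.code] at hP
    have h1 : step P c = { c with pc := if b.holds s then c.pc + q.len nR + 2 else c.pc + 1,
                                  clock := c.clock + 1 } := by
      rw [step_eq hP.left.left.left.get, Cond.jump_exec hs]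
    by_cases hb : b.holds s
    · have hP' := hP.right
      simp only [List.length_append, List.length_cons, List.length_nil, Cmd.length_code] at hP'
      obtain ⟨k, s', h', hs', hpc⟩ := ihp (c := step P c) hB.2.1
        (by rw [h1]; simp only [hb, if_true]; convert hP' using 1; omega)
        (by rw [h1]; exact hs.tick hB1 _) (h.1 hb)
      rw [← Function.iterate_succ_apply] at hs' hpc
      refine ⟨k + 1, s', h', hs', ?_⟩
      rw [hpc, h1]
      simp only [hb, if_true, Cmd.len]
      omega
    · have hP' := hP.left.left.right
      have hP'' := hP.left.right
      simp only [List.length_append, List.length_cons, List.length_nil, Cmd.length_code] at hP' hP''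
      obtain ⟨k, s', h', hs', hpc⟩ := ihq (c := step P c) hB.2.2
        (by rw [h1]; simp only [hb, if_false]; exact hP')
        (by rw [h1]; exact hs.tick hB1 _) (h.2 hb)
      rw [← Function.iterate_succ_apply] at hs' hpc
      have hpc' : ((step P)^[k + 1] c).pc = c.pc + (0 + 1 + q.len nR) := by
        rw [hpc, h1]
        simp only [hb, if_false]
        omega
      have h2 := step_eq (c := (step P)^[k + 1] c) (by rw [hpc']; exact hP''.get)
      rw [← Function.iterate_succ_apply' (step P)] at h2
      refine ⟨k + 2, s'.tick, h', ?_, ?_⟩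
      · rw [h2]
        exact hs'.tick hB1 _
      · rw [h2]
        simp only [Instr.exec, Cmd.len]
        omega
  | loop b p ih =>
    rintro Q s c hB hP hs ⟨n, h⟩
    classical
    simp only [Cmd.width, sup_le_iff] at hB
    simp only [Cmd.code] at hP
    induction n generalizing s c with
    | zero =>
      have h1 : step P c = { c with pc := if b.holds s then c.pc + p.len nR + 2 else c.pc + 1,
                                    clock := c.clock + 1 } := by
        rw [step_eq hP.left.left.get, Cond.jump_exec hs]
      refine ⟨1, s.tick, h.2, ?_, ?_⟩
      · rw [Function.iterate_one, h1]; exact hs.tick hB1 _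
      · rw [Function.iterate_one, h1]
        simp only [h.1, if_true, Cmd.len]
        omega
    | succ n ihn =>
      have hb := h.1
      have h1 : step P c = { c with pc := if b.holds s then c.pc + p.len nR + 2 else c.pc + 1,
                                    clock := c.clock + 1 } := by
        rw [step_eq hP.left.left.get, Cond.jump_exec hs]
      have hP' := hP.left.right
      have hP'' := hP.right
      simp only [List.length_append, List.length_cons, List.length_nil, Cmd.length_code] at hP' hP''
      obtain ⟨k, s', h', hs', hpc⟩ := ih (c := step P c) hB.2
        (by rw [h1]; simp only [hb, if_false]; exact hP')
        (by rw [h1]; exact hs.tick hB1 _) h.2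
      rw [← Function.iterate_succ_apply] at hs' hpc
      have hpc' : ((step P)^[k + 1] c).pc = c.pc + (0 + 1 + p.len nR) := by
        rw [hpc, h1]
        simp only [hb, if_false]
        omega
      have h2 := step_eq (c := (step P)^[k + 1] c) (by rw [hpc']; exact hP''.get)
      rw [← Function.iterate_succ_apply' (step P)] at h2
      -- The jump at the end of the body returns to the test, so the inner induction on the number
      -- of rounds applies to the same code.
      have h3 : ((step P)^[k + 2] c).pc = c.pc := by rw [h2]; rfl
      obtain ⟨k', s'', h'', hs'', hpc''⟩ := ihn (s := s'.tick) (c := (step P)^[k + 2] c)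
        (by rw [h3]; exact hP) (by rw [h2]; exact hs'.tick hB1 _) h'
      rw [← Function.iterate_add_apply] at hs'' hpc''
      exact ⟨k' + (k + 2), s'', h'', hs'', by rw [hpc'', h3]⟩

end Simulation

/-! ### The order of a selective dioid -/

section Order

variable {W : Type v} [CommSemiring W]

theorem DLe.trans {x y z : W} (h : DLe x y) (h' : DLe y z) : DLe x z := by
  unfold DLe at *
  rw [← h, add_assoc, h']

theorem IsSelective.refl (hW : IsSelective W) (x : W) : DLe x x := by
  rcases hW x x with h | h <;> exact h

theorem IsSelective.total (hW : IsSelective W) (x y : W) : DLe x y ∨ DLe y x := by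
  rcases hW x y with h | h
  · exact .inl h
  · exact .inr (by rw [DLe, add_comm]; exact h)

theorem IsSelective.le_of_not (hW : IsSelective W) {x y : W} (h : ¬ DLe x y) : DLe y x :=
  (hW.total x y).resolve_left h

/-- Distributivity is the only link between the order and the product; the monotonicity of all
weights rests on it. -/
theorem DLe.mul_left {x y : W} (h : DLe x y) (z : W) : DLe (z * x) (z * y) := by
  unfold DLe at *
  rw [← mul_add, h]

end Order

/-! ### Binary heaps in arrays -/

/-- `f'` arises from `f` by permuting the positions `1, ..., n`. -/
def Shuffle (n : ℕ) (f f' : ℕ → ℕ) : Prop :=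
  ∃ e : Equiv.Perm ℕ, (∀ p, ¬ (1 ≤ p ∧ p ≤ n) → e p = p) ∧ f' = f ∘ e

theorem Shuffle.refl (n : ℕ) (f : ℕ → ℕ) : Shuffle n f f := ⟨1, fun _ _ => rfl, rfl⟩

theorem Shuffle.trans {n : ℕ} {f g h : ℕ → ℕ} (h₁ : Shuffle n f g) (h₂ : Shuffle n g h) :
    Shuffle n f h := by
  obtain ⟨e, he, rfl⟩ := h₁
  obtain ⟨e', he', rfl⟩ := h₂
  refine ⟨e * e', fun p hp => ?_, rfl⟩
  rw [Equiv.Perm.mul_apply, he' p hp, he p hp]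

theorem Shuffle.swap {n : ℕ} (f : ℕ → ℕ) {a b : ℕ} (ha : 1 ≤ a ∧ a ≤ n) (hb : 1 ≤ b ∧ b ≤ n) :
    Shuffle n f (f ∘ Equiv.swap a b) :=
  ⟨Equiv.swap a b, fun p hp => Equiv.swap_apply_of_ne_of_ne (by rintro rfl; exact hp ha)
    (by rintro rfl; exact hp hb), rfl⟩

theorem Shuffle.range {n : ℕ} {e : Equiv.Perm ℕ} (he : ∀ p, ¬ (1 ≤ p ∧ p ≤ n) → e p = p) {p : ℕ}
    (hp : 1 ≤ p ∧ p ≤ n) : 1 ≤ e p ∧ e p ≤ n := by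
  by_contra h
  have := he _ h
  rw [e.injective this] at h
  exact h hp

theorem Shuffle.exists_pos {n : ℕ} {f f' : ℕ → ℕ} (h : Shuffle n f f') {p : ℕ}
    (hp : 1 ≤ p ∧ p ≤ n) : ∃ q, (1 ≤ q ∧ q ≤ n) ∧ f' q = f p := by
  obtain ⟨e, he, rfl⟩ := h
  refine ⟨e.symm p, ?_, by simp⟩
  refine Shuffle.range (e := e.symm) (fun p hp => ?_) hp
  rw [Equiv.symm_apply_eq, he p hp]

theorem Shuffle.exists_pos' {n : ℕ} {f f' : ℕ → ℕ} (h : Shuffle n f f') {p : ℕ}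
    (hp : 1 ≤ p ∧ p ≤ n) : ∃ q, (1 ≤ q ∧ q ≤ n) ∧ f' p = f q := by
  obtain ⟨e, he, rfl⟩ := h
  exact ⟨e p, Shuffle.range he hp, rfl⟩

theorem Shuffle.injOn {n : ℕ} {f f' : ℕ → ℕ} (h : Shuffle n f f')
    (hf : Set.InjOn f (Set.Icc 1 n)) : Set.InjOn f' (Set.Icc 1 n) := by
  obtain ⟨e, he, rfl⟩ := h
  intro p hp q hq hpq
  exact e.injective (hf (Shuffle.range he hp) (Shuffle.range he hq) hpq)

section Heap

variable {α : Type u} {W : Type v} [CommSemiring W]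

/-- The heap order at all positions whose parent is at least `lo`. -/
def HeapFrom (lo n : ℕ) (w : ℕ → W) : Prop :=
  ∀ c, 2 ≤ c → c ≤ n → lo ≤ c / 2 → DLe (w (c / 2)) (w c)

theorem HeapFrom.root_le {n : ℕ} {w : ℕ → W} (hW : IsSelective W) (h : HeapFrom 1 n w) :
    ∀ p, 1 ≤ p → p ≤ n → DLe (w 1) (w p) := by
  intro p
  induction p using Nat.strong_induction_on with
  | _ p ih =>
    intro h1 hn
    by_cases hp : p = 1
    · subst hp; exact hW.refl _
    · exact (ih (p / 2) (by omega) (by omega) (by omega)).trans (h p (by omega) hn (by omega))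

/-- The heap order from `lo` on, except below the position `cur`. -/
structure DownInv (lo n cur : ℕ) (w : ℕ → W) : Prop where
  away : ∀ c, 2 ≤ c → c ≤ n → lo ≤ c / 2 → c / 2 ≠ cur → DLe (w (c / 2)) (w c)
  skip : ∀ c, 2 ≤ c → c ≤ n → c / 2 = cur → lo ≤ cur / 2 → DLe (w (cur / 2)) (w c)

theorem DownInv.exit {lo n cur : ℕ} {w : ℕ → W} (h : DownInv lo n cur w)
    (hc : ∀ c, 2 ≤ c → c ≤ n → c / 2 = cur → DLe (w cur) (w c)) : HeapFrom lo n w := by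
  intro c h2 hn hlo
  by_cases hcc : c / 2 = cur
  · rw [hcc]; exact hc c h2 hn hcc
  · exact h.away c h2 hn hlo hcc

/-- The smaller child `d` rises. It is below its sibling and below the old entry at `cur`, and the
`skip` clause places it correctly under the parent of `cur`. The new `skip` clause at `d` holds
because the risen entry already was the parent of the children of `d`. -/
theorem DownInv.swap {lo n cur d : ℕ} {w : ℕ → W} (h : DownInv lo n cur w)
    (hlo : 1 ≤ lo) (hcur : lo ≤ cur) (hd : d / 2 = cur) (hdn : d ≤ n)
    (hmin : ∀ c, 2 ≤ c → c ≤ n → c / 2 = cur → DLe (w d) (w c)) (hlt : DLe (w d) (w cur)) :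
    DownInv lo n d (w ∘ Equiv.swap cur d) := by
  have hne : cur ≠ d := by omega
  have hs : ∀ p, p ≠ cur → p ≠ d → (w ∘ Equiv.swap cur d) p = w p := fun p h1 h2 => by
    rw [Function.comp_apply, Equiv.swap_apply_of_ne_of_ne h1 h2]
  have hs1 : (w ∘ Equiv.swap cur d) cur = w d := by simp
  have hs2 : (w ∘ Equiv.swap cur d) d = w cur := by simp
  constructor
  · intro c h2 hn hl hcd
    by_cases hp : c / 2 = cur
    · rw [hp, hs1]
      by_cases hcd' : c = d
      · rw [hcd', hs2]; exact hlt
      · rw [hs c (by omega) hcd']; exact hmin c h2 hn hp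
    · rw [hs _ hp hcd]
      by_cases hc : c = cur
      · subst hc
        rw [hs1]
        exact h.skip d (by omega) hdn hd hl
      · rw [hs c hc (by omega)]
        exact h.away c h2 hn hl hp
  · intro c h2 hn hcd hl
    rw [hd, hs1, hs c (by omega) (by omega)]
    have := h.away c h2 hn (by omega) (by omega)
    rwa [hcd] at this

/-- The heap order except at the position `cur`. -/
structure UpInv (n cur : ℕ) (w : ℕ → W) : Prop where
  away : ∀ c, 2 ≤ c → c ≤ n → c ≠ cur → DLe (w (c / 2)) (w c)
  skip : ∀ c, 2 ≤ c → c ≤ n → c / 2 = cur → 2 ≤ cur → DLe (w (cur / 2)) (w c)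

theorem UpInv.exit {n cur : ℕ} {w : ℕ → W} (h : UpInv n cur w)
    (hc : 2 ≤ cur → DLe (w (cur / 2)) (w cur)) : HeapFrom 1 n w := by
  intro c h2 hn hlo
  by_cases hcc : c = cur
  · subst hcc; exact hc h2
  · exact h.away c h2 hn hcc

/-- The rising entry is smaller than its old parent, hence than its sibling. The old parent moves
above the children of `cur`, which the `skip` clause allows. -/
theorem UpInv.swap {n cur : ℕ} {w : ℕ → W} (h : UpInv n cur w)
    (hcur : 2 ≤ cur) (hn : cur ≤ n) (hlt : DLe (w cur) (w (cur / 2))) :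
    UpInv n (cur / 2) (w ∘ Equiv.swap (cur / 2) cur) := by
  have hs : ∀ p, p ≠ cur / 2 → p ≠ cur → (w ∘ Equiv.swap (cur / 2) cur) p = w p :=
    fun p h1 h2 => by rw [Function.comp_apply, Equiv.swap_apply_of_ne_of_ne h1 h2]
  have hs1 : (w ∘ Equiv.swap (cur / 2) cur) (cur / 2) = w cur := by simp
  have hs2 : (w ∘ Equiv.swap (cur / 2) cur) cur = w (cur / 2) := by simp
  constructor
  · intro c h2 hc hne
    by_cases hcc : c = cur
    · rw [hcc, hs1, hs2]; exact hlt
    · rw [hs c hne hcc]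
      by_cases hp : c / 2 = cur / 2
      · rw [hp, hs1]
        have := h.away c h2 hc hcc
        rw [hp] at this
        exact hlt.trans this
      · by_cases hp' : c / 2 = cur
        · rw [hp', hs2]
          exact h.skip c h2 hc hp' hcur
        · rw [hs _ hp hp']
          exact h.away c h2 hc hcc
  · intro c h2 hc hcc h2'
    have hg : DLe (w (cur / 2 / 2)) (w (cur / 2)) := h.away (cur / 2) h2' (by omega) (by omega)
    rw [hs (cur / 2 / 2) (by omega) (by omega)]
    by_cases hc' : c = cur
    · rw [hc', hs2]; exact hg
    · rw [hs c (by omega) hc']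
      have := h.away c h2 hc hc'
      rw [hcc] at this
      exact hg.trans this

/-! ### Sifting in a heap stored in an array -/

/-- Replace the child `ch` (with id `ia`) by its right sibling if that one is smaller. -/
def pickChild (h wt : Tag) (xs : List ℕ) : Cmd := seqs [
  .prim (.load (.sc .ia) h (.sc .ch :: xs.map .var)),
  .ite (.lt (.sc .ch) (.sc .n))
    (seqs [
      .prim (.add (.sc .ch1) (.sc .ch) (.sc .one)),
      .prim (.load (.sc .ib) h (.sc .ch1 :: xs.map .var)),
      .prim (.wload 2 wt [.sc .ia]),
      .prim (.wload 3 wt [.sc .ib]),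
      .ite (.wle 2 3) .skip
        (seqs [.prim (.move (.sc .ch) (.sc .ch1)), .prim (.move (.sc .ia) (.sc .ib))])])
    .skip]

/-- Exchange `cur` and its child `ch` and go down, or stop the loop by a large `ch`. -/
def exchangeChild (h wt : Tag) (xs : List ℕ) : Cmd := seqs [
  .prim (.load (.sc .ic) h (.sc .cur :: xs.map .var)),
  .prim (.wload 2 wt [.sc .ia]),
  .prim (.wload 3 wt [.sc .ic]),
  .ite (.wle 3 2)
    (.prim (.add (.sc .ch) (.sc .n) (.sc .one)))
    (seqs [
      .prim (.store h (.sc .cur :: xs.map .var) (.sc .ia)),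
      .prim (.store h (.sc .ch :: xs.map .var) (.sc .ic)),
      .prim (.move (.sc .cur) (.sc .ch)),
      .prim (.add (.sc .ch) (.sc .cur) (.sc .cur))])]

/-- Restore the heap order below the position `cur` in the heap of size `n` at the array `h` and the
group key in the variables `xs`. -/
def siftDown (h wt : Tag) (xs : List ℕ) : Cmd :=
  .seq (.prim (.add (.sc .ch) (.sc .cur) (.sc .cur)))
    (.loop (.lt (.sc .n) (.sc .ch)) (.seq (pickChild h wt xs) (exchangeChild h wt xs)))

/-- The values of the variables `xs`. -/
def St.vals (s : St α W) (xs : List ℕ) : List (Word α) := xs.map fun x => s.reg (.var x)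

/-- Weights of ids, as stored in the array `wt`. -/
def St.idw (s : St α W) (wt : Tag) (i : ℕ) : W := s.warr wt [.num i]

theorem pickChild_spec {h wt : Tag} {xs : List ℕ} {s : St α W} (hW : IsSelective W) {n c : ℕ}
    {f : ℕ → ℕ}
    (hone : s.reg (.sc .one) = .num 1) (hn : s.reg (.sc .n) = .num n)
    (hc : s.reg (.sc .ch) = .num c) (hc1 : 1 ≤ c) (hcn : c ≤ n)
    (hf : ∀ p, 1 ≤ p → p ≤ n → s.arr h (.num p :: s.vals xs) = .num (f p)) :
    (pickChild h wt xs).wp (fun s' => ∃ d, s'.reg (.sc .ch) = .num d ∧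
      s'.reg (.sc .ia) = .num (f d) ∧ (d = c ∨ d = c + 1) ∧ d ≤ n ∧
      ∀ d', (d' = c ∨ d' = c + 1) → d' ≤ n → DLe (s.idw wt (f d)) (s.idw wt (f d'))) s := by
  have e1 := hf c hc1 hcn
  unfold St.vals at e1
  simp only [pickChild, seqs, Cmd.wp, Prim.app, Cond.holds, List.map_cons, List.map_map,
    List.map_nil, Function.comp_def, Function.update_apply, reduceCtorEq, if_false,
    Reg.sc.injEq, hone, hn, hc, Word.toNat_num, e1, St.tick_reg, St.tick_wreg, St.tick_arr,
    St.tick_warr, if_pos, Nat.reduceEqDiff]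
  refine ⟨fun hlt => ?_, fun hlt => ?_⟩
  · have e2 := hf (c + 1) (by omega) (by omega)
    unfold St.vals at e2
    simp only [e2]
    refine ⟨fun hle => ?_, fun hle => ?_⟩
    · refine ⟨c, rfl, rfl, .inl rfl, hcn, ?_⟩
      rintro d' (rfl | rfl) hd
      · exact hW.refl _
      · exact hle
    · refine ⟨c + 1, rfl, rfl, .inr rfl, by omega, ?_⟩
      rintro d' (rfl | rfl) hd
      · exact hW.le_of_not hle
      · exact hW.refl _
  · refine ⟨c, rfl, rfl, .inl rfl, hcn, ?_⟩
    rintro d' (rfl | rfl) hd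
    · exact hW.refl _
    · omega

theorem exchangeChild_spec {h wt : Tag} {xs : List ℕ} {s : St α W} {n cur d : ℕ} {f : ℕ → ℕ}
    (hone : s.reg (.sc .one) = .num 1) (hn : s.reg (.sc .n) = .num n)
    (hcur : s.reg (.sc .cur) = .num cur) (hd : s.reg (.sc .ch) = .num d)
    (hia : s.reg (.sc .ia) = .num (f d)) (hcur1 : 1 ≤ cur) (hcd : cur < d) (hdn : d ≤ n)
    (hf : ∀ p, 1 ≤ p → p ≤ n → s.arr h (.num p :: s.vals xs) = .num (f p)) :
    (exchangeChild h wt xs).wp (fun s' =>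
      (DLe (s.idw wt (f cur)) (s.idw wt (f d)) ∧ s'.reg (.sc .ch) = .num (n + 1) ∧
        s'.reg (.sc .cur) = .num cur ∧ s'.arr h = s.arr h) ∨
      (¬ DLe (s.idw wt (f cur)) (s.idw wt (f d)) ∧ s'.reg (.sc .ch) = .num (d + d) ∧
        s'.reg (.sc .cur) = .num d ∧
        (∀ p, 1 ≤ p → p ≤ n →
          s'.arr h (.num p :: s.vals xs) = .num ((f ∘ Equiv.swap cur d) p)) ∧
        ∀ key, key ≠ .num cur :: s.vals xs → key ≠ .num d :: s.vals xs →
          s'.arr h key = s.arr h key)) s := by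
  have e1 := hf cur hcur1 (by omega)
  unfold St.vals at *
  simp only [exchangeChild, seqs, Cmd.wp, Prim.app, Cond.holds, List.map_cons, List.map_map,
    List.map_nil, Function.comp_def, Function.update_apply, reduceCtorEq, if_false,
    Reg.sc.injEq, hone, hn, hcur, hd, hia, Word.toNat_num, e1, St.tick_reg, St.tick_wreg,
    St.tick_arr, St.tick_warr, if_pos, Nat.reduceEqDiff]
  refine ⟨fun hle => .inl ⟨hle, trivial, trivial, trivial⟩,
    fun hle => .inr ⟨hle, trivial, trivial, ?_, ?_⟩⟩
  · intro p hp1 hpn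
    by_cases h1 : p = d
    · subst h1; simp
    · by_cases h2 : p = cur
      · subst h2; simp [h1]
      · simp [h1, h2, Equiv.swap_apply_of_ne_of_ne, hf p hp1 hpn]
  · intro key h1 h2
    simp [h1, h2]

/-- A bound on the cost of one round of sifting. -/
def siftStep : ℕ := 30

/-- `Nat.log 2 (n / cur)` is the number of levels below `cur`; every round descends by one level or
stops. -/
theorem siftDown_spec {h wt : Tag} {xs : List ℕ} {s : St α W} (hW : IsSelective W)
    {n cur lo : ℕ} {f : ℕ → ℕ}
    (hone : s.reg (.sc .one) = .num 1) (hn : s.reg (.sc .n) = .num n)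
    (hcur : s.reg (.sc .cur) = .num cur) (hlo : 1 ≤ lo) (hlc : lo ≤ cur)
    (hf : ∀ p, 1 ≤ p → p ≤ n → s.arr h (.num p :: s.vals xs) = .num (f p))
    (hinv : DownInv lo n cur fun p => s.idw wt (f p)) :
    (siftDown h wt xs).wp (fun s' => ∃ f', Shuffle n f f' ∧
      (∀ p, 1 ≤ p → p ≤ n → s'.arr h (.num p :: s.vals xs) = .num (f' p)) ∧
      HeapFrom lo n (fun p => s.idw wt (f' p)) ∧
      (∀ key, (∀ p, key ≠ .num p :: s.vals xs) → s'.arr h key = s.arr h key) ∧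
      s'.clock ≤ s.clock + 2 + siftStep * Nat.log 2 (n / cur)) s := by
  have hlf : (pickChild h wt xs).loopFree := by simp [pickChild, seqs, Cmd.loopFree]
  have hlf' : (exchangeChild h wt xs).loopFree := by simp [exchangeChild, seqs, Cmd.loopFree]
  have hcost : (pickChild h wt xs).cost + (exchangeChild h wt xs).cost + 2 ≤ siftStep := by
    simp [pickChild, exchangeChild, seqs, Cmd.cost, siftStep]
  rw [siftDown, Cmd.wp]
  set s₀ := Prim.app (.add (.sc .ch) (.sc .cur) (.sc .cur)) s with hs₀
  have hreg : ∀ r, r ≠ .sc .ch → s₀.reg r = s.reg r := fun r hr => by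
    simp [hs₀, Prim.app, Function.update_of_ne hr]
  -- The second alternative describes a sift that has found its place: `ch` was set to `n + 1` to
  -- end the loop, and the heap order holds already. The clause with `k` is therefore required only
  -- as long as `c ≤ n`.
  refine Cmd.wp_loop (fun k s' => ∃ f' cur' c, Shuffle n f f' ∧
      (∀ p, 1 ≤ p → p ≤ n → s'.arr h (.num p :: s.vals xs) = .num (f' p)) ∧
      (∀ key, (∀ p, key ≠ .num p :: s.vals xs) → s'.arr h key = s.arr h key) ∧
      s'.reg (.sc .ch) = .num c ∧ s'.reg (.sc .cur) = .num cur' ∧ lo ≤ cur' ∧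
      ((c = cur' + cur' ∧ DownInv lo n cur' fun p => s.idw wt (f' p)) ∨
        (n < c ∧ HeapFrom lo n fun p => s.idw wt (f' p))) ∧
      (c ≤ n → Nat.log 2 (n / cur') ≤ k) ∧
      s'.clock + siftStep * k ≤ s.clock + 1 + siftStep * Nat.log 2 (n / cur))
    (Nat.log 2 (n / cur)) ?_ ?_ ?_
  · refine ⟨f, cur, cur + cur, .refl _ _, hf, fun _ _ => rfl, ?_, ?_, hlc, .inl ⟨rfl, hinv⟩,
      fun _ => le_rfl, le_rfl⟩
    · simp [Prim.app, hcur]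
    · rw [hreg _ (by simp), hcur]
  · rintro k s₁ hfr ⟨f', cur', c, hsh, hf', hout, hc, hcur', hlo', hor, hk, hclk⟩ hb
    simp only [Cond.holds, hc, Word.toNat_num] at hb
    rw [hfr.reg (.sc .n) (by simp [pickChild, exchangeChild, seqs, Cmd.collect, Prim.wr]),
      hreg _ (by simp), hn, Word.toNat_num, not_lt] at hb
    obtain ⟨hc2, hdi⟩ := hor.resolve_right (by omega)
    have hwa : s₁.warr = s.warr := by
      funext t
      exact hfr.warr t (by simp [pickChild, exchangeChild, seqs, Cmd.collect, Prim.wwt])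
    have hva : s₁.vals xs = s.vals xs := by
      refine List.map_congr_left fun x _ => ?_
      rw [hfr.reg _ (by simp [pickChild, exchangeChild, seqs, Cmd.collect, Prim.wr]),
        hreg _ (by simp)]
    have hone₁ : s₁.reg (.sc .one) = .num 1 := by
      rw [hfr.reg _ (by simp [pickChild, exchangeChild, seqs, Cmd.collect, Prim.wr]),
        hreg _ (by simp), hone]
    have hn₁ : s₁.reg (.sc .n) = .num n := by
      rw [hfr.reg _ (by simp [pickChild, exchangeChild, seqs, Cmd.collect, Prim.wr]),
        hreg _ (by simp), hn]
    have hlog : Nat.log 2 (n / cur') = Nat.log 2 (n / cur' / 2) + 1 := by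
      rw [Nat.log_of_one_lt_of_le one_lt_two]
      rw [Nat.le_div_iff_mul_le (by omega)]
      omega
    have hk1 := hk hb
    rw [Cmd.wp]
    refine Cmd.wp_use_cost hlf (pickChild_spec (s := s₁.tick) (n := n) (c := c) (f := f') hW hone₁
      hn₁ hc (by omega) hb (by rw [← hva] at hf'; exact hf')) ?_
    rintro s₂ ⟨d, hd, hia, hdc, hdn, hmin⟩ hfr₂ hclk₂
    have harr₂ : s₂.arr = s₁.arr := by
      funext t
      exact hfr₂.arr t (by simp [pickChild, seqs, Cmd.collect, Prim.wt])
    have hwarr₂ : s₂.warr = s.warr := by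
      rw [← hwa]
      funext t
      exact hfr₂.warr t (by simp [pickChild, seqs, Cmd.collect, Prim.wwt])
    have hva₂ : s₂.vals xs = s.vals xs := by
      rw [← hva]
      exact List.map_congr_left fun x _ => hfr₂.reg _
        (by simp [pickChild, seqs, Cmd.collect, Prim.wr])
    have hcur₂ : s₂.reg (.sc .cur) = .num cur' := by
      rw [hfr₂.reg _ (by simp [pickChild, seqs, Cmd.collect, Prim.wr]), ← hcur']; rfl
    have hidw₂ : ∀ i, s₂.idw wt i = s.idw wt i := fun i => by rw [St.idw, hwarr₂]; rfl
    have hidw₁ : ∀ i, s₁.tick.idw wt i = s.idw wt i := fun i => by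
      rw [St.idw, St.tick_warr, hwa]; rfl
    simp only [hidw₁] at hmin
    refine Cmd.wp_use_cost hlf' (exchangeChild_spec (n := n) (cur := cur') (d := d) (f := f')
      (by rw [hfr₂.reg _ (by simp [pickChild, seqs, Cmd.collect, Prim.wr])]; exact hone₁)
      (by rw [hfr₂.reg _ (by simp [pickChild, seqs, Cmd.collect, Prim.wr])]; exact hn₁)
      hcur₂ hd hia (by omega) (by omega) hdn (by rw [hva₂, harr₂]; exact hf')) ?_
    rintro s₃ hs₃ hfr₃ hclk₃
    simp only [hidw₂, hva₂, harr₂] at hs₃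
    have hmin' : ∀ c, 2 ≤ c → c ≤ n → c / 2 = cur' →
        DLe (s.idw wt (f' d)) (s.idw wt (f' c)) := fun e he2 hen hec => hmin e (by omega) hen
    obtain ⟨k, rfl⟩ : ∃ k', k = k' + 1 := ⟨k - 1, by omega⟩
    refine ⟨k, by omega, ?_⟩
    have hclk₄ : s₃.tick.clock + siftStep * k ≤
        s.clock + 1 + siftStep * Nat.log 2 (n / cur) := by
      rw [mul_add] at hclk
      simp only [St.tick_clock] at *
      omega
    rcases hs₃ with ⟨hle, hch, hcu, harr⟩ | ⟨hle, hch, hcu, harr, hout'⟩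
    · refine ⟨f', cur', n + 1, hsh, ?_, ?_, hch, hcu, hlo', .inr ⟨by omega, ?_⟩, by omega, hclk₄⟩
      · intro p h1 h2
        rw [St.tick_arr, harr]
        exact hf' p h1 h2
      · intro key hkey
        rw [St.tick_arr, harr]
        exact hout key hkey
      · exact hdi.exit fun e he2 hen hec => hle.trans (hmin' e he2 hen hec)
    · refine ⟨f' ∘ Equiv.swap cur' d, d, d + d, ?_, harr, ?_, hch, hcu, by omega,
        .inl ⟨rfl, ?_⟩, ?_, hclk₄⟩
      · exact hsh.trans (.swap _ (by omega) (by omega))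
      · intro key hkey
        rw [St.tick_arr, hout' key (hkey _) (hkey _)]
        exact hout key hkey
      · exact hdi.swap hlo hlo' (by omega) hdn hmin' (hW.le_of_not hle)
      · intro _
        have h1 : n / d ≤ n / cur' / 2 := by
          rw [Nat.div_div_eq_div_mul]
          exact Nat.div_le_div_left (by omega) (by omega)
        have := Nat.log_mono_right (b := 2) h1
        omega
  · rintro k s₁ hfr ⟨f', cur', c, hsh, hf', hout, hc, hcur', hlo', hor, hk, hclk⟩ hb
    simp only [Cond.holds, hc, Word.toNat_num] at hb
    rw [hfr.reg (.sc .n) (by simp [pickChild, exchangeChild, seqs, Cmd.collect, Prim.wr]),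
      hreg _ (by simp), hn, Word.toNat_num] at hb
    refine ⟨f', hsh, hf', ?_, hout, ?_⟩
    · rcases hor with ⟨h1, h2⟩ | ⟨_, h2⟩
      · exact h2.exit fun e he2 hen hec => by omega
      · exact h2
    · simp only [St.tick_clock]
      omega

/-- Move the entry at the position `cur` up to its place. -/
def siftUpBody (h wt : Tag) : Cmd := seqs [
  .prim (.half (.sc .ch) (.sc .cur)),
  .prim (.load (.sc .ia) h [.sc .ch]),
  .prim (.load (.sc .ic) h [.sc .cur]),
  .prim (.wload 2 wt [.sc .ia]),
  .prim (.wload 3 wt [.sc .ic]),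
  .ite (.wle 2 3)
    (.prim (.move (.sc .cur) (.sc .one)))
    (seqs [
      .prim (.store h [.sc .cur] (.sc .ia)),
      .prim (.store h [.sc .ch] (.sc .ic)),
      .prim (.move (.sc .cur) (.sc .ch))])]

def siftUp (h wt : Tag) : Cmd := .loop (.eq (.sc .cur) (.sc .one)) (siftUpBody h wt)

theorem siftUpBody_spec {h wt : Tag} {s : St α W} {n cur : ℕ} {f : ℕ → ℕ}
    (hone : s.reg (.sc .one) = .num 1)
    (hcur : s.reg (.sc .cur) = .num cur) (hcur1 : 2 ≤ cur) (hdn : cur ≤ n)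
    (hf : ∀ p, 1 ≤ p → p ≤ n → s.arr h [.num p] = .num (f p)) :
    (siftUpBody h wt).wp (fun s' =>
      (DLe (s.idw wt (f (cur / 2))) (s.idw wt (f cur)) ∧ s'.reg (.sc .cur) = .num 1 ∧
        s'.arr h = s.arr h) ∨
      (¬ DLe (s.idw wt (f (cur / 2))) (s.idw wt (f cur)) ∧ s'.reg (.sc .cur) = .num (cur / 2) ∧
        (∀ p, 1 ≤ p → p ≤ n → s'.arr h [.num p] = .num ((f ∘ Equiv.swap (cur / 2) cur) p)))) s := by
  have e1 := hf cur (by omega) (by omega)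
  have e2 := hf (cur / 2) (by omega) (by omega)
  simp only [siftUpBody, seqs, Cmd.wp, Prim.app, Cond.holds, List.map_cons,
    List.map_nil, Function.update_apply, reduceCtorEq, if_false,
    Reg.sc.injEq, hone, hcur, Word.toNat_num, e1, e2, St.tick_reg, St.tick_wreg,
    St.tick_arr, St.tick_warr, if_pos, Nat.reduceEqDiff]
  refine ⟨fun hle => .inl ⟨hle, trivial, trivial⟩, fun hle => .inr ⟨hle, trivial, ?_⟩⟩
  intro p hp1 hpn
  by_cases h1 : p = cur / 2
  · subst h1; simp
  · by_cases h2 : p = cur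
    · subst h2; simp [h1]
    · simp [h1, h2, Equiv.swap_apply_of_ne_of_ne, hf p hp1 hpn]

/-- `Nat.log 2 cur` is the depth of `cur`. An entry that finds its place early ends the loop by
setting the register `cur` to `1`, which the invariant admits as a separate case. -/
theorem siftUp_spec {h wt : Tag} {s : St α W} (hW : IsSelective W) {n cur : ℕ} {f : ℕ → ℕ}
    (hone : s.reg (.sc .one) = .num 1) (hcur : s.reg (.sc .cur) = .num cur)
    (hcur1 : 1 ≤ cur) (hcn : cur ≤ n)
    (hf : ∀ p, 1 ≤ p → p ≤ n → s.arr h [.num p] = .num (f p))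
    (hinv : UpInv n cur fun p => s.idw wt (f p)) :
    (siftUp h wt).wp (fun s' => ∃ f', Shuffle n f f' ∧
      (∀ p, 1 ≤ p → p ≤ n → s'.arr h [.num p] = .num (f' p)) ∧
      HeapFrom 1 n (fun p => s.idw wt (f' p)) ∧
      s'.clock ≤ s.clock + 1 + siftStep * Nat.log 2 cur) s := by
  have hlf : (siftUpBody h wt).loopFree := by simp [siftUpBody, seqs, Cmd.loopFree]
  have hcost : (siftUpBody h wt).cost + 2 ≤ siftStep := by
    simp [siftUpBody, seqs, Cmd.cost, siftStep]
  refine Cmd.wp_loop (fun k s' => ∃ f' cur', Shuffle n f f' ∧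
      (∀ p, 1 ≤ p → p ≤ n → s'.arr h [.num p] = .num (f' p)) ∧
      s'.reg (.sc .cur) = .num cur' ∧ 1 ≤ cur' ∧ cur' ≤ n ∧
      (UpInv n cur' (fun p => s.idw wt (f' p)) ∨
        (cur' = 1 ∧ HeapFrom 1 n fun p => s.idw wt (f' p))) ∧
      Nat.log 2 cur' ≤ k ∧
      s'.clock + siftStep * k ≤ s.clock + siftStep * Nat.log 2 cur)
    (Nat.log 2 cur) ?_ ?_ ?_
  · exact ⟨f, cur, .refl _ _, hf, hcur, hcur1, hcn, .inl hinv, le_rfl, le_rfl⟩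
  · rintro k s₁ hfr ⟨f', cur', hsh, hf', hcur', h1c, hcn', hor, hk, hclk⟩ hb
    have hone₁ : s₁.reg (.sc .one) = .num 1 := by
      rw [hfr.reg _ (by simp [siftUpBody, seqs, Cmd.collect, Prim.wr]), hone]
    simp only [Cond.holds, hcur', hone₁, Word.num.injEq] at hb
    have hdi := hor.resolve_right (by omega)
    have hidw₁ : ∀ i, s₁.tick.idw wt i = s.idw wt i := fun i => by
      rw [St.idw, St.tick_warr, hfr.warr wt (by simp [siftUpBody, seqs, Cmd.collect, Prim.wwt])]
      rfl
    have hlog : Nat.log 2 cur' = Nat.log 2 (cur' / 2) + 1 := by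
      rw [Nat.log_of_one_lt_of_le one_lt_two (by omega)]
    refine Cmd.wp_use_cost hlf (siftUpBody_spec (s := s₁.tick) (n := n) (cur := cur') (f := f')
      hone₁ hcur' (by omega) hcn' hf') ?_
    rintro s₃ hs₃ hfr₃ hclk₃
    simp only [hidw₁, St.tick_arr] at hs₃
    obtain ⟨k, rfl⟩ : ∃ k', k = k' + 1 := ⟨k - 1, by omega⟩
    refine ⟨k, by omega, ?_⟩
    have hclk₄ : s₃.tick.clock + siftStep * k ≤ s.clock + siftStep * Nat.log 2 cur := by
      rw [mul_add] at hclk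
      simp only [St.tick_clock] at *
      omega
    rcases hs₃ with ⟨hle, hcu, harr⟩ | ⟨hle, hcu, harr⟩
    · refine ⟨f', 1, hsh, ?_, hcu, le_rfl, by omega, .inr ⟨rfl, ?_⟩, by simp, hclk₄⟩
      · intro p h1 h2
        rw [St.tick_arr, harr]
        exact hf' p h1 h2
      · exact hdi.exit fun _ => hle
    · refine ⟨f' ∘ Equiv.swap (cur' / 2) cur', cur' / 2, ?_, harr, hcu, by omega, by omega,
        .inl ?_, by omega, hclk₄⟩
      · exact hsh.trans (.swap _ (by omega) (by omega))
      · exact hdi.swap (by omega) hcn' (hW.le_of_not hle)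
  · rintro k s₁ hfr ⟨f', cur', hsh, hf', hcur', h1c, hcn', hor, hk, hclk⟩ hb
    have hone₁ : s₁.reg (.sc .one) = .num 1 := by
      rw [hfr.reg _ (by simp [siftUpBody, seqs, Cmd.collect, Prim.wr]), hone]
    simp only [Cond.holds, hcur', hone₁, Word.num.injEq] at hb
    refine ⟨f', hsh, hf', ?_, ?_⟩
    · rcases hor with h2 | ⟨_, h2⟩
      · exact h2.exit fun _ => by omega
      · exact h2
    · simp only [St.tick_clock]
      omega

/-! ### Linear-time construction of a heap -/

/-- Terms with `i > n / 2` vanish, and for the others `log (n / i) = 1 + log ((n / 2) / i)`. So the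
sum for `n` is `n / 2` plus the sum for `n / 2`. This is the reason why building a heap takes linear
time. -/
theorem sum_log_div_le (n : ℕ) : ∑ i ∈ Finset.Icc 1 n, Nat.log 2 (n / i) ≤ n := by
  induction n using Nat.strong_induction_on with
  | _ n ih =>
    by_cases hn : n = 0
    · simp [hn]
    · have h1 : ∑ i ∈ Finset.Icc 1 n, Nat.log 2 (n / i) =
          ∑ i ∈ Finset.Icc 1 (n / 2), Nat.log 2 (n / i) := by
        symm
        refine Finset.sum_subset (Finset.Icc_subset_Icc_right (by omega)) fun i hi hi' => ?_
        simp only [Finset.mem_Icc] at hi hi'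
        rw [Nat.log_eq_zero_iff]
        left
        rw [Nat.div_lt_iff_lt_mul (by omega)]
        omega
      have h2 : ∀ i ∈ Finset.Icc 1 (n / 2),
          Nat.log 2 (n / i) = 1 + Nat.log 2 (n / 2 / i) := fun i hi => by
        simp only [Finset.mem_Icc] at hi
        have : 2 ≤ n / i := by
          rw [Nat.le_div_iff_mul_le (by omega)]
          omega
        rw [Nat.log_of_one_lt_of_le one_lt_two this, Nat.div_div_eq_div_mul, mul_comm,
          ← Nat.div_div_eq_div_mul, add_comm]
      rw [h1, Finset.sum_congr rfl h2, Finset.sum_add_distrib]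
      have := ih (n / 2) (by omega)
      simp only [Finset.sum_const, Nat.card_Icc, smul_eq_mul, mul_one]
      omega

/-- Turn the array of size `n` into a heap. -/
def heapifyBody (h wt : Tag) (xs : List ℕ) : Cmd := seqs [
  .prim (.move (.sc .cur) (.sc .lp)),
  siftDown h wt xs,
  .prim (.sub (.sc .lp) (.sc .lp) (.sc .one))]

def heapify (h wt : Tag) (xs : List ℕ) : Cmd :=
  .seq (.prim (.move (.sc .lp) (.sc .n)))
    (.loop (.eq (.sc .lp) (.sc .zero)) (heapifyBody h wt xs))

/-- The entries are sifted down from the last position to the first. The cost of the positions that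
remain serves as a potential; `sum_log_div_le` bounds its initial value. -/
theorem heapify_spec {h wt : Tag} {xs : List ℕ} {s : St α W} (hW : IsSelective W)
    {n : ℕ} {f : ℕ → ℕ}
    (hone : s.reg (.sc .one) = .num 1) (hzero : s.reg (.sc .zero) = .num 0)
    (hn : s.reg (.sc .n) = .num n)
    (hf : ∀ p, 1 ≤ p → p ≤ n → s.arr h (.num p :: s.vals xs) = .num (f p)) :
    (heapify h wt xs).wp (fun s' => ∃ f', Shuffle n f f' ∧
      (∀ p, 1 ≤ p → p ≤ n → s'.arr h (.num p :: s.vals xs) = .num (f' p)) ∧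
      HeapFrom 1 n (fun p => s.idw wt (f' p)) ∧
      (∀ key, (∀ p, key ≠ .num p :: s.vals xs) → s'.arr h key = s.arr h key) ∧
      s'.clock ≤ s.clock + 2 + (6 + siftStep) * n) s := by
  have hwr : ∀ r, r ∈ (heapifyBody h wt xs).collect Prim.wr → r = .sc .cur ∨ r = .sc .lp ∨
      r = .sc .ch ∨ r = .sc .ch1 ∨ r = .sc .ia ∨ r = .sc .ib ∨ r = .sc .ic := by
    intro r
    simp [heapifyBody, siftDown, pickChild, exchangeChild, seqs, Cmd.collect, Prim.wr]
    tauto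
  have hwwt : ∀ t, t ∉ (heapifyBody h wt xs).collect Prim.wwt := by
    simp [heapifyBody, siftDown, pickChild, exchangeChild, seqs, Cmd.collect, Prim.wwt]
  rw [heapify, Cmd.wp]
  set s₀ := Prim.app (.move (.sc .lp) (.sc .n)) s with hs₀
  have hreg : ∀ r, r ≠ .sc .lp → s₀.reg r = s.reg r := fun r hr => by
    simp [hs₀, Prim.app, Function.update_of_ne hr]
  refine Cmd.wp_loop (fun k s' => k ≤ n ∧ ∃ f', Shuffle n f f' ∧
      (∀ p, 1 ≤ p → p ≤ n → s'.arr h (.num p :: s.vals xs) = .num (f' p)) ∧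
      (∀ key, (∀ p, key ≠ .num p :: s.vals xs) → s'.arr h key = s.arr h key) ∧
      s'.reg (.sc .lp) = .num k ∧
      (HeapFrom (k + 1) n fun p => s.idw wt (f' p)) ∧
      s'.clock + ∑ i ∈ Finset.Icc 1 k, (6 + siftStep * Nat.log 2 (n / i)) ≤
        s.clock + 1 + ∑ i ∈ Finset.Icc 1 n, (6 + siftStep * Nat.log 2 (n / i)))
    n ?_ ?_ ?_
  · refine ⟨le_rfl, f, .refl _ _, hf, fun _ _ => rfl, ?_, ?_, le_rfl⟩
    · simp [Prim.app, hn]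
    · intro c h1 h2 h3
      omega
  · rintro k s₁ hfr ⟨hkn, f', hsh, hf', hout, hlp, hheap, hclk⟩ hb
    have hreg₁ : ∀ r, r ≠ .sc .cur → r ≠ .sc .lp → r ≠ .sc .ch → r ≠ .sc .ch1 → r ≠ .sc .ia →
        r ≠ .sc .ib → r ≠ .sc .ic → s₁.reg r = s.reg r := fun r h1 h2 h3 h4 h5 h6 h7 => by
      rw [hfr.reg r (fun hr => by have := hwr r hr; tauto), hreg r h2]
    have hz₁ : s₁.reg (.sc .zero) = .num 0 := by rw [hreg₁, hzero] <;> simp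
    have ho₁ : s₁.reg (.sc .one) = .num 1 := by rw [hreg₁, hone] <;> simp
    have hn₁ : s₁.reg (.sc .n) = .num n := by rw [hreg₁, hn] <;> simp
    have hva : s₁.vals xs = s.vals xs :=
      List.map_congr_left fun x _ => by rw [hreg₁] <;> simp
    simp only [Cond.holds, hlp, hz₁, Word.num.injEq] at hb
    obtain ⟨k, rfl⟩ : ∃ k', k = k' + 1 := ⟨k - 1, by omega⟩
    have hwa : s₁.warr = s.warr := funext fun t => hfr.warr t (hwwt t)
    simp only [heapifyBody, seqs]
    rw [Cmd.wp, Cmd.wp]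
    set s₂ := Prim.app (.move (.sc .cur) (.sc .lp)) s₁.tick with hs₂
    have hreg₂ : ∀ r, r ≠ .sc .cur → s₂.reg r = s₁.reg r := fun r hr => by
      simp [hs₂, Prim.app, Function.update_of_ne hr]
    have hva₂ : s₂.vals xs = s.vals xs := by
      rw [← hva]
      exact List.map_congr_left fun x _ => by rw [hreg₂]; simp
    have hidw : ∀ i, s₂.idw wt i = s.idw wt i := fun i => by
      simp only [St.idw, hs₂, Prim.app, St.tick_warr, hwa]
    rw [Cmd.wp]
    refine Cmd.wp_use (siftDown_spec (s := s₂) (n := n) (cur := k + 1) (lo := k + 1) (f := f') hW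
      (by rw [hreg₂ _ (by simp), ho₁]) (by rw [hreg₂ _ (by simp), hn₁])
      (by simp [hs₂, Prim.app, hlp]) (by omega) le_rfl (by rw [hva₂]; exact hf')
      -- The order is only claimed from `k + 1` on, and the parent of `k + 1` lies before that; so
      -- the `skip` clause is void.
      ⟨fun c h2 hc hl hne => ?_, fun c h2 hc hl hne => by omega⟩) ?_
    · simp only [hidw]
      exact hheap c h2 hc (by omega)
    rintro s₃ ⟨f'', hsh', hf'', hheap', hout', hclk'⟩ hfr₃
    simp only [hidw, hva₂] at hf'' hheap' hout'
    have hlp₃ : s₃.reg (.sc .lp) = .num (k + 1) := by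
      rw [hfr₃.reg _ (by simp [siftDown, pickChild, exchangeChild, seqs, Cmd.collect, Prim.wr]),
        hreg₂ _ (by simp), hlp]
    have ho₃ : s₃.reg (.sc .one) = .num 1 := by
      rw [hfr₃.reg _ (by simp [siftDown, pickChild, exchangeChild, seqs, Cmd.collect, Prim.wr]),
        hreg₂ _ (by simp), ho₁]
    refine ⟨k, by omega, by omega, f'', hsh.trans hsh', hf'', ?_, ?_, hheap', ?_⟩
    · intro key hkey
      exact (hout' key hkey).trans (hout key hkey)
    · simp [Prim.app, hlp₃, ho₃]
    · rw [Finset.sum_Icc_succ_top (by omega)] at hclk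
      simp only [Prim.app, St.tick_clock, hs₂] at *
      omega
  · rintro k s₁ hfr ⟨hkn, f', hsh, hf', hout, hlp, hheap, hclk⟩ hb
    have hz₁ : s₁.reg (.sc .zero) = .num 0 := by
      rw [hfr.reg _ (fun hr => by simpa using hwr _ hr), hreg _ (by simp), hzero]
    simp only [Cond.holds, hlp, hz₁, Word.num.injEq] at hb
    subst hb
    refine ⟨f', hsh, hf', hheap, hout, ?_⟩
    have h1 := sum_log_div_le n
    have h2 := Nat.mul_le_mul_left siftStep h1
    simp only [Finset.Icc_eq_empty_of_lt, zero_lt_one, Finset.sum_empty, Finset.sum_add_distrib,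
      Finset.sum_const, Nat.card_Icc, ← Finset.mul_sum, smul_eq_mul, St.tick_clock] at *
    rw [add_mul]
    omega

end Heap

/-! ### Orders with the running intersection property -/

section JoinTree

variable {ι V : Type}

/-- In an acyclic graph, let `u` be outside of a set `S` of vertices that are connected to `p` within
`S`, and adjacent to `p`. Then all walks from `u` into `S` pass through `p`. -/
theorem mem_support_of_leaving {T : SimpleGraph ι} (hT : T.IsAcyclic) {S : Set ι} {u p s : ι}
    (hu : u ∉ S) (hadj : T.Adj u p) (w : T.Walk s p) (hw : ∀ v ∈ w.support, v ∈ S)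
    (w' : T.Walk u s) : p ∈ w'.support := by
  have hb := SimpleGraph.isAcyclic_iff_forall_adj_isBridge.1 hT hadj
  have := SimpleGraph.isBridge_iff_forall_walk_mem_edges.1 hb (w'.append w)
  rw [SimpleGraph.Walk.edges_append, List.mem_append] at this
  rcases this with h | h
  · exact w'.snd_mem_support_of_mem_edges h
  · exact absurd (hw _ (w.fst_mem_support_of_mem_edges h)) hu

/-- The hyperedges containing `x` are connected, so some walk from `u` to `s` stays among them; it
has to pass through `p`. -/
theorem IsJoinTree.mem_of_leaving {E : ι → Set V} {T : SimpleGraph ι} (h : IsJoinTree E T)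
    {S : Set ι} {u p s : ι} (hu : u ∉ S) (hadj : T.Adj u p) (w : T.Walk s p)
    (hw : ∀ v ∈ w.support, v ∈ S) {x : V} (hxu : x ∈ E u) (hxs : x ∈ E s) : x ∈ E p := by
  obtain ⟨w'⟩ := h.2 x ⟨u, hxu⟩ ⟨s, hxs⟩
  let f := (SimpleGraph.Embedding.induce (G := T) {i | x ∈ E i}).toHom
  have := mem_support_of_leaving h.1.2 hu hadj w hw (w'.map f)
  erw [SimpleGraph.Walk.support_map, List.mem_map] at this
  obtain ⟨q, _, rfl⟩ := this
  exact q.2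

/-- A join tree yields an order of the hyperedges, starting from any given one, in which each
hyperedge meets the union of its predecessors within a single predecessor. -/
theorem IsJoinTree.exists_order [Fintype ι] {E : ι → Set V} {T : SimpleGraph ι}
    (h : IsJoinTree E T) (r : ι) :
    ∃ (l : ℕ → ι) (p : ℕ → ℕ), l 0 = r ∧ Set.BijOn l (Set.Iio (Fintype.card ι)) Set.univ ∧
      ∀ i, 0 < i → i < Fintype.card ι →
        p i < i ∧ ∀ j < i, ∀ x, x ∈ E (l i) → x ∈ E (l j) → x ∈ E (l (p i)) := by
  classical
  -- The chosen hyperedges grow as a subtree. The induction also carries walks from `r` within the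
  -- chosen set, as needed for `mem_of_leaving`.
  suffices ∀ n, n < Fintype.card ι → ∃ (l : ℕ → ι) (p : ℕ → ℕ), l 0 = r ∧
      Set.InjOn l (Set.Iio (n + 1)) ∧
      (∀ i < n + 1, ∃ w : T.Walk r (l i), ∀ v ∈ w.support, v ∈ l '' Set.Iio (n + 1)) ∧
      ∀ i, 0 < i → i < n + 1 →
        p i < i ∧ ∀ j < i, ∀ x, x ∈ E (l i) → x ∈ E (l j) → x ∈ E (l (p i)) by
    have hc : 0 < Fintype.card ι := Fintype.card_pos_iff.2 ⟨r⟩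
    obtain ⟨l, p, h0, hinj, -, hp⟩ := this (Fintype.card ι - 1) (by omega)
    rw [Nat.sub_add_cancel hc] at hinj hp
    refine ⟨l, p, h0, ⟨Set.mapsTo_univ _ _, hinj, ?_⟩, hp⟩
    have hcard : (Finset.image l (Finset.range (Fintype.card ι))).card = Fintype.card ι := by
      rw [Finset.card_image_of_injOn (by simpa using hinj), Finset.card_range]
    have huniv := (Finset.card_eq_iff_eq_univ _).1 hcard
    intro i _
    have hi : i ∈ Finset.image l (Finset.range (Fintype.card ι)) := by rw [huniv]; simp
    simpa using hi
  intro n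
  induction n with
  | zero =>
    intro _
    refine ⟨fun _ => r, fun _ => 0, rfl, ?_, ?_, ?_⟩
    · intro a ha b hb _
      simp only [Set.mem_Iio] at ha hb
      omega
    · intro i hi
      exact ⟨.nil, by simp⟩
    · intro i h1 h2; omega
  | succ n ih =>
    intro hn
    obtain ⟨l, p, h0, hinj, hconn, hp⟩ := ih (by omega)
    have hr : r ∈ l '' Set.Iio (n + 1) := ⟨0, by simp, h0⟩
    obtain ⟨u₀, hu₀⟩ : ∃ u₀, u₀ ∉ l '' Set.Iio (n + 1) := by
      by_contra hall
      push Not at hall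
      have h1 : Fintype.card ι ≤ (Finset.image l (Finset.range (n + 1))).card := by
        rw [← Finset.card_univ]
        refine Finset.card_le_card fun i _ => ?_
        simpa using hall i
      have := h1.trans Finset.card_image_le
      simp only [Finset.card_range] at this
      omega
    obtain ⟨w₀⟩ := h.1.1.preconnected r u₀
    -- A walk from `r` to an unchosen hyperedge leaves the chosen set somewhere; that edge supplies
    -- the next hyperedge and its parent.
    obtain ⟨d, -, hd1, hd2⟩ := w₀.exists_boundary_dart _ hr hu₀
    obtain ⟨q, hq, hql⟩ := hd1
    simp only [Set.mem_Iio] at hq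
    have hl : ∀ i < n + 1, Function.update l (n + 1) d.snd i = l i := fun i hi =>
      Function.update_of_ne (by omega) _ _
    have himg : l '' Set.Iio (n + 1) ⊆ Function.update l (n + 1) d.snd '' Set.Iio (n + 1 + 1) := by
      rintro _ ⟨i, hi, rfl⟩
      simp only [Set.mem_Iio] at hi
      exact ⟨i, by simp only [Set.mem_Iio]; omega, hl i hi⟩
    refine ⟨Function.update l (n + 1) d.snd, Function.update p (n + 1) q, ?_, ?_, ?_, ?_⟩
    · rw [hl 0 (by omega), h0]
    · intro a ha b hb hab
      simp only [Set.mem_Iio] at ha hb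
      rcases Nat.lt_succ_iff_lt_or_eq.1 ha with ha | rfl <;>
        rcases Nat.lt_succ_iff_lt_or_eq.1 hb with hb | rfl
      · rw [hl a ha, hl b hb] at hab
        exact hinj ha hb hab
      · rw [hl a ha, Function.update_self] at hab
        exact absurd ⟨a, ha, hab⟩ hd2
      · rw [hl b hb, Function.update_self] at hab
        exact absurd ⟨b, hb, hab.symm⟩ hd2
      · rfl
    · intro i hi
      rcases Nat.lt_succ_iff_lt_or_eq.1 hi with hi | rfl
      · rw [hl i hi]
        obtain ⟨w, hw⟩ := hconn i hi
        exact ⟨w, fun v hv => himg (hw v hv)⟩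
      · rw [Function.update_self]
        obtain ⟨w, hw⟩ := hconn q hq
        refine ⟨(w.copy rfl hql).concat d.adj, fun v hv => ?_⟩
        rw [SimpleGraph.Walk.support_concat, List.mem_append] at hv
        rcases hv with hv | hv
        · rw [SimpleGraph.Walk.support_copy] at hv
          exact himg (hw v hv)
        · rw [List.mem_singleton] at hv
          exact ⟨n + 1, by simp, by rw [hv, Function.update_self]⟩
    · intro i hi hin
      rcases Nat.lt_succ_iff_lt_or_eq.1 hin with hin | rfl
      · obtain ⟨h1, h2⟩ := hp i hi hin
        rw [Function.update_of_ne (by omega), hl i hin, hl (p i) (by omega)]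
        refine ⟨h1, fun j hj => ?_⟩
        rw [hl j (by omega)]
        exact h2 j hj
      · rw [Function.update_self, Function.update_self, hl q hq]
        refine ⟨hq, fun j hj x hx hxj => ?_⟩
        rw [hl j hj] at hxj
        obtain ⟨w1, hw1⟩ := hconn j hj
        obtain ⟨w2, hw2⟩ := hconn q hq
        rw [hql]
        refine h.mem_of_leaving hd2 d.adj.symm (w1.reverse.append (w2.copy rfl hql)) ?_ hx hxj
        intro v hv
        rw [SimpleGraph.Walk.mem_support_append_iff] at hv
        rcases hv with hv | hv
        · rw [SimpleGraph.Walk.support_reverse, List.mem_reverse] at hv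
          exact hw1 v hv
        · rw [SimpleGraph.Walk.support_copy] at hv
          exact hw2 v hv

end JoinTree

/-! ### Query plans -/

/-- A plan for a free-connex acyclic query: a tree of nodes `0, ..., N - 1` (parents first), each of
them a projection of an atom to the variables `X i`. The nodes from `m` on are the atoms themselves;
the variables of the nodes below `m` are the free variables of the query. The variables that a node
shares with its predecessors are those in the key `K i`, and they occur in the parent. -/
structure Plan (Q : CQ) where
  N : ℕ
  m : ℕ
  m_pos : 0 < m
  m_le : m ≤ N
  atom : ℕ → Fin Q.numAtoms
  X : ℕ → List ℕ
  K : ℕ → List ℕ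
  par : ℕ → ℕ
  X_sub : ∀ i < N, ∀ x ∈ X i, ∃ j, (Q.args (atom i) j : ℕ) = x
  X_full : ∀ i, m ≤ i → i < N → ∀ j, (Q.args (atom i) j : ℕ) ∈ X i
  par_lt : ∀ i, 0 < i → i < N → par i < i
  K_sub : ∀ i < N, ∀ x ∈ K i, x ∈ X i
  K_par : ∀ i, 0 < i → i < N → ∀ x ∈ K i, x ∈ X (par i)
  rip : ∀ i < N, ∀ j < i, ∀ x ∈ X i, x ∈ X j → x ∈ K i
  head_iff : ∀ x : Fin Q.numVars, x ∈ Q.head ↔ ∃ i < m, (x : ℕ) ∈ X i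
  bij : Set.BijOn atom (Set.Ico m N) Set.univ
  K_zero : K 0 = []

open Classical in
/-- A set of variables as a list of numbers. -/
noncomputable def varList {n : ℕ} (S : Set (Fin n)) : List ℕ :=
  ((List.finRange n).filter (· ∈ S)).map Fin.val

theorem mem_varList {n : ℕ} {S : Set (Fin n)} {x : ℕ} : x ∈ varList S ↔ ∃ y ∈ S, (y : ℕ) = x := by
  simp [varList]

theorem coe_mem_varList {n : ℕ} {S : Set (Fin n)} {x : Fin n} : (x : ℕ) ∈ varList S ↔ x ∈ S := by
  rw [mem_varList]
  exact ⟨fun ⟨y, hy, h⟩ => Fin.ext h ▸ hy, fun h => ⟨x, h, rfl⟩⟩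

/-- Every atom gets two nodes. The upper copies are intersected with the head and follow the join
tree of the query, whose running intersection property survives the intersection. The lower copies
are the full atoms; they follow the join tree that includes the head, rooted at the head. A lower
node shares only free variables with upper nodes, so the head accounts for all of them. -/
theorem CQ.FreeConnexAcyclic.nonempty_plan {Q : CQ} (hQ : Q.FreeConnexAcyclic) :
    Nonempty (Plan Q) := by
  classical
  obtain ⟨⟨T₁, hT₁⟩, T₂, hT₂⟩ := hQ
  obtain ⟨r⟩ := hT₁.1.1.nonempty
  obtain ⟨l₁, p₁, -, hb₁, h₁⟩ := hT₁.exists_order r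
  obtain ⟨l₂, p₂, h₂0, hb₂, h₂⟩ := hT₂.exists_order none
  simp only [Fintype.card_option, Fintype.card_fin] at hb₁ h₁ hb₂ h₂
  have hpos : 0 < Q.numAtoms := Fin.pos r
  choose idx hidx hidx' using fun a : Fin Q.numAtoms => hb₁.2.2 (Set.mem_univ a)
  simp only [Set.mem_Iio] at hidx
  have hsome : ∀ i, 0 < i → i < Q.numAtoms + 1 → l₂ i = some ((l₂ i).getD r) := by
    intro i h0 hi
    cases hl : l₂ i with
    | some a => rfl
    | none =>
      have := hb₂.2.1 (show i ∈ Set.Iio (Q.numAtoms + 1) from hi)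
        (show 0 ∈ Set.Iio (Q.numAtoms + 1) by simp) (by rw [hl, h₂0])
      omega
  -- Position `0` of the second order is the head, which is not a node. Node `numAtoms + k` hence
  -- corresponds to position `k + 1`.
  let atom : ℕ → Fin Q.numAtoms := fun i => if i < Q.numAtoms then l₁ i else (l₂ (i - Q.numAtoms + 1)).getD r
  let S : ℕ → Set (Fin Q.numVars) := fun i =>
    if i < Q.numAtoms then Q.edge (atom i) ∩ {x | x ∈ Q.head} else Q.edge (atom i)
  -- An atom that hangs from the head in the second tree is attached to its own upper copy, which
  -- contains precisely the free variables of that atom.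
  let par : ℕ → ℕ := fun i =>
    if i < Q.numAtoms then p₁ i else
      if p₂ (i - Q.numAtoms + 1) = 0 then idx (atom i) else Q.numAtoms + p₂ (i - Q.numAtoms + 1) - 1
  have hSe : ∀ i x, x ∈ S i → x ∈ Q.edge (atom i) := by
    intro i x hx
    simp only [S] at hx
    split_ifs at hx
    · exact hx.1
    · exact hx
  have hatom1 : ∀ i < Q.numAtoms, atom i = l₁ i := fun i hi => if_pos hi
  have hatom2 : ∀ i, Q.numAtoms ≤ i → i < 2 * Q.numAtoms → l₂ (i - Q.numAtoms + 1) = some (atom i) := fun i hi hi' => by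
    rw [hsome (i - Q.numAtoms + 1) (by omega) (by omega)]
    simp only [atom, if_neg (not_lt.2 hi)]
  have hS1 : ∀ i < Q.numAtoms, ∀ x, x ∈ S i ↔ x ∈ Q.edge (l₁ i) ∧ x ∈ Q.head := fun i hi x => by
    simp only [S, if_pos hi, hatom1 i hi]
    rfl
  have hS2 : ∀ i, Q.numAtoms ≤ i → S i = Q.edge (atom i) := fun i hi => if_neg (not_lt.2 hi)
  have hpar : ∀ i, 0 < i → i < 2 * Q.numAtoms → par i < i := by
    intro i h0 hi
    simp only [par]
    split_ifs with h1 h2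
    · exact (h₁ i h0 h1).1
    · exact (hidx _).trans_le (not_lt.1 h1)
    · have := (h₂ (i - Q.numAtoms + 1) (by omega) (by omega)).1
      omega
  have hrip : ∀ i < 2 * Q.numAtoms, ∀ j < i, ∀ x ∈ S i, x ∈ S j → x ∈ S (par i) := by
    intro i hi j hj x hxi hxj
    by_cases hil : i < Q.numAtoms
    · have hpi := h₁ i (by omega) hil
      have hpe : par i = p₁ i := if_pos hil
      rw [hS1 i hil] at hxi
      rw [hS1 j (by omega)] at hxj
      rw [hpe, hS1 _ (by omega)]
      exact ⟨hpi.2 j hj x hxi.1 hxj.1, hxi.2⟩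
    · have hpi := h₂ (i - Q.numAtoms + 1) (by omega) (by omega)
      have hx2 : x ∈ Q.edgeWithHead (l₂ (i - Q.numAtoms + 1)) := by
        rw [hatom2 i (by omega) hi]
        exact hSe i x hxi
      have hxp : x ∈ Q.edgeWithHead (l₂ (p₂ (i - Q.numAtoms + 1))) := by
        by_cases hjl : j < Q.numAtoms
        -- An upper node has only free variables, so the head can stand in for it as the
        -- predecessor.
        · refine hpi.2 0 (by omega) x hx2 ?_
          rw [h₂0]
          exact ((hS1 j hjl x).1 hxj).2
        · refine hpi.2 (j - Q.numAtoms + 1) (by omega) x hx2 ?_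
          rw [hatom2 j (by omega) (by omega)]
          exact hSe j x hxj
      by_cases hq : p₂ (i - Q.numAtoms + 1) = 0
      · have hpe : par i = idx (atom i) := by simp only [par, if_neg hil, if_pos hq]
        rw [hq, h₂0] at hxp
        rw [hpe, hS1 _ (hidx _), hidx']
        exact ⟨hSe i x hxi, hxp⟩
      · have hpe : par i = Q.numAtoms + p₂ (i - Q.numAtoms + 1) - 1 := by simp only [par, if_neg hil, if_neg hq]
        rw [hpe, hS2 _ (by omega)]
        have h3 := hatom2 (Q.numAtoms + p₂ (i - Q.numAtoms + 1) - 1) (by omega) (by omega)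
        rw [show Q.numAtoms + p₂ (i - Q.numAtoms + 1) - 1 - Q.numAtoms + 1 = p₂ (i - Q.numAtoms + 1) by omega] at h3
        rw [h3] at hxp
        exact hxp
  exact ⟨{
    N := 2 * Q.numAtoms
    m := Q.numAtoms
    m_pos := hpos
    m_le := by omega
    atom := atom
    X := fun i => varList (S i)
    -- The key is the intersection with the parent. The parent of the root is a meaningless value,
    -- so the root needs a separate case.
    K := fun i => if i = 0 then [] else (varList (S i)).filter (· ∈ varList (S (par i)))
    par := par
    X_sub := fun i _ x hx => by
      obtain ⟨y, hy, rfl⟩ := mem_varList.1 hx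
      obtain ⟨j, hj⟩ := hSe i y hy
      exact ⟨j, by rw [hj]⟩
    X_full := fun i hi _ j => by
      rw [coe_mem_varList, hS2 i hi]
      exact ⟨j, rfl⟩
    par_lt := hpar
    K_sub := fun i _ x hx => by
      split_ifs at hx
      · simp at hx
      · exact (List.mem_filter.1 hx).1
    K_par := fun i h0 _ x hx => by
      rw [if_neg (by omega)] at hx
      simpa using (List.mem_filter.1 hx).2
    rip := fun i hi j hj x hxi hxj => by
      rw [if_neg (by omega), List.mem_filter]
      refine ⟨hxi, ?_⟩
      obtain ⟨y, hy, rfl⟩ := mem_varList.1 hxi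
      rw [coe_mem_varList] at hxj
      simpa [coe_mem_varList] using hrip i hi j hj y hy hxj
    head_iff := fun x => by
      constructor
      · intro hx
        obtain ⟨a, j, hj⟩ := Q.covered x
        refine ⟨idx a, hidx a, ?_⟩
        rw [coe_mem_varList, hS1 _ (hidx a), hidx']
        exact ⟨⟨j, hj⟩, hx⟩
      · rintro ⟨i, hi, hx⟩
        rw [coe_mem_varList, hS1 i hi] at hx
        exact hx.2
    bij := by
      refine ⟨Set.mapsTo_univ _ _, ?_, ?_⟩
      · intro i hi j hj hij
        simp only [Set.mem_Ico] at hi hj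
        have h1 := hatom2 i hi.1 hi.2
        rw [hij, ← hatom2 j hj.1 hj.2] at h1
        have := hb₂.2.1 (show i - Q.numAtoms + 1 < Q.numAtoms + 1 by omega)
          (show j - Q.numAtoms + 1 < Q.numAtoms + 1 by omega) h1
        omega
      · intro a _
        obtain ⟨i, hi, hia⟩ := hb₂.2.2 (Set.mem_univ (some a))
        simp only [Set.mem_Iio] at hi
        have hi0 : i ≠ 0 := by
          rintro rfl
          rw [h₂0] at hia
          cases hia
        refine ⟨Q.numAtoms + i - 1, by simp only [Set.mem_Ico]; omega, ?_⟩
        have h1 := hatom2 (Q.numAtoms + i - 1) (by omega) (by omega)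
        rw [show Q.numAtoms + i - 1 - Q.numAtoms + 1 = i by omega, hia] at h1
        exact (Option.some.inj h1).symm
    K_zero := if_pos rfl }⟩

/-! ### The tables of the dynamic program -/

section Tables

variable {Q : CQ} {α : Type u} {W : Type v}

/-- For every node and every key, a group of tuple numbers at the positions `1, ..., cnt`; and the
optimal weight of a tuple of a node within its subtree. -/
structure Tables (α : Type u) (W : Type v) where
  cnt : ℕ → List (Word α) → ℕ
  hp : ℕ → List (Word α) → ℕ → ℕ
  ow : ℕ → ℕ → W

namespace Plan

variable (Pl : Plan Q)

abbrev rel (i : ℕ) : Fin Q.numRels := Q.rel (Pl.atom i)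

def children (i : ℕ) : List ℕ := (List.range Pl.N).filter fun c => i < c ∧ Pl.par c = i

variable {Pl} in
theorem mem_children {i c : ℕ} : c ∈ Pl.children i ↔ c < Pl.N ∧ i < c ∧ Pl.par c = i := by
  simp [children]

theorem prod_children {M : Type*} [CommMonoid M] (i : ℕ) (f : ℕ → M) :
    ((Pl.children i).map f).prod =
      ∏ c ∈ (Finset.Ico (i + 1) Pl.N).filter (fun c => Pl.par c = i), f c := by
  have hn : (Pl.children i).Nodup := List.nodup_range.filter _
  rw [← List.prod_toFinset f hn]
  refine Finset.prod_congr ?_ fun _ _ => rfl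
  ext c
  simp only [List.mem_toFinset, mem_children, Finset.mem_filter, Finset.mem_Ico]
  omega

variable [CommSemiring W] (D : Database Q α W)

/-- The valuation `a` agrees with the `k`-th tuple of the atom of node `i`. -/
def Match (i k : ℕ) (a : ℕ → Word α) : Prop :=
  ∀ j : Fin (Q.arity (Pl.rel i)),
    a (Q.args (Pl.atom i) j) = inputMem D [.num (Pl.rel i), .num k, .num j]

/-- The weight that node `i` contributes with its `k`-th tuple. -/
def base (i k : ℕ) : W := if i < Pl.m then 1 else inputWMem D [.num (Pl.rel i), .num k]

/-- The optimal weight in the subtree of node `c` for the key given by `a`. -/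
def best (T : Tables α W) (c : ℕ) (a : ℕ → Word α) : W := T.ow c (T.hp c ((Pl.K c).map a) 1)

/-- The table of node `i` is correct for the first `k₀` tuples, up to the order of the groups. -/
structure NodeOK (T : Tables α W) (i k₀ : ℕ) : Prop where
  sound : ∀ κ p, 1 ≤ p → p ≤ T.cnt i κ → T.hp i κ p < k₀ ∧
    ∃ a, Pl.Match D i (T.hp i κ p) a ∧ (Pl.K i).map a = κ ∧
      (∀ c ∈ Pl.children i, 1 ≤ T.cnt c ((Pl.K c).map a)) ∧
      T.ow i (T.hp i κ p) =
        Pl.base D i (T.hp i κ p) * ((Pl.children i).map fun c => Pl.best T c a).prod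
  complete : ∀ k < k₀, ∀ a, Pl.Match D i k a →
    (∀ c ∈ Pl.children i, 1 ≤ T.cnt c ((Pl.K c).map a)) →
    ∃ p, 1 ≤ p ∧ p ≤ T.cnt i ((Pl.K i).map a) ∧
      ∃ a', Pl.Match D i (T.hp i ((Pl.K i).map a) p) a' ∧ ∀ x ∈ Pl.X i, a' x = a x
  distinct : ∀ κ p p' a a', 1 ≤ p → p ≤ T.cnt i κ → 1 ≤ p' → p' ≤ T.cnt i κ →
    Pl.Match D i (T.hp i κ p) a → Pl.Match D i (T.hp i κ p') a' →
    (∀ x ∈ Pl.X i, a x = a' x) → p = p'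

structure TablesOK (T : Tables α W) : Prop where
  node : ∀ i < Pl.N, Pl.NodeOK D T i (D.size (Pl.rel i))
  heap : ∀ i < Pl.N, ∀ κ, HeapFrom 1 (T.cnt i κ) fun p => T.ow i (T.hp i κ p)

/-- The valuation `a` uses the tuple at position `p` of its group at node `i`. -/
def Ent (T : Tables α W) (i : ℕ) (a : ℕ → Word α) (p : ℕ) : Prop :=
  1 ≤ p ∧ p ≤ T.cnt i ((Pl.K i).map a) ∧
    ∃ a', Pl.Match D i (T.hp i ((Pl.K i).map a) p) a' ∧ ∀ x ∈ Pl.X i, a' x = a x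

/-- The valuation `a` is given by the positions `v` at the nodes below `i`. -/
def Rep (T : Tables α W) (i : ℕ) (v : ℕ → ℕ) (a : ℕ → Word α) : Prop :=
  ∀ j < i, Pl.Ent D T j a (v j)

def opt (T : Tables α W) (i : ℕ) (a : ℕ → Word α) (p : ℕ) : W := T.ow i (T.hp i ((Pl.K i).map a) p)

def baseAt (T : Tables α W) (i : ℕ) (a : ℕ → Word α) (p : ℕ) : W :=
  Pl.base D i (T.hp i ((Pl.K i).map a) p)

/-- The optimal weight of a completion of a partial solution on the nodes below `i`. -/
def prefixOpt (T : Tables α W) (i : ℕ) (v : ℕ → ℕ) (a : ℕ → Word α) : W :=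
  (∏ j ∈ Finset.range i, Pl.baseAt D T j a (v j)) *
    ∏ c ∈ (Finset.Ico i Pl.N).filter (fun c => Pl.par c < i), Pl.best T c a

/-- `prefixOpt` without the contribution of the subtree of `i`. -/
def prefixRest (T : Tables α W) (i : ℕ) (v : ℕ → ℕ) (a : ℕ → Word α) : W :=
  (∏ j ∈ Finset.range i, Pl.baseAt D T j a (v j)) *
    ∏ c ∈ (Finset.Ico (i + 1) Pl.N).filter (fun c => Pl.par c < i), Pl.best T c a

/-- The weight of an answer. -/
def answerWeight (T : Tables α W) (a : ℕ → Word α) : W :=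
  ∏ c ∈ (Finset.Ico Pl.m Pl.N).filter (fun c => Pl.par c < Pl.m), Pl.best T c a

/-! ### Position vectors, their valuations and their weights -/

variable {Pl D} {T : Tables α W}

theorem map_key_congr {i : ℕ} (hi : i < Pl.N) {a b : ℕ → Word α}
    (h : ∀ x ∈ Pl.X i, a x = b x) : (Pl.K i).map a = (Pl.K i).map b :=
  List.map_congr_left fun x hx => h x (Pl.K_sub i hi x hx)

/-- The group in which a node searches is determined by the values at its parent; the root has a
single group, with the empty key. -/
theorem map_key_congr_par {i : ℕ} (hi : i < Pl.N) {a b : ℕ → Word α}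
    (h : 0 < i → ∀ x ∈ Pl.X (Pl.par i), a x = b x) : (Pl.K i).map a = (Pl.K i).map b := by
  rcases Nat.eq_zero_or_pos i with rfl | h0
  · rw [Pl.K_zero]; rfl
  · exact List.map_congr_left fun x hx => h h0 x (Pl.K_par i h0 hi x hx)

theorem best_congr {c : ℕ} (hc : c < Pl.N) {a b : ℕ → Word α}
    (h : 0 < c → ∀ x ∈ Pl.X (Pl.par c), a x = b x) : Pl.best T c a = Pl.best T c b := by
  rw [best, best, map_key_congr_par hc h]

theorem Match.eq_on {i k : ℕ} (hi : i < Pl.N) {a b : ℕ → Word α} (ha : Pl.Match D i k a)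
    (hb : Pl.Match D i k b) : ∀ x ∈ Pl.X i, a x = b x := by
  intro x hx
  obtain ⟨j, rfl⟩ := Pl.X_sub i hi x hx
  rw [ha j, hb j]

theorem Ent.congr {i p : ℕ} (hi : i < Pl.N) {a b : ℕ → Word α}
    (h : ∀ x ∈ Pl.X i, a x = b x) (he : Pl.Ent D T i a p) : Pl.Ent D T i b p := by
  obtain ⟨h1, h2, a', h3, h4⟩ := he
  rw [Ent, ← map_key_congr hi h]
  exact ⟨h1, h2, a', h3, fun x hx => (h4 x hx).trans (h x hx)⟩

/-- Soundness speaks of some valuation that matches the stored tuple. It agrees with `a` on the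
variables of the node, and the keys of the children involve no others. -/
theorem Ent.spec {i p : ℕ} (hi : i < Pl.N) {k₀ : ℕ} (hT : Pl.NodeOK D T i k₀) {a : ℕ → Word α}
    (he : Pl.Ent D T i a p) :
    (∀ c ∈ Pl.children i, 1 ≤ T.cnt c ((Pl.K c).map a)) ∧
      Pl.opt T i a p = Pl.baseAt D T i a p * ((Pl.children i).map fun c => Pl.best T c a).prod := by
  obtain ⟨h1, h2, a', h3, h4⟩ := he
  obtain ⟨-, a₀, h5, -, h6, h7⟩ := hT.sound _ p h1 h2
  have hX : ∀ x ∈ Pl.X i, a₀ x = a x := fun x hx => (h5.eq_on hi h3 x hx).trans (h4 x hx)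
  have hc : ∀ c ∈ Pl.children i, c < Pl.N ∧ (0 < c → ∀ x ∈ Pl.X (Pl.par c), a₀ x = a x) := by
    intro c hc
    obtain ⟨hc1, hc2, hc3⟩ := mem_children.1 hc
    exact ⟨hc1, fun _ => by rw [hc3]; exact hX⟩
  refine ⟨fun c hcc => ?_, ?_⟩
  · rw [← map_key_congr_par (hc c hcc).1 (hc c hcc).2]
    exact h6 c hcc
  · rw [opt, h7, baseAt]
    congr 2
    exact List.map_congr_left fun c hcc => best_congr (hc c hcc).1 (hc c hcc).2

theorem Ent.unique {i p p' k₀ : ℕ} (hT : Pl.NodeOK D T i k₀) {a : ℕ → Word α}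
    (he : Pl.Ent D T i a p) (he' : Pl.Ent D T i a p') : p = p' := by
  obtain ⟨h1, h2, b, h3, h4⟩ := he
  obtain ⟨h1', h2', b', h3', h4'⟩ := he'
  exact hT.distinct _ p p' b b' h1 h2 h1' h2' h3 h3' fun x hx => (h4 x hx).trans (h4' x hx).symm

theorem Rep.mono {i i' : ℕ} {v : ℕ → ℕ} {a : ℕ → Word α} (h : Pl.Rep D T i v a) (hi : i' ≤ i) :
    Pl.Rep D T i' v a := fun j hj => h j (hj.trans_le hi)

/-- Extend a partial solution by a tuple of the next node. -/
theorem Rep.step_of {i : ℕ} (hi : i < Pl.N) {v : ℕ → ℕ} {a a' b : ℕ → Word α}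
    (h : Pl.Rep D T i v a) (h1 : 1 ≤ v i) (h2 : v i ≤ T.cnt i ((Pl.K i).map a))
    (hb : Pl.Match D i (T.hp i ((Pl.K i).map a) (v i)) b) (hbK : (Pl.K i).map b = (Pl.K i).map a)
    (hX : ∀ x ∈ Pl.X i, a' x = b x) (hX' : ∀ x, x ∉ Pl.X i → a' x = a x) :
    Pl.Rep D T (i + 1) v a' ∧ ∀ j < i, ∀ x ∈ Pl.X j, a' x = a x := by
  have hK : ∀ x ∈ Pl.K i, b x = a x := List.map_inj_left.1 hbK
  -- A variable of the new node that occurred earlier lies in the key by running intersection, and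
  -- there the new tuple agrees with `a`.
  have hagree : ∀ j < i, ∀ x ∈ Pl.X j, a' x = a x := by
    intro j hj x hx
    by_cases hxi : x ∈ Pl.X i
    · rw [hX x hxi]
      exact hK x (Pl.rip i hi j hj x hxi hx)
    · exact hX' x hxi
  refine ⟨fun j hj => ?_, hagree⟩
  rcases Nat.lt_succ_iff_lt_or_eq.1 hj with hj | rfl
  · exact (h j hj).congr (hj.trans hi) fun x hx => (hagree j hj x hx).symm
  · have hk : (Pl.K j).map a' = (Pl.K j).map a := by
      rw [← hbK]
      exact map_key_congr hi hX
    rw [Ent, hk]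
    exact ⟨h1, h2, b, hb, fun x hx => (hX x hx).symm⟩

theorem Rep.step {i k₀ : ℕ} (hi : i < Pl.N) (hT : Pl.NodeOK D T i k₀) {v : ℕ → ℕ}
    {a : ℕ → Word α} (h : Pl.Rep D T i v a) (h1 : 1 ≤ v i) (h2 : v i ≤ T.cnt i ((Pl.K i).map a)) :
    ∃ a', Pl.Rep D T (i + 1) v a' ∧ ∀ j < i, ∀ x ∈ Pl.X j, a' x = a x := by
  classical
  obtain ⟨-, b, hb, hbK, -⟩ := hT.sound _ _ h1 h2
  exact ⟨fun x => if x ∈ Pl.X i then b x else a x, h.step_of hi h1 h2 hb hbK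
    (fun x hx => if_pos hx) fun x hx => if_neg hx⟩

/-- Extend a partial solution by optimal tuples of the following nodes. -/
theorem Rep.extend (hT : Pl.TablesOK D T) {i : ℕ} (h0 : 0 < i) {v : ℕ → ℕ} {a : ℕ → Word α}
    (h : Pl.Rep D T i v a) (M : ℕ) (hiM : i ≤ M) (hM : M ≤ Pl.N)
    (hv : ∀ j, i ≤ j → j < M → v j = 1) :
    ∃ a', Pl.Rep D T M v a' ∧ ∀ j < i, ∀ x ∈ Pl.X j, a' x = a x := by
  induction M, hiM using Nat.le_induction with
  | base => exact ⟨a, h, fun _ _ _ _ => rfl⟩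
  | succ M hiM ih =>
    obtain ⟨a₁, h1, h2⟩ := ih (by omega) fun j hj hj' => hv j hj (by omega)
    have hpar := Pl.par_lt M (by omega) (by omega)
    -- Tables keep only tuples with partners in all children, so the group at `M` is not empty and
    -- position `1` exists: the search never runs into a dead end.
    have hc := ((h1 (Pl.par M) hpar).spec (by omega) (hT.node _ (by omega))).1 M
      (mem_children.2 ⟨by omega, hpar, rfl⟩)
    obtain ⟨a₂, h3, h4⟩ := h1.step (by omega) (hT.node M (by omega))
      (by rw [hv M hiM (by omega)]) (by rw [hv M hiM (by omega)]; exact hc)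
    exact ⟨a₂, h3, fun j hj x hx => (h4 j (by omega) x hx).trans (h2 j hj x hx)⟩

/-- By induction along the tree: the parent fixes the key, and the key and the position fix the
tuple. -/
theorem Rep.eq_on {i : ℕ} (hi : i ≤ Pl.N) {v : ℕ → ℕ} {a b : ℕ → Word α}
    (ha : Pl.Rep D T i v a) (hb : Pl.Rep D T i v b) : ∀ j < i, ∀ x ∈ Pl.X j, a x = b x := by
  intro j
  induction j using Nat.strong_induction_on with
  | _ j ih =>
    intro hj x hx
    have hk : (Pl.K j).map a = (Pl.K j).map b := map_key_congr_par (by omega) fun h0 =>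
      ih _ (Pl.par_lt j h0 (by omega)) (by have := Pl.par_lt j h0 (by omega); omega)
    obtain ⟨-, -, a', h1, h2⟩ := ha j hj
    obtain ⟨-, -, b', h3, h4⟩ := hb j hj
    rw [hk] at h1
    rw [← h2 x hx, ← h4 x hx]
    exact h1.eq_on (by omega) h3 x hx

theorem Rep.pos_eq (hT : Pl.TablesOK D T) {i : ℕ} (hi : i ≤ Pl.N) {v v' : ℕ → ℕ}
    {a b : ℕ → Word α} (ha : Pl.Rep D T i v a) (hb : Pl.Rep D T i v' b)
    (hab : ∀ j < i, ∀ x ∈ Pl.X j, a x = b x) : ∀ j < i, v j = v' j := fun j hj =>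
  ((ha j hj).congr (by omega) (hab j hj)).unique (hT.node j (by omega)) (hb j hj)

/-- Choosing a tuple at `i` turns the optimum of its subtree into the base weight of the tuple times
the optima of the children of `i`, and these are exactly the subtrees that become pending. -/
theorem prefixOpt_succ (hT : Pl.TablesOK D T) {i : ℕ} (hi : i < Pl.N) {v : ℕ → ℕ}
    {a : ℕ → Word α} (he : Pl.Ent D T i a (v i)) :
    Pl.prefixOpt D T (i + 1) v a = Pl.prefixRest D T i v a * Pl.opt T i a (v i) := by
  rw [prefixOpt, prefixRest, (he.spec hi (hT.node i hi)).2, Finset.prod_range_succ, prod_children]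
  have hu : (Finset.Ico (i + 1) Pl.N).filter (fun c => Pl.par c < i + 1) =
      (Finset.Ico (i + 1) Pl.N).filter (fun c => Pl.par c < i) ∪
        (Finset.Ico (i + 1) Pl.N).filter (fun c => Pl.par c = i) := by
    rw [← Finset.filter_or]
    refine Finset.filter_congr fun c _ => ?_
    omega
  rw [hu, Finset.prod_union]
  · ring
  · refine Finset.disjoint_filter.2 fun c _ h1 h2 => ?_
    omega

/-- Before the choice at `i`, its subtree is pending and enters with the best member of its group.
The root is excluded because its parent is meaningless. -/
theorem prefixOpt_eq {i : ℕ} (h0 : 0 < i) (hi : i < Pl.N) (v : ℕ → ℕ) (a : ℕ → Word α) :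
    Pl.prefixOpt D T i v a = Pl.prefixRest D T i v a * Pl.best T i a := by
  rw [prefixOpt, prefixRest, ← Finset.insert_Ico_succ_left_eq_Ico hi, Finset.filter_insert,
    if_pos (Pl.par_lt i h0 hi), Finset.prod_insert (by simp)]
  simp only [Order.succ_eq_add_one]
  ring

theorem prefixOpt_m (v : ℕ → ℕ) (a : ℕ → Word α) :
    Pl.prefixOpt D T Pl.m v a = Pl.answerWeight T a := by
  rw [prefixOpt, answerWeight, Finset.prod_eq_one, one_mul]
  intro j hj
  rw [baseAt, base, if_pos (Finset.mem_range.1 hj)]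

theorem prefixRest_congr {i : ℕ} (hi : i ≤ Pl.N) {v v' : ℕ → ℕ} {a b : ℕ → Word α}
    (hv : ∀ j < i, v j = v' j) (hab : ∀ j < i, ∀ x ∈ Pl.X j, a x = b x) :
    Pl.prefixRest D T i v a = Pl.prefixRest D T i v' b := by
  rw [prefixRest, prefixRest]
  congr 1
  · refine Finset.prod_congr rfl fun j hj => ?_
    rw [Finset.mem_range] at hj
    rw [baseAt, baseAt, hv j hj, map_key_congr (by omega) (hab j hj)]
  · refine Finset.prod_congr rfl fun c hc => ?_
    simp only [Finset.mem_filter, Finset.mem_Ico] at hc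
    exact best_congr (by omega) fun _ => hab _ hc.2

theorem answerWeight_congr {a b : ℕ → Word α} (hab : ∀ j < Pl.m, ∀ x ∈ Pl.X j, a x = b x) :
    Pl.answerWeight T a = Pl.answerWeight T b := by
  rw [answerWeight, answerWeight]
  refine Finset.prod_congr rfl fun c hc => ?_
  simp only [Finset.mem_filter, Finset.mem_Ico] at hc
  exact best_congr (by omega) fun _ => hab _ hc.2

/-- Fixing one more position replaces the root of a heap by another member and leaves all other
factors alone. -/
theorem Rep.prefixOpt_le (hW : IsSelective W) (hT : Pl.TablesOK D T) {i M : ℕ} (h0 : 0 < i)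
    (hiM : i ≤ M) (hM : M ≤ Pl.N) {v : ℕ → ℕ} {a : ℕ → Word α} (h : Pl.Rep D T M v a) :
    DLe (Pl.prefixOpt D T i v a) (Pl.prefixOpt D T M v a) := by
  induction M, hiM using Nat.le_induction with
  | base => exact hW.refl _
  | succ M hiM ih =>
    refine (ih (by omega) (h.mono (by omega))).trans ?_
    rw [prefixOpt_eq (by omega) (by omega), prefixOpt_succ hT (by omega) (h M (by omega))]
    exact ((hT.heap M (by omega) _).root_le hW _ (h M (by omega)).1 (h M (by omega)).2.1).mul_left _

theorem Rep.prefixOpt_const (hT : Pl.TablesOK D T) {i M : ℕ} (h0 : 0 < i)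
    (hiM : i ≤ M) (hM : M ≤ Pl.N) {v : ℕ → ℕ} {a : ℕ → Word α} (h : Pl.Rep D T M v a)
    (hv : ∀ j, i ≤ j → j < M → v j = 1) :
    Pl.prefixOpt D T i v a = Pl.prefixOpt D T M v a := by
  induction M, hiM using Nat.le_induction with
  | base => rfl
  | succ M hiM ih =>
    rw [ih (by omega) (h.mono (by omega)) fun j hj hj' => hv j hj (by omega),
      prefixOpt_eq (by omega) (by omega), prefixOpt_succ hT (by omega) (h M (by omega)),
      hv M hiM (by omega)]
    rfl

/-- Halving the last position that is not `1` does not increase the weight. -/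
theorem Rep.halve (hT : Pl.TablesOK D T) {v : ℕ → ℕ} {a : ℕ → Word α}
    (h : Pl.Rep D T Pl.m v a) {i : ℕ} (hi : i < Pl.m) (h2 : 2 ≤ v i)
    (hv : ∀ j, i < j → j < Pl.m → v j = 1) :
    ∃ a', Pl.Rep D T Pl.m (Function.update v i (v i / 2)) a' ∧
      DLe (Pl.answerWeight T a') (Pl.answerWeight T a) := by
  have hm := Pl.m_le
  set v' := Function.update v i (v i / 2) with hv'
  have hv'i : v' i = v i / 2 := Function.update_self ..
  have hv'j : ∀ j, j ≠ i → v' j = v j := fun j hj => Function.update_of_ne hj ..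
  have hr : Pl.Rep D T i v' a := fun j hj => by
    rw [hv'j j (by omega)]
    exact h j (by omega)
  have hrange := (h i hi).2.1
  -- The key at `i` depends on earlier nodes only, so `v i / 2` is a position of the same group, the
  -- heap parent of `v i`. The later nodes may enter other groups, but there they take position `1`,
  -- so their choices do not change the weight.
  obtain ⟨a₁, h3, h4⟩ := hr.step (by omega) (hT.node i (by omega)) (by omega) (by omega)
  obtain ⟨a₂, h5, h6⟩ := h3.extend hT (by omega) Pl.m (by omega) hm fun j hj hj' => by
    rw [hv'j j (by omega)]
    exact hv j (by omega) hj'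
  refine ⟨a₂, h5, ?_⟩
  have hagree : ∀ j < i, ∀ x ∈ Pl.X j, a₂ x = a x := fun j hj x hx =>
    (h6 j (by omega) x hx).trans (h4 j hj x hx)
  have hK : (Pl.K i).map a₂ = (Pl.K i).map a := map_key_congr_par (by omega) fun h0 =>
    hagree _ (Pl.par_lt i h0 (by omega))
  rw [← prefixOpt_m (D := D) v' a₂, ← prefixOpt_m (D := D) v a,
    ← h5.prefixOpt_const hT (i := i + 1) (by omega) (by omega) hm fun j hj hj' => by
      rw [hv'j j (by omega)]
      exact hv j (by omega) hj',
    ← h.prefixOpt_const hT (i := i + 1) (by omega) (by omega) hm fun j hj hj' =>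
      hv j (by omega) hj',
    prefixOpt_succ hT (by omega) (h5 i hi), prefixOpt_succ hT (by omega) (h i hi),
    prefixRest_congr (by omega) (fun j hj => hv'j j (by omega)) hagree]
  refine DLe.mul_left ?_ _
  rw [opt, opt, hK, hv'i]
  exact hT.heap i (by omega) _ (v i) h2 hrange (by omega)

theorem inputMem_tuple {R : Fin Q.numRels} (k : Fin (D.size R)) (j : Fin (Q.arity R)) :
    inputMem D [.num R, .num k, .num j] = .val (D.tuple R k j) := by
  simp [inputMem]

theorem inputWMem_weight {R : Fin Q.numRels} (k : Fin (D.size R)) :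
    inputWMem D [.num R, .num k] = D.weight R k := by
  simp [inputWMem]

/-- At the end no subtree is pending, upper nodes have weight `1`, and the lower nodes correspond to
the atoms one to one. -/
theorem prefixOpt_N {v : ℕ → ℕ} {a : ℕ → Word α}
    {t : (i : Fin Q.numAtoms) → Fin (D.size (Q.rel i))}
    (ht : ∀ j, Pl.m ≤ j → j < Pl.N → T.hp j ((Pl.K j).map a) (v j) = t (Pl.atom j)) :
    Pl.prefixOpt D T Pl.N v a = D.witnessWeight t := by
  rw [prefixOpt, Database.witnessWeight]
  simp only [Finset.Ico_self, Finset.filter_empty, Finset.prod_empty, mul_one]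
  rw [← Finset.prod_range_mul_prod_Ico _ Pl.m_le, Finset.prod_eq_one, one_mul]
  · refine Finset.prod_bij (fun j _ => Pl.atom j) (fun _ _ => Finset.mem_univ _) ?_ ?_ ?_
    · intro j hj j' hj' h
      exact Pl.bij.2.1 (by simpa using hj) (by simpa using hj') h
    · intro b _
      obtain ⟨j, hj, hjb⟩ := Pl.bij.2.2 (Set.mem_univ b)
      exact ⟨j, by simpa using hj, hjb⟩
    · intro j hj
      rw [Finset.mem_Ico] at hj
      rw [baseAt, base, if_neg (by omega), ht j hj.1 hj.2]
      exact inputWMem_weight _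
  · intro j hj
    rw [baseAt, base, if_pos (Finset.mem_range.1 hj)]

/-- An answer of the full query is given by positions at all nodes. -/
theorem exists_rep_of_isWitness (hT : Pl.TablesOK D T) {a₀ : Fin Q.numVars → α}
    {t : (i : Fin Q.numAtoms) → Fin (D.size (Q.rel i))} (h : D.IsWitness a₀ t) :
    ∃ v a, Pl.Rep D T Pl.N v a ∧ (∀ x : Fin Q.numVars, a x = .val (a₀ x)) ∧
      Pl.prefixOpt D T Pl.N v a = D.witnessWeight t := by
  classical
  let a : ℕ → Word α := fun x => if hx : x < Q.numVars then .val (a₀ ⟨x, hx⟩) else .num 0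
  have ha : ∀ x : Fin Q.numVars, a x = .val (a₀ x) := fun x => by simp [a]
  have hM : ∀ i, Pl.Match D i (t (Pl.atom i)) a := fun i j => by
    rw [ha, inputMem_tuple, h]
  -- Induction from the leaves: completeness at a node presupposes nonempty groups at its children.
  have hE : ∀ n i, i < Pl.N → Pl.N - i = n → ∃ p, Pl.Ent D T i a p := by
    intro n
    induction n using Nat.strong_induction_on with
    | _ n ih =>
      intro i hi hn
      obtain ⟨p, h1, h2, h3⟩ := (hT.node i hi).complete _ (t (Pl.atom i)).2 a (hM i) fun c hc => by
        obtain ⟨hc1, hc2, -⟩ := mem_children.1 hc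
        obtain ⟨q, h1, h2, -⟩ := ih (Pl.N - c) (by omega) c hc1 rfl
        exact h1.trans h2
      exact ⟨p, h1, h2, h3⟩
  choose! v hv using fun i hi => hE _ i hi rfl
  refine ⟨v, a, hv, ha, prefixOpt_N fun j hj hjN => ?_⟩
  obtain ⟨h1, h2, b, h3, h4⟩ := hv j hjN
  have hlt := ((hT.node j hjN).sound _ _ h1 h2).1
  -- A lower node keeps all variables of its atom and a relation lists no tuple twice; so the stored
  -- tuple is the tuple of the witness itself.
  refine congrArg Fin.val (D.tuple_injective _ (a₁ := ⟨_, hlt⟩) (a₂ := t (Pl.atom j)) ?_)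
  funext l
  have h5 := h3 l
  rw [h4 _ (Pl.X_full j hj hjN l), hM j l, inputMem_tuple] at h5
  have h6 := inputMem_tuple (D := D) ⟨_, hlt⟩ l
  simp only at h6
  rw [h6] at h5
  exact (Word.val.inj h5).symm

/-- Positions at all nodes give an answer of the full query. -/
theorem Rep.exists_isWitness (hT : Pl.TablesOK D T) {v : ℕ → ℕ} {a : ℕ → Word α}
    (h : Pl.Rep D T Pl.N v a) :
    ∃ a₀ t, D.IsWitness a₀ t ∧ (∀ x : Fin Q.numVars, a x = .val (a₀ x)) ∧
      Pl.prefixOpt D T Pl.N v a = D.witnessWeight t := by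
  choose node hnode hnode' using fun b : Fin Q.numAtoms => Pl.bij.2.2 (Set.mem_univ b)
  simp only [Set.mem_Ico] at hnode
  have hlt : ∀ j < Pl.N, T.hp j ((Pl.K j).map a) (v j) < D.size (Pl.rel j) := fun j hj =>
    ((hT.node j hj).sound _ _ (h j hj).1 (h j hj).2.1).1
  have hlt' : ∀ b, T.hp (node b) ((Pl.K (node b)).map a) (v (node b)) < D.size (Q.rel b) :=
    fun b => by
      have := hlt (node b) (hnode b).2
      rwa [Plan.rel, hnode'] at this
  let t : (i : Fin Q.numAtoms) → Fin (D.size (Q.rel i)) := fun b => ⟨_, hlt' b⟩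
  have hcell : ∀ (b : Fin Q.numAtoms) j, a (Q.args b j) = .val (D.tuple (Q.rel b) (t b) j) := by
    intro b j
    obtain ⟨h1, h2, b', h3, h4⟩ := h (node b) (hnode b).2
    have hX := Pl.X_full (node b) (hnode b).1 (hnode b).2
    rw [← inputMem_tuple]
    simp only [t]
    have h5 : ∀ j, a (Q.args (Pl.atom (node b)) j) = inputMem D [.num (Pl.rel (node b)),
        .num (T.hp (node b) ((Pl.K (node b)).map a) (v (node b))), .num j] := fun j => by
      rw [← h3 j, h4 _ (hX j)]
    clear_value t
    clear h1 h2 h3 h4 hX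
    -- The types of the components depend on the atom. With the tuple number abstracted, `atom (node
    -- b)` can be rewritten to `b`.
    generalize T.hp (node b) ((Pl.K (node b)).map a) (v (node b)) = k at h5
    have h6 := hnode' b
    unfold Plan.rel at h5
    rw [h6] at h5
    exact h5 j
  have hval : ∀ x : Fin Q.numVars, ∃ y, a x = .val y := fun x => by
    obtain ⟨b, j, rfl⟩ := Q.covered x
    exact ⟨_, hcell b j⟩
  choose a₀ ha₀ using hval
  refine ⟨a₀, t, fun b j => ?_, ha₀, prefixOpt_N fun j hj hjN => ?_⟩
  · have := hcell b j
    rw [ha₀] at this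
    exact (Word.val.inj this).symm
  · have : node (Pl.atom j) = j := Pl.bij.2.1 (hnode _) ⟨hj, hjN⟩ (hnode' _)
    simp only [t, this]

/-- A position vector represents an answer together with its weight. -/
theorem Rep.isMinWeight (hW : IsSelective W) (hT : Pl.TablesOK D T) {v : ℕ → ℕ} {a : ℕ → Word α}
    (h : Pl.Rep D T Pl.m v a) :
    ∃ r : List α, Q.head.map (fun x : Fin Q.numVars => a x) = r.map .val ∧ D.IsAnswer r ∧
      D.IsMinWeight r (Pl.answerWeight T a) := by
  -- The values of `v` from `m` on carry no information. Position `1` at all lower nodes selects an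
  -- optimal witness.
  let v' : ℕ → ℕ := fun j => if j < Pl.m then v j else 1
  have h' : Pl.Rep D T Pl.m v' a := fun j hj => by
    simp only [v', if_pos hj]
    exact h j hj
  have hv' : ∀ j, Pl.m ≤ j → j < Pl.N → v' j = 1 := fun j hj _ => if_neg (by omega)
  obtain ⟨b, hb, hba⟩ := h'.extend hT Pl.m_pos Pl.N Pl.m_le le_rfl hv'
  obtain ⟨b₀, t, hw, hb₀, hwt⟩ := hb.exists_isWitness hT
  have hhead : Q.head.map (fun x : Fin Q.numVars => a x) = (Q.head.map b₀).map Word.val := by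
    rw [List.map_map]
    refine List.map_congr_left fun x hx => ?_
    obtain ⟨i, hi, hxi⟩ := (Pl.head_iff x).1 hx
    rw [← hba i hi x hxi, hb₀]
    rfl
  have hweight : D.witnessWeight t = Pl.answerWeight T a := by
    rw [← hwt, ← hb.prefixOpt_const hT Pl.m_pos Pl.m_le le_rfl hv', prefixOpt_m]
    exact answerWeight_congr hba
  refine ⟨Q.head.map b₀, hhead, ⟨b₀, t, hw, rfl⟩, ⟨b₀, t, hw, rfl, hweight⟩, ?_⟩
  -- A competing witness with the same projection extends the same upper choice, so `prefixOpt_le`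
  -- compares it with the weight of the answer.
  intro c₀ t' hc hch
  obtain ⟨u, c, hu, hcc, hwt'⟩ := exists_rep_of_isWitness hT hc
  rw [← hwt']
  have := hu.prefixOpt_le hW hT Pl.m_pos Pl.m_le le_rfl
  rw [prefixOpt_m] at this
  rwa [answerWeight_congr (a := a) (b := c)]
  intro i hi x hx
  obtain ⟨j, rfl⟩ := Pl.X_sub i (hi.trans_le Pl.m_le) x hx
  have hmem := (Pl.head_iff (Q.args (Pl.atom i) j)).2 ⟨i, hi, hx⟩
  have e1 := List.map_inj_left.1 hch _ hmem
  rw [hcc, e1, ← hb₀, hba i hi _ hx]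

theorem exists_rep_of_isAnswer (hT : Pl.TablesOK D T) {r : List α} (h : D.IsAnswer r) :
    ∃ v a, Pl.Rep D T Pl.m v a ∧ Q.head.map (fun x : Fin Q.numVars => a x) = r.map .val := by
  obtain ⟨a₀, t, hw, rfl⟩ := h
  obtain ⟨v, a, hv, ha, -⟩ := exists_rep_of_isWitness hT hw
  refine ⟨v, a, hv.mono Pl.m_le, ?_⟩
  rw [List.map_map]
  exact List.map_congr_left fun x _ => ha x

/-- All variables of upper nodes are free, so different position vectors give different answers; no
answer is output twice. -/
theorem Rep.pos_eq_of_head (hT : Pl.TablesOK D T) {v v' : ℕ → ℕ} {a b : ℕ → Word α}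
    (ha : Pl.Rep D T Pl.m v a) (hb : Pl.Rep D T Pl.m v' b)
    (hab : Q.head.map (fun x : Fin Q.numVars => a x) = Q.head.map fun x : Fin Q.numVars => b x) : ∀ j < Pl.m, v j = v' j := by
  refine ha.pos_eq hT Pl.m_le hb fun i hi x hx => ?_
  obtain ⟨j, rfl⟩ := Pl.X_sub i (hi.trans_le Pl.m_le) x hx
  exact List.map_inj_left.1 hab _ ((Pl.head_iff (Q.args (Pl.atom i) j)).2 ⟨i, hi, hx⟩)

end Plan

end Tables

/-! ### Updating tables -/

section Update

variable {Q : CQ} {α : Type u} {W : Type v}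

/-- Two tables agree at a node. -/
def Tables.SameAt (T T' : Tables α W) (c : ℕ) : Prop :=
  T'.cnt c = T.cnt c ∧ T'.hp c = T.hp c ∧ T'.ow c = T.ow c

namespace Plan

variable {Pl : Plan Q} [CommSemiring W] {D : Database Q α W} {T T' : Tables α W} {i k : ℕ}

theorem not_mem_children_self : i ∉ Pl.children i := fun h => by
  have := (mem_children.1 h).2.1
  omega

theorem best_sameAt {c : ℕ} (h : T.SameAt T' c) (a : ℕ → Word α) :
    Pl.best T' c a = Pl.best T c a := by
  rw [best, best, h.2.2, h.2.1]

theorem map_best_sameAt (h : ∀ c ∈ Pl.children i, T.SameAt T' c) (a : ℕ → Word α) :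
    ((Pl.children i).map fun c => Pl.best T' c a) = (Pl.children i).map fun c => Pl.best T c a :=
  List.map_congr_left fun c hc => best_sameAt (h c hc) a

theorem childCnt_sameAt (h : ∀ c ∈ Pl.children i, T.SameAt T' c) (a : ℕ → Word α) :
    (∀ c ∈ Pl.children i, 1 ≤ T'.cnt c ((Pl.K c).map a)) ↔
      ∀ c ∈ Pl.children i, 1 ≤ T.cnt c ((Pl.K c).map a) :=
  forall₂_congr fun c hc => by rw [(h c hc).1]

theorem childCnt_congr {a b : ℕ → Word α} (hab : ∀ x ∈ Pl.X i, a x = b x)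
    (h : ∀ c ∈ Pl.children i, 1 ≤ T.cnt c ((Pl.K c).map a)) :
    ∀ c ∈ Pl.children i, 1 ≤ T.cnt c ((Pl.K c).map b) := fun c hc => by
  obtain ⟨h1, h2, h3⟩ := mem_children.1 hc
  rw [← map_key_congr_par h1 fun _ => by rw [h3]; exact hab]
  exact h c hc

theorem NodeOK.congr (hT : Pl.NodeOK D T i k) (hi : T.SameAt T' i)
    (hc : ∀ c ∈ Pl.children i, T.SameAt T' c) : Pl.NodeOK D T' i k := by
  obtain ⟨h1, h2, h3⟩ := hi
  constructor
  · intro κ p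
    rw [h1, h2, h3]
    intro hp hp'
    obtain ⟨h4, a, h5, h6, h7, h8⟩ := hT.sound κ p hp hp'
    exact ⟨h4, a, h5, h6, (childCnt_sameAt hc a).2 h7, by rw [map_best_sameAt hc]; exact h8⟩
  · intro l hl a ha hca
    rw [h1, h2]
    exact hT.complete l hl a ha ((childCnt_sameAt hc a).1 hca)
  · rw [h1, h2]
    exact hT.distinct

theorem NodeOK.zero (h : ∀ κ, T.cnt i κ = 0) : Pl.NodeOK D T i 0 := by
  constructor
  · intro κ p h1 h2
    rw [h] at h2
    omega
  · intro l hl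
    omega
  · intro κ p p' a a' h1 h2
    rw [h] at h2
    omega

/-- Tuple `k` may be passed over if it matches no valuation, has no partner in some child, or
repeats an earlier projection; in the first two cases the hypothesis is void. -/
theorem NodeOK.skip (hi : i < Pl.N) (hT : Pl.NodeOK D T i k)
    (h : ∀ a, Pl.Match D i k a → (∀ c ∈ Pl.children i, 1 ≤ T.cnt c ((Pl.K c).map a)) →
      ∃ k' < k, ∃ b, Pl.Match D i k' b ∧ ∀ x ∈ Pl.X i, b x = a x) :
    Pl.NodeOK D T i (k + 1) := by
  constructor
  · intro κ p h1 h2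
    obtain ⟨h3, h4⟩ := hT.sound κ p h1 h2
    exact ⟨by omega, h4⟩
  · intro l hl a ha hca
    rcases Nat.lt_succ_iff_lt_or_eq.1 hl with hl | rfl
    · exact hT.complete l hl a ha hca
    · obtain ⟨k', hk', b, hb, hba⟩ := h a ha hca
      obtain ⟨p, h1, h2, b', h3, h4⟩ := hT.complete k' hk' b hb
        (childCnt_congr (fun x hx => (hba x hx).symm) hca)
      rw [map_key_congr hi hba] at h2 h3
      exact ⟨p, h1, h2, b', h3, fun x hx => (h4 x hx).trans (hba x hx)⟩
  · exact hT.distinct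

-- One group gains a last position. Older entries refer to tuple numbers below `k`, so writing the
-- weight of `k` does not disturb them, and freshness of the projection keeps the entries distinct.
open Classical in
theorem NodeOK.insert (hi : i < Pl.N) (hT : Pl.NodeOK D T i k) {a : ℕ → Word α}
    (ha : Pl.Match D i k a) (hca : ∀ c ∈ Pl.children i, 1 ≤ T.cnt c ((Pl.K c).map a))
    (hfresh : ∀ k' < k, ∀ b, Pl.Match D i k' b → ¬ ∀ x ∈ Pl.X i, b x = a x)
    (hc : ∀ c ∈ Pl.children i, T.SameAt T' c)
    (hcnt : T'.cnt i = Function.update (T.cnt i) ((Pl.K i).map a) (T.cnt i ((Pl.K i).map a) + 1))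
    (hhp : T'.hp i = Function.update (T.hp i) ((Pl.K i).map a)
      (Function.update (T.hp i ((Pl.K i).map a)) (T.cnt i ((Pl.K i).map a) + 1) k))
    (how : T'.ow i = Function.update (T.ow i) k
      (Pl.base D i k * ((Pl.children i).map fun c => Pl.best T c a).prod)) :
    Pl.NodeOK D T' i (k + 1) := by
  set κ₀ := (Pl.K i).map a with hκ₀
  set n := T.cnt i κ₀ with hn
  have hcnt0 : T'.cnt i κ₀ = n + 1 := by rw [hcnt, Function.update_self]
  have hnew : T'.hp i κ₀ (n + 1) = k := by rw [hhp, Function.update_self, Function.update_self]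
  have hcases : ∀ κ p, 1 ≤ p → p ≤ T'.cnt i κ →
      (κ = κ₀ ∧ p = n + 1) ∨ (p ≤ T.cnt i κ ∧ T'.hp i κ p = T.hp i κ p) := by
    intro κ p h1 h2
    by_cases hκ : κ = κ₀
    · subst hκ
      rw [hcnt0] at h2
      by_cases hp : p = n + 1
      · exact .inl ⟨rfl, hp⟩
      · refine .inr ⟨by omega, ?_⟩
        rw [hhp, Function.update_self, Function.update_of_ne hp]
    · right
      rw [hcnt, Function.update_of_ne hκ] at h2
      rw [hhp, Function.update_of_ne hκ]
      exact ⟨h2, rfl⟩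
  have hold : ∀ κ p, p ≤ T.cnt i κ → p ≤ T'.cnt i κ ∧ T'.hp i κ p = T.hp i κ p := by
    intro κ p h2
    by_cases hκ : κ = κ₀
    · subst hκ
      rw [hcnt0, hhp, Function.update_self, Function.update_of_ne (by omega)]
      exact ⟨by omega, rfl⟩
    · rw [hcnt, hhp, Function.update_of_ne hκ, Function.update_of_ne hκ]
      exact ⟨h2, rfl⟩
  have hdiff : ∀ κ p b b', 1 ≤ p → p ≤ T.cnt i κ → Pl.Match D i (T.hp i κ p) b →
      Pl.Match D i k b' → ¬ ∀ x ∈ Pl.X i, b x = b' x := by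
    intro κ p b b' h1 h2 hb hb' h
    exact hfresh _ (hT.sound κ p h1 h2).1 b hb fun x hx => (h x hx).trans (hb'.eq_on hi ha x hx)
  constructor
  · intro κ p h1 h2
    rcases hcases κ p h1 h2 with ⟨rfl, rfl⟩ | ⟨h3, h4⟩
    · rw [hnew, how, Function.update_self]
      exact ⟨by omega, a, ha, rfl, (childCnt_sameAt hc a).2 hca, by rw [map_best_sameAt hc]⟩
    · obtain ⟨h5, b, h6, h7, h8, h9⟩ := hT.sound κ p h1 h3
      rw [h4, how, Function.update_of_ne (by omega)]
      exact ⟨by omega, b, h6, h7, (childCnt_sameAt hc b).2 h8, by rw [map_best_sameAt hc]; exact h9⟩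
  · intro l hl b hb hcb
    rcases Nat.lt_succ_iff_lt_or_eq.1 hl with hl | rfl
    · obtain ⟨p, h1, h2, b', h3, h4⟩ := hT.complete l hl b hb ((childCnt_sameAt hc b).1 hcb)
      obtain ⟨h5, h6⟩ := hold _ p h2
      exact ⟨p, h1, h5, b', by rw [h6]; exact h3, h4⟩
    · have hk : (Pl.K i).map b = κ₀ := map_key_congr hi (hb.eq_on hi ha)
      rw [hk]
      exact ⟨n + 1, by omega, hcnt0.ge, b, by rw [hnew]; exact hb, fun _ _ => rfl⟩
  · intro κ p p' b b' h1 h2 h1' h2' hb hb' h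
    rcases hcases κ p h1 h2 with ⟨rfl, rfl⟩ | ⟨h3, h4⟩ <;>
      rcases hcases _ p' h1' h2' with ⟨e, e'⟩ | ⟨h3', h4'⟩
    · exact e'.symm
    · rw [hnew] at hb
      rw [h4'] at hb'
      exact absurd (fun x hx => (h x hx).symm) (hdiff _ _ _ _ h1' h3' hb' hb)
    · subst e e'
      rw [hnew] at hb'
      rw [h4] at hb
      exact absurd h (hdiff _ _ _ _ h1 h3 hb hb')
    · rw [h4] at hb
      rw [h4'] at hb'
      exact hT.distinct κ p p' b b' h1 h3 h1' h3' hb hb' h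

/-- Heap construction permutes positions within each group, and the three properties do not depend
on that order. The children must not change, since optimal weights read their heap roots. -/
theorem NodeOK.shuffle (hT : Pl.NodeOK D T i k) (hc : ∀ c ∈ Pl.children i, T.SameAt T' c)
    (hcnt : T'.cnt i = T.cnt i) (how : T'.ow i = T.ow i)
    (hhp : ∀ κ, Shuffle (T.cnt i κ) (T.hp i κ) (T'.hp i κ)) : Pl.NodeOK D T' i k := by
  constructor
  · intro κ p h1 h2
    rw [hcnt] at h2
    obtain ⟨q, hq, hpq⟩ := (hhp κ).exists_pos' ⟨h1, h2⟩
    rw [hpq, how]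
    obtain ⟨h5, b, h6, h7, h8, h9⟩ := hT.sound κ q hq.1 hq.2
    exact ⟨h5, b, h6, h7, (childCnt_sameAt hc b).2 h8, by rw [map_best_sameAt hc]; exact h9⟩
  · intro l hl b hb hcb
    obtain ⟨p, h1, h2, b', h3, h4⟩ := hT.complete l hl b hb ((childCnt_sameAt hc b).1 hcb)
    obtain ⟨q, hq, hpq⟩ := (hhp ((Pl.K i).map b)).exists_pos ⟨h1, h2⟩
    exact ⟨q, hq.1, by rw [hcnt]; exact hq.2, b', by rw [hpq]; exact h3, h4⟩
  · intro κ p p' b b' h1 h2 h1' h2' hb hb' h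
    rw [hcnt] at h2 h2'
    obtain ⟨e, he, hf⟩ := hhp κ
    rw [hf, Function.comp_apply] at hb hb'
    have hr := Shuffle.range he ⟨h1, h2⟩
    have hr' := Shuffle.range he ⟨h1', h2'⟩
    exact e.injective (hT.distinct κ _ _ b b' hr.1 hr.2 hr'.1 hr'.2 hb hb' h)

/-- A tuple number determines its projection, hence its key and its position, so it occurs only once
in all groups. This makes heapifying all groups of a node linear. -/
theorem NodeOK.sum_cnt_le (hi : i < Pl.N) (hT : Pl.NodeOK D T i k)
    (S : Finset (List (Word α))) : ∑ κ ∈ S, T.cnt i κ ≤ k := by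
  have h1 : ∑ κ ∈ S, T.cnt i κ = (S.sigma fun κ => Finset.Icc 1 (T.cnt i κ)).card := by
    simp
  rw [h1, ← Finset.card_range k]
  refine Finset.card_le_card_of_injOn (fun q => T.hp i q.1 q.2) ?_ ?_
  · rintro ⟨κ, p⟩ hq
    simp only [Finset.coe_sigma, Finset.coe_Icc, Set.mem_sigma_iff, Set.mem_Icc] at hq
    simpa using (hT.sound κ p hq.2.1 hq.2.2).1
  · rintro ⟨κ, p⟩ hq ⟨κ', p'⟩ hq' h
    simp only [Finset.coe_sigma, Finset.coe_Icc, Set.mem_sigma_iff, Set.mem_Icc] at hq hq' h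
    obtain ⟨-, b, h6, h7, -⟩ := hT.sound κ p hq.2.1 hq.2.2
    obtain ⟨-, b', h6', h7', -⟩ := hT.sound κ' p' hq'.2.1 hq'.2.2
    rw [← h] at h6'
    have hκ : κ = κ' := by
      rw [← h7, ← h7']
      exact map_key_congr hi (h6.eq_on hi h6')
    subst hκ
    have := hT.distinct κ p p' b b' hq.2.1 hq.2.2 hq'.2.1 hq'.2.2 h6 (by rw [← h]; exact h6')
      (h6.eq_on hi h6')
    rw [this]

end Plan

end Update

/-! ### Programs for the tables -/

theorem Cmd.mem_collect_seqs {β : Type} {f : Prim → Set β} {b : β} {l : List Cmd} :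
    b ∈ (seqs l).collect f ↔ ∃ p ∈ l, b ∈ p.collect f := by
  induction l with
  | nil => simp [seqs, Cmd.collect]
  | cons p l ih => simp [seqs, Cmd.collect, ih]

theorem Cmd.loopFree_seqs {l : List Cmd} : (seqs l).loopFree ↔ ∀ p ∈ l, p.loopFree := by
  induction l with
  | nil => simp [seqs, Cmd.loopFree]
  | cons p l ih => simp [seqs, Cmd.loopFree, ih]

/-! ### Reading tuples into the variable registers -/

section Load

variable {Q : CQ} {α : Type u} {W : Type v} [CommSemiring W]

/-- Load the components `js` of the tuple with number `kid` of the relation of an atom. -/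
def loadVars (Q : CQ) (A : Fin Q.numAtoms) (js : List (Fin (Q.arity (Q.rel A)))) : Cmd :=
  seqs (js.map fun j : Fin (Q.arity (Q.rel A)) => .seq (.prim (.const (.sc .t) j))
    (.prim (.load (.var (Q.args A j)) (.inp (Q.rel A)) [.sc .kid, .sc .t])))

/-- Check that the values of the variables agree with the components `js` of the tuple. -/
def checkVars (Q : CQ) (A : Fin Q.numAtoms) (js : List (Fin (Q.arity (Q.rel A)))) : Cmd :=
  seqs (js.map fun j : Fin (Q.arity (Q.rel A)) => seqs [.prim (.const (.sc .t) j),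
    .prim (.load (.sc .ia) (.inp (Q.rel A)) [.sc .kid, .sc .t]),
    .ite (.eq (.sc .ia) (.var (Q.args A j))) .skip (.prim (.move (.sc .ok) (.sc .zero)))])

/-- The valuation in the registers. -/
def St.va (s : St α W) : ℕ → Word α := fun x => s.reg (.var x)

theorem St.vals_eq (s : St α W) (xs : List ℕ) : s.vals xs = xs.map s.va := rfl

/-- The input arrays are in place. -/
def InpOK (D : Database Q α W) (s : St α W) : Prop :=
  (∀ (R : Fin Q.numRels) key, s.arr (.inp R) key = inputMem D (.num R :: key)) ∧
    ∀ (R : Fin Q.numRels) key, s.warr (.inp R) key = inputWMem D (.num R :: key)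

variable {D : Database Q α W}

/-- If an atom repeats a variable, the last load wins; only agreement with some component is
guaranteed. `checkVars` afterwards detects a conflict. -/
theorem loadVars_spec {A : Fin Q.numAtoms} {k : ℕ} (js : List (Fin (Q.arity (Q.rel A))))
    {s : St α W} (hin : InpOK D s) (hk : s.reg (.sc .kid) = .num k) :
    (loadVars Q A js).wp (fun s' =>
      (∀ x, (∀ j ∈ js, (Q.args A j : ℕ) ≠ x) → s'.va x = s.va x) ∧
      ∀ x, (∃ j ∈ js, (Q.args A j : ℕ) = x) → ∃ j ∈ js, (Q.args A j : ℕ) = x ∧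
        s'.va x = inputMem D [.num (Q.rel A), .num k, .num j]) s := by
  induction js generalizing s with
  | nil => simp [loadVars, seqs, Cmd.wp]
  | cons j js ih =>
    simp only [loadVars, List.map_cons, seqs, Cmd.wp]
    set s₁ := Prim.app (.load (.var (Q.args A j)) (.inp (Q.rel A)) [.sc .kid, .sc .t])
      (Prim.app (.const (.sc .t) j) s) with hs₁
    have h1 : InpOK D s₁ := hin
    have h2 : s₁.reg (.sc .kid) = .num k := by simp [hs₁, Prim.app, hk]
    have h3 : ∀ x, s₁.va x = if x = Q.args A j then
        inputMem D [.num (Q.rel A), .num k, .num j] else s.va x := by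
      intro x
      by_cases hx : x = Q.args A j
      · subst hx
        simp [St.va, hs₁, Prim.app, hk, hin.1]
      · simp [St.va, hs₁, Prim.app, hx]
    refine Cmd.wp_mono _ (ih h1 h2) fun s' ⟨h4, h5⟩ => ⟨fun x hx => ?_, fun x hx => ?_⟩
    · rw [h4 x fun j' hj' => hx j' (List.mem_cons_of_mem _ hj'), h3,
        if_neg (Ne.symm (hx j List.mem_cons_self))]
    · by_cases hx' : ∃ j ∈ js, (Q.args A j : ℕ) = x
      · obtain ⟨j', hj', h6⟩ := h5 x hx'
        exact ⟨j', List.mem_cons_of_mem _ hj', h6⟩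
      · push Not at hx'
        obtain ⟨j', hj', rfl⟩ := hx
        rcases List.mem_cons.1 hj' with rfl | hj'
        · refine ⟨j', List.mem_cons_self, rfl, ?_⟩
          rw [h4 _ hx', h3, if_pos rfl]
        · exact absurd rfl (hx' j' hj')

theorem checkVars_spec {A : Fin Q.numAtoms} {k : ℕ} (js : List (Fin (Q.arity (Q.rel A))))
    {s : St α W} (hin : InpOK D s) (hk : s.reg (.sc .kid) = .num k)
    (hz : s.reg (.sc .zero) = .num 0) :
    (checkVars Q A js).wp (fun s' =>
      (s'.reg (.sc .ok) = s.reg (.sc .ok) ∧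
        ∀ j ∈ js, s.va (Q.args A j) = inputMem D [.num (Q.rel A), .num k, .num j]) ∨
      (s'.reg (.sc .ok) = .num 0 ∧
        ¬ ∀ j ∈ js, s.va (Q.args A j) = inputMem D [.num (Q.rel A), .num k, .num j])) s := by
  induction js generalizing s with
  | nil => simp [checkVars, seqs, Cmd.wp]
  | cons j js ih =>
    rw [checkVars, List.map_cons, seqs, Cmd.wp]
    have hstep : (seqs [.prim (.const (.sc .t) j),
        .prim (.load (.sc .ia) (.inp (Q.rel A)) [.sc .kid, .sc .t]),
        .ite (.eq (.sc .ia) (.var (Q.args A j))) .skip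
          (.prim (.move (.sc .ok) (.sc .zero)))]).wp (fun s' : St α W =>
        InpOK D s' ∧ s'.reg (.sc .kid) = .num k ∧ s'.reg (.sc .zero) = .num 0 ∧ s'.va = s.va ∧
        ((s'.reg (.sc .ok) = s.reg (.sc .ok) ∧
          s.va (Q.args A j) = inputMem D [.num (Q.rel A), .num k, .num j]) ∨
        (s'.reg (.sc .ok) = .num 0 ∧
          ¬ s.va (Q.args A j) = inputMem D [.num (Q.rel A), .num k, .num j]))) s := by
      simp only [seqs, Cmd.wp, Prim.app, Cond.holds, List.map_cons, List.map_nil,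
        Function.update_apply, reduceCtorEq, if_false, Reg.sc.injEq, hk, hin.1, if_pos]
      refine ⟨fun h => ⟨hin, hk, hz, ?_, .inl ⟨rfl, h.symm⟩⟩,
        fun h => ⟨hin, ?_, ?_, ?_, .inr ⟨?_, fun h' => h h'.symm⟩⟩⟩
      · funext x; simp [St.va]
      · simp [hk]
      · simp [hz]
      · funext x; simp [St.va]
      · simp [hz]
    refine Cmd.wp_mono _ hstep fun s' ⟨h1, h2, h3, h4, h5⟩ => Cmd.wp_mono _ (ih h1 h2 h3) ?_
    intro s'' h6
    simp only [h4] at h6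
    simp only [List.mem_cons, forall_eq_or_imp]
    rcases h5 with ⟨h5, h7⟩ | ⟨h5, h7⟩ <;> rcases h6 with ⟨h6, h8⟩ | ⟨h6, h8⟩
    · exact .inl ⟨h6.trans h5, h7, h8⟩
    · exact .inr ⟨h6, fun h => h8 h.2⟩
    · exact .inr ⟨h6.trans h5, fun h => h7 h.1⟩
    · exact .inr ⟨h6, fun h => h7 h.1⟩

end Load

/-! ### Construction of the table of one node: inserting tuples -/

section Build

variable {Q : CQ} {α : Type u} {W : Type v} [CommSemiring W]

/-- The arrays of node `c` hold the table `T`. -/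
structure NodeAt (T : Tables α W) (c : ℕ) (s : St α W) : Prop where
  cnt : ∀ κ, s.arr (.cnt c) κ = .num (T.cnt c κ)
  hp : ∀ κ p, 1 ≤ p → p ≤ T.cnt c κ → s.arr (.heap c) (.num p :: κ) = .num (T.hp c κ p)
  ow : ∀ k, s.warr (.ow c) [.num k] = T.ow c k

theorem NodeAt.congr {T T' : Tables α W} {c : ℕ} {s s' : St α W} (h : NodeAt T c s)
    (hT : T.SameAt T' c) (h1 : s'.arr (.cnt c) = s.arr (.cnt c))
    (h2 : s'.arr (.heap c) = s.arr (.heap c)) (h3 : s'.warr (.ow c) = s.warr (.ow c)) :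
    NodeAt T' c s' := by
  obtain ⟨e1, e2, e3⟩ := hT
  constructor
  · rw [h1, e1]; exact h.cnt
  · rw [h2, e1, e2]; exact h.hp
  · rw [h3, e3]; exact h.ow

theorem Tables.SameAt.refl (T : Tables α W) (c : ℕ) : T.SameAt T c := ⟨rfl, rfl, rfl⟩

variable (Pl : Plan Q)

/-- Multiply the weight by the best weight of the child `c`, or note that there is none. -/
def childStep (c : ℕ) : Cmd := seqs [
  .prim (.load (.sc .cn) (.cnt c) ((Pl.K c).map .var)),
  .ite (.eq (.sc .cn) (.sc .zero)) (.prim (.move (.sc .ok) (.sc .zero)))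
    (seqs [
      .prim (.load (.sc .ia) (.heap c) (.sc .one :: (Pl.K c).map .var)),
      .prim (.wload 1 (.ow c) [.sc .ia]),
      .prim (.wmul 0 0 1)])]

/-- Load the tuple `k` of node `i`. -/
def fetch (i : ℕ) : Cmd :=
  .seq (.prim (.move (.sc .kid) (.sc .k))) (loadVars Q (Pl.atom i) (List.finRange _))

/-- Compare the registers with the tuple `k` of node `i`. -/
def testTuple (i : ℕ) : Cmd :=
  .seq (.prim (.move (.sc .ok) (.sc .one))) (checkVars Q (Pl.atom i) (List.finRange _))

/-- Append the tuple `k` to its group. -/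
def appendTuple (i : ℕ) : Cmd := seqs [
  .prim (.load (.sc .cn) (.cnt i) ((Pl.K i).map .var)),
  .prim (.add (.sc .cn) (.sc .cn) (.sc .one)),
  .prim (.store (.cnt i) ((Pl.K i).map .var) (.sc .cn)),
  .prim (.store (.heap i) (.sc .cn :: (Pl.K i).map .var) (.sc .k)),
  .prim (.wstore (.ow i) [.sc .k] 0)]

def baseWeight (i : ℕ) : Prim := if i < Pl.m then .wone 0 else .wload 0 (.inp (Pl.rel i)) [.sc .k]

/-- Mark the projection of the tuple `k` as seen, and add the tuple if it has partners in all
children. -/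
def addTuple (i : ℕ) : Cmd := seqs [
  .prim (.store (.seen i) ((Pl.X i).map .var) (.sc .one)),
  .prim (baseWeight Pl i),
  seqs ((Pl.children i).map (childStep Pl)),
  .ite (.eq (.sc .ok) (.sc .one)) (appendTuple Pl i) .skip]

/-- Process the tuple `k` of node `i`. -/
def insertTuple (i : ℕ) : Cmd := seqs [
  fetch Pl i,
  testTuple Pl i,
  .ite (.eq (.sc .ok) (.sc .one))
    (seqs [
      .prim (.load (.sc .cn) (.seen i) ((Pl.X i).map .var)),
      .ite (.eq (.sc .cn) (.sc .zero)) (addTuple Pl i) .skip])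
    .skip,
  .prim (.add (.sc .k) (.sc .k) (.sc .one))]

/-- Turn the group of the tuple `k` of node `i` into a heap, unless this has been done. -/
def heapifyGroup (i : ℕ) : Cmd := seqs [
  fetch Pl i,
  .prim (.load (.sc .cn) (.hz i) ((Pl.K i).map .var)),
  .ite (.eq (.sc .cn) (.sc .zero))
    (seqs [
      .prim (.store (.hz i) ((Pl.K i).map .var) (.sc .one)),
      .prim (.load (.sc .n) (.cnt i) ((Pl.K i).map .var)),
      heapify (.heap i) (.ow i) (Pl.K i)])
    .skip,
  .prim (.add (.sc .k) (.sc .k) (.sc .one))]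

def buildNode (i : ℕ) : Cmd := seqs [
  .prim (.load (.sc .sz) (.inp (Pl.rel i)) []),
  .prim (.const (.sc .k) 0),
  .loop (.eq (.sc .k) (.sc .sz)) (insertTuple Pl i),
  .prim (.const (.sc .k) 0),
  .loop (.eq (.sc .k) (.sc .sz)) (heapifyGroup Pl i)]

variable {Pl} {D : Database Q α W} {T : Tables α W}

theorem childStep_spec {c : ℕ} {s : St α W} (hz : s.reg (.sc .zero) = .num 0)
    (hone : s.reg (.sc .one) = .num 1) (hat : NodeAt T c s) :
    (childStep Pl c).wp (fun s' =>
      (s'.reg (.sc .ok) = s.reg (.sc .ok) ∧ 1 ≤ T.cnt c ((Pl.K c).map s.va) ∧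
        s'.wreg 0 = s.wreg 0 * Pl.best T c s.va) ∨
      (s'.reg (.sc .ok) = .num 0 ∧ ¬ 1 ≤ T.cnt c ((Pl.K c).map s.va))) s := by
  have e1 := hat.cnt ((Pl.K c).map s.va)
  unfold St.va at *
  simp only [childStep, seqs, Cmd.wp, Prim.app, Cond.holds, List.map_cons, List.map_map,
    List.map_nil, Function.comp_def, Function.update_apply, reduceCtorEq, if_false,
    Reg.sc.injEq, hone, hz, e1, St.tick_reg, St.tick_wreg, St.tick_arr,
    St.tick_warr, if_pos, Word.num.injEq]
  refine ⟨fun h => .inr ⟨trivial, by omega⟩, fun h => .inl ⟨trivial, by omega, ?_⟩⟩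
  rw [hat.hp _ 1 le_rfl (by omega), hat.ow]
  simp [Plan.best]

theorem childSteps_spec (cs : List ℕ) {s : St α W} (hz : s.reg (.sc .zero) = .num 0)
    (hone : s.reg (.sc .one) = .num 1) (hat : ∀ c ∈ cs, NodeAt T c s) :
    (seqs (cs.map (childStep Pl))).wp (fun s' =>
      (s'.reg (.sc .ok) = s.reg (.sc .ok) ∧ (∀ c ∈ cs, 1 ≤ T.cnt c ((Pl.K c).map s.va)) ∧
        s'.wreg 0 = s.wreg 0 * (cs.map fun c => Pl.best T c s.va).prod) ∨
      (s'.reg (.sc .ok) = .num 0 ∧ ¬ ∀ c ∈ cs, 1 ≤ T.cnt c ((Pl.K c).map s.va))) s := by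
  induction cs generalizing s with
  | nil => simp [seqs, Cmd.wp]
  | cons c cs ih =>
    rw [List.map_cons, seqs, Cmd.wp]
    refine Cmd.wp_use (childStep_spec hz hone (hat c List.mem_cons_self)) fun s' h1 hfr => ?_
    have hva : s'.va = s.va := funext fun x =>
      hfr.reg _ (by simp [childStep, seqs, Cmd.collect, Prim.wr])
    refine Cmd.wp_mono _ (ih (s := s')
      (by rw [hfr.reg _ (by simp [childStep, seqs, Cmd.collect, Prim.wr]), hz])
      (by rw [hfr.reg _ (by simp [childStep, seqs, Cmd.collect, Prim.wr]), hone])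
      fun c' hc' => (hat c' (List.mem_cons_of_mem _ hc')).congr (.refl _ _)
        (hfr.arr _ (by simp [childStep, seqs, Cmd.collect, Prim.wt]))
        (hfr.arr _ (by simp [childStep, seqs, Cmd.collect, Prim.wt]))
        (hfr.warr _ (by simp [childStep, seqs, Cmd.collect, Prim.wwt]))) fun s'' h2 => ?_
    simp only [hva] at h2
    simp only [List.mem_cons, forall_eq_or_imp, List.map_cons, List.prod_cons]
    rcases h1 with ⟨h1, h3, h4⟩ | ⟨h1, h3⟩ <;> rcases h2 with ⟨h2, h5, h6⟩ | ⟨h2, h5⟩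
    · exact .inl ⟨h2.trans h1, ⟨h3, h5⟩, by rw [h6, h4, mul_assoc]⟩
    · exact .inr ⟨h2, fun h => h5 h.2⟩
    · exact .inr ⟨h2.trans h1, fun h => h3 h.1⟩
    · exact .inr ⟨h2, fun h => h3 h.1⟩

/-- If some valuation matches the tuple, components under the same variable agree, and then the
loaded registers match as well. -/
theorem fetch_spec {i k : ℕ} {s : St α W} (hin : InpOK D s) (hk : s.reg (.sc .k) = .num k) :
    (fetch Pl i).wp (fun s' => s'.reg (.sc .kid) = .num k ∧
      ∀ b, Pl.Match D i k b → Pl.Match D i k s'.va) s := by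
  rw [fetch, Cmd.wp, Cmd.wp]
  have h1 : (Prim.app (.move (.sc .kid) (.sc .k)) s).reg (.sc .kid) = .num k := by
    simp [Prim.app, hk]
  refine Cmd.wp_use (loadVars_spec (D := D) (k := k) _ hin h1) fun s' ⟨_, h2⟩ hfr => ⟨?_, ?_⟩
  · rw [hfr.reg _ (by simp [loadVars, Cmd.mem_collect_seqs, Cmd.collect, Prim.wr]), h1]
  · intro b hb j
    obtain ⟨j', -, h3, h4⟩ := h2 (Q.args (Pl.atom i) j) ⟨j, List.mem_finRange _, rfl⟩
    rw [h4, ← hb j, ← h3, hb j']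

theorem testTuple_spec {i k : ℕ} {s : St α W} (hin : InpOK D s)
    (hk : s.reg (.sc .kid) = .num k) (hz : s.reg (.sc .zero) = .num 0)
    (hone : s.reg (.sc .one) = .num 1) :
    (testTuple Pl i).wp (fun s' => (s'.reg (.sc .ok) = .num 1 ∧ Pl.Match D i k s.va) ∨
      (s'.reg (.sc .ok) = .num 0 ∧ ¬ Pl.Match D i k s.va)) s := by
  rw [testTuple, Cmd.wp, Cmd.wp]
  have hva : (Prim.app (.move (.sc .ok) (.sc .one)) s).va = s.va :=
    funext fun x => by simp [St.va, Prim.app]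
  refine Cmd.wp_mono _ (checkVars_spec (D := D) (k := k) _ (by exact hin)
    (by simp [Prim.app, hk]) (by simp [Prim.app, hz])) fun s' h => ?_
  rw [hva] at h
  have hM : Pl.Match D i k s.va ↔ ∀ j ∈ List.finRange (Q.arity (Q.rel (Pl.atom i))),
      s.va (Q.args (Pl.atom i) j) = inputMem D [.num (Q.rel (Pl.atom i)), .num k, .num j] :=
    ⟨fun h j _ => h j, fun h j => h j (List.mem_finRange _)⟩
  rw [hM]
  refine h.imp (fun h => ⟨h.1.trans ?_, h.2⟩) id
  simp [Prim.app, hone]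

open Classical in
theorem appendTuple_spec {i k : ℕ} {s : St α W} (hone : s.reg (.sc .one) = .num 1)
    (hk : s.reg (.sc .k) = .num k) (hat : NodeAt T i s) :
    (appendTuple Pl i).wp (fun s' => NodeAt
      { cnt := Function.update T.cnt i (Function.update (T.cnt i) ((Pl.K i).map s.va)
          (T.cnt i ((Pl.K i).map s.va) + 1))
        hp := Function.update T.hp i (Function.update (T.hp i) ((Pl.K i).map s.va)
          (Function.update (T.hp i ((Pl.K i).map s.va)) (T.cnt i ((Pl.K i).map s.va) + 1) k))
        ow := Function.update T.ow i (Function.update (T.ow i) k (s.wreg 0)) } i s') s := by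
  have e1 := hat.cnt ((Pl.K i).map s.va)
  set κ := (Pl.K i).map s.va with hκ
  have hκ' : (Pl.K i).map (fun x => s.reg (.var x)) = κ := rfl
  simp only [appendTuple, seqs, Cmd.wp, Prim.app, List.map_cons, List.map_map,
    List.map_nil, Function.comp_def, Function.update_apply, reduceCtorEq, if_false,
    Reg.sc.injEq, hone, hk, e1, if_pos, Word.toNat_num, hκ']
  constructor
  · intro κ'
    simp only [Function.update_self, Function.update_apply, reduceCtorEq, if_false]
    split_ifs with h
    · rfl
    · exact hat.cnt κ'
  · intro κ' p h1 h2
    simp only [Function.update_self, Function.update_apply] at h2 ⊢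
    by_cases h : κ' = κ
    · rw [h] at h2 ⊢
      rw [if_pos rfl] at h2 ⊢
      by_cases hp : p = T.cnt i κ + 1
      · simp [hp]
      · rw [Function.update_of_ne hp, if_neg (by simp [hp])]
        exact hat.hp κ p h1 (by omega)
    · rw [if_neg h] at h2 ⊢
      rw [if_neg (by simp [h])]
      exact hat.hp κ' p h1 h2
  · intro k'
    simp only [Function.update_apply, if_pos]
    by_cases h : k' = k
    · simp [h]
    · simp [h, hat.ow]

/-- What the construction of the table of node `i` does not change. -/
structure BuildCore (D : Database Q α W) (Pl : Plan Q) (T : Tables α W) (i : ℕ) (s : St α W) :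
    Prop where
  inp : InpOK D s
  one : s.reg (.sc .one) = .num 1
  zero : s.reg (.sc .zero) = .num 0
  child : ∀ c ∈ Pl.children i, NodeAt T c s

theorem BuildCore.of_fr {i : ℕ} {p : Cmd} {s s' : St α W} (h : BuildCore D Pl T i s)
    (hfr : Fr p s s') (h1 : .sc .one ∉ p.collect Prim.wr) (h2 : .sc .zero ∉ p.collect Prim.wr)
    (h3 : ∀ R, .inp R ∉ p.collect Prim.wt) (h4 : ∀ R, .inp R ∉ p.collect Prim.wwt)
    (h5 : ∀ c, c ≠ i → .cnt c ∉ p.collect Prim.wt)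
    (h6 : ∀ c, c ≠ i → .heap c ∉ p.collect Prim.wt)
    (h7 : ∀ c, c ≠ i → .ow c ∉ p.collect Prim.wwt) : BuildCore D Pl T i s' := by
  refine ⟨⟨fun R key => ?_, fun R key => ?_⟩, ?_, ?_, fun c hc => ?_⟩
  · rw [hfr.arr _ (h3 R)]; exact h.inp.1 R key
  · rw [hfr.warr _ (h4 R)]; exact h.inp.2 R key
  · rw [hfr.reg _ h1, h.one]
  · rw [hfr.reg _ h2, h.zero]
  · have hci : c ≠ i := fun e => Plan.not_mem_children_self (e ▸ hc)
    exact (h.child c hc).congr (.refl _ _) (hfr.arr _ (h5 c hci)) (hfr.arr _ (h6 c hci))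
      (hfr.warr _ (h7 c hci))

/-- The projection `κ` occurs among the first `k` tuples of node `i`. -/
def Seen (D : Database Q α W) (Pl : Plan Q) (i k : ℕ) (κ : List (Word α)) : Prop :=
  ∃ k' < k, ∃ a, Pl.Match D i k' a ∧ (Pl.X i).map a = κ

def SeenAt (D : Database Q α W) (Pl : Plan Q) (i k : ℕ) (s : St α W) : Prop :=
  ∀ κ, (s.arr (.seen i) κ = .num 1 ∧ Seen D Pl i k κ) ∨
    (s.arr (.seen i) κ = .num 0 ∧ ¬ Seen D Pl i k κ)

theorem seen_succ {i k : ℕ} {κ : List (Word α)} : Seen D Pl i (k + 1) κ ↔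
    Seen D Pl i k κ ∨ ∃ a, Pl.Match D i k a ∧ (Pl.X i).map a = κ := by
  constructor
  · rintro ⟨k', hk', h⟩
    rcases Nat.lt_succ_iff_lt_or_eq.1 hk' with hk' | rfl
    · exact .inl ⟨k', hk', h⟩
    · exact .inr h
  · rintro (⟨k', hk', h⟩ | h)
    · exact ⟨k', by omega, h⟩
    · exact ⟨k, by omega, h⟩

/-- The loop invariant of the first pass. -/
structure InsInv (D : Database Q α W) (Pl : Plan Q) (T₀ : Tables α W) (i k : ℕ) (s : St α W) :
    Prop where
  core : BuildCore D Pl T₀ i s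
  tab : ∃ T, (∀ c, c ≠ i → T₀.SameAt T c) ∧ NodeAt T i s ∧ Pl.NodeOK D T i k
  seen : SeenAt D Pl i k s

/-- Whether there are partners in the children depends on the projection alone. Marking it as seen
is therefore right even when the tuple is then rejected. -/
theorem addTuple_spec {i k : ℕ} (hi : i < Pl.N) {s : St α W} (h : InsInv D Pl T i k s)
    (hk : s.reg (.sc .k) = .num k) (hok : s.reg (.sc .ok) = .num 1) (hM : Pl.Match D i k s.va)
    (hns : ¬ Seen D Pl i k ((Pl.X i).map s.va)) :
    (addTuple Pl i).wp (InsInv D Pl T i (k + 1)) s := by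
  classical
  obtain ⟨hcore, ⟨T', hsame, hat, hT'⟩, hseen⟩ := h
  have hch : ∀ c ∈ Pl.children i, T.SameAt T' c := fun c hc =>
    hsame c fun e => Plan.not_mem_children_self (e ▸ hc)
  have hch' : ∀ c ∈ Pl.children i, T'.SameAt T c := fun c hc =>
    ⟨(hch c hc).1.symm, (hch c hc).2.1.symm, (hch c hc).2.2.symm⟩
  rw [addTuple, seqs, Cmd.wp, Cmd.wp, seqs, Cmd.wp]
  set s₁ := Prim.app (.store (.seen i) ((Pl.X i).map .var) (.sc .one)) s with hs₁
  have hcore₁ : BuildCore D Pl T i s₁ :=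
    hcore.of_fr (Fr.prim _ s) (by simp [Cmd.collect, Prim.wr]) (by simp [Cmd.collect, Prim.wr])
      (by simp [Cmd.collect, Prim.wt]) (by simp [Cmd.collect, Prim.wwt])
      (by simp [Cmd.collect, Prim.wt]) (by simp [Cmd.collect, Prim.wt])
      (by simp [Cmd.collect, Prim.wwt])
  have hat₁ : NodeAt T' i s₁ := hat.congr (.refl _ _) (by simp [hs₁, Prim.app])
    (by simp [hs₁, Prim.app]) (by simp [hs₁, Prim.app])
  have hseen₁ : SeenAt D Pl i (k + 1) s₁ := by
    intro κ
    have hr : s₁.arr (.seen i) κ =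
        if κ = (Pl.X i).map s.va then .num 1 else s.arr (.seen i) κ := by
      simp only [hs₁, Prim.app, Function.update_self, hcore.one, List.map_map, Function.comp_def,
        Function.update_apply]
      rfl
    rw [hr, seen_succ]
    split_ifs with hκ
    · exact .inl ⟨rfl, .inr ⟨s.va, hM, hκ.symm⟩⟩
    · rcases hseen κ with ⟨h1, h2⟩ | ⟨h1, h2⟩
      · exact .inl ⟨h1, .inl h2⟩
      · refine .inr ⟨h1, ?_⟩
        rintro (h3 | ⟨a, ha, rfl⟩)
        · exact h2 h3
        · exact hκ (List.map_congr_left (ha.eq_on hi hM))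
  have hreg₁ : s₁.reg = s.reg := rfl
  clear_value s₁
  rw [Cmd.wp]
  set s₂ := Prim.app (baseWeight Pl i) s₁ with hs₂
  have hs₂' : s₂.reg = s₁.reg ∧ s₂.arr = s₁.arr ∧ s₂.warr = s₁.warr ∧
      s₂.wreg 0 = Pl.base D i k := by
    rw [hs₂, baseWeight, Plan.base]
    split_ifs
    · simp [Prim.app]
    · simp [Prim.app, hreg₁, hk, hcore₁.inp.2]
  clear_value s₂
  obtain ⟨hreg₂, harr₂, hwarr₂, hw₂⟩ := hs₂'
  have hva₂ : s₂.va = s.va := by unfold St.va; rw [hreg₂, hreg₁]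
  rw [seqs, Cmd.wp]
  refine Cmd.wp_use (childSteps_spec (T := T) (Pl := Pl) _
    (by rw [hreg₂, hcore₁.zero]) (by rw [hreg₂, hcore₁.one])
    fun c hc => (hcore₁.child c hc).congr (.refl _ _) (by rw [harr₂]) (by rw [harr₂])
      (by rw [hwarr₂])) fun s₃ h3 hfr₃ => ?_
  have harr₃ : s₃.arr = s₁.arr := by
    rw [← harr₂]
    funext t
    exact hfr₃.arr t (by simp [Cmd.mem_collect_seqs, childStep, seqs, Cmd.collect, Prim.wt])
  have hwarr₃ : s₃.warr = s₁.warr := by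
    rw [← hwarr₂]
    funext t
    exact hfr₃.warr t (by simp [Cmd.mem_collect_seqs, childStep, seqs, Cmd.collect, Prim.wwt])
  have hreg₃ : ∀ r, r ≠ .sc .cn → r ≠ .sc .ok → r ≠ .sc .ia → s₃.reg r = s.reg r := by
    intro r h1 h2 h3
    rw [← hreg₁, ← hreg₂]
    exact hfr₃.reg r
      (by simp [Cmd.mem_collect_seqs, childStep, seqs, Cmd.collect, Prim.wr, h1, h2, h3])
  have hva₃ : s₃.va = s.va := funext fun x => hreg₃ _ (by simp) (by simp) (by simp)
  rw [hva₂] at h3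
  have hcore₃ : BuildCore D Pl T i s₃ := by
    refine ⟨⟨?_, ?_⟩, ?_, ?_, fun c hc => (hcore₁.child c hc).congr (.refl _ _) (by rw [harr₃])
      (by rw [harr₃]) (by rw [hwarr₃])⟩
    · rw [harr₃]; exact hcore₁.inp.1
    · rw [hwarr₃]; exact hcore₁.inp.2
    · rw [hreg₃ _ (by simp) (by simp) (by simp), hcore.one]
    · rw [hreg₃ _ (by simp) (by simp) (by simp), hcore.zero]
  have hat₃ : NodeAt T' i s₃ := hat₁.congr (.refl _ _) (by rw [harr₃]) (by rw [harr₃])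
    (by rw [hwarr₃])
  have hseen₃ : SeenAt D Pl i (k + 1) s₃ := by
    intro κ; rw [harr₃]; exact hseen₁ κ
  clear hfr₃
  simp only [seqs, Cmd.wp, Cond.holds, hcore₃.one]
  rcases h3 with ⟨hok₃, hall, hw₃⟩ | ⟨hok₃, hnall⟩
  · rw [hreg₂, hreg₁, hok] at hok₃
    refine ⟨fun _ => ?_, fun hne => absurd hok₃ hne⟩
    refine Cmd.wp_use (appendTuple_spec (s := s₃.tick) (T := T') (k := k) hcore₃.one
      ((hreg₃ _ (by simp) (by simp) (by simp)).trans hk)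
      (hat₃.congr (.refl _ _) rfl rfl rfl)) fun s₄ h4 hfr₄ => ?_
    have hva₄ : s₃.tick.va = s.va := hva₃
    have hw₄ : s₃.tick.wreg 0 = Pl.base D i k *
        ((Pl.children i).map fun c => Pl.best T' c s.va).prod := by
      rw [Plan.map_best_sameAt hch, ← hw₂]
      exact hw₃
    rw [hva₄, hw₄] at h4
    refine ⟨?_, ⟨_, fun c hc => ?_, h4, ?_⟩, fun κ => ?_⟩
    · exact (hcore₃.of_fr hfr₄.tick_left (by simp [appendTuple, seqs, Cmd.collect, Prim.wr])
        (by simp [appendTuple, seqs, Cmd.collect, Prim.wr])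
        (by simp [appendTuple, seqs, Cmd.collect, Prim.wt])
        (by simp [appendTuple, seqs, Cmd.collect, Prim.wwt])
        (by simp [appendTuple, seqs, Cmd.collect, Prim.wt])
        (by simp [appendTuple, seqs, Cmd.collect, Prim.wt])
        (by simp [appendTuple, seqs, Cmd.collect, Prim.wwt]))
    · obtain ⟨e1, e2, e3⟩ := hsame c hc
      exact ⟨by simp [hc, e1], by simp [hc, e2], by simp [hc, e3]⟩
    · refine hT'.insert hi hM ((Plan.childCnt_sameAt hch _).2 hall) ?_ (fun c hc => ?_)
        (by simp) (by simp) (by simp)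
      · intro k' hk' b hb hX
        exact hns ⟨k', hk', b, hb, List.map_congr_left hX⟩
      · have hci : c ≠ i := fun e => Plan.not_mem_children_self (e ▸ hc)
        exact ⟨by simp [hci], by simp [hci], by simp [hci]⟩
    · rw [hfr₄.arr (.seen i) (by simp [appendTuple, seqs, Cmd.collect, Prim.wt])]
      exact hseen₃ κ
  · refine ⟨fun he => ?_, fun _ => ?_⟩
    · rw [hok₃] at he
      cases he
    · refine ⟨⟨hcore₃.inp, hcore₃.one, hcore₃.zero, fun c hc => (hcore₃.child c hc).congr
        (.refl _ _) rfl rfl rfl⟩, ⟨T', hsame, hat₃.congr (.refl _ _) rfl rfl rfl, ?_⟩, hseen₃⟩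
      refine hT'.skip hi fun a ha hca => absurd ?_ hnall
      exact Plan.childCnt_congr (ha.eq_on hi hM) ((Plan.childCnt_sameAt hch a).1 hca)

end Build

/-! ### The two passes over a relation and the construction of all tables -/

section BuildLoops

variable {Q : CQ} {α : Type u} {W : Type v} [CommSemiring W]
variable {Pl : Plan Q} {D : Database Q α W} {T : Tables α W}

theorem Fr.arr_eq {p : Cmd} {s s' : St α W} (h : Fr p s s') (hp : ∀ t, t ∉ p.collect Prim.wt) :
    s'.arr = s.arr := funext fun t => h.arr t (hp t)

theorem Fr.warr_eq {p : Cmd} {s s' : St α W} (h : Fr p s s') (hp : ∀ t, t ∉ p.collect Prim.wwt) :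
    s'.warr = s.warr := funext fun t => h.warr t (hp t)

theorem BuildCore.congr {i : ℕ} {s s' : St α W} (h : BuildCore D Pl T i s)
    (h1 : s'.arr = s.arr) (h2 : s'.warr = s.warr) (h3 : s'.reg (.sc .one) = s.reg (.sc .one))
    (h4 : s'.reg (.sc .zero) = s.reg (.sc .zero)) : BuildCore D Pl T i s' :=
  ⟨⟨by rw [h1]; exact h.inp.1, by rw [h2]; exact h.inp.2⟩, h3.trans h.one, h4.trans h.zero,
    fun c hc => (h.child c hc).congr (.refl _ _) (by rw [h1]) (by rw [h1]) (by rw [h2])⟩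

theorem InsInv.congr {i k : ℕ} {s s' : St α W} (h : InsInv D Pl T i k s)
    (h1 : s'.arr = s.arr) (h2 : s'.warr = s.warr) (h3 : s'.reg (.sc .one) = s.reg (.sc .one))
    (h4 : s'.reg (.sc .zero) = s.reg (.sc .zero)) : InsInv D Pl T i k s' := by
  obtain ⟨hc, ⟨T', h5, h6, h7⟩, h8⟩ := h
  refine ⟨hc.congr h1 h2 h3 h4, ⟨T', h5, h6.congr (.refl _ _) (by rw [h1]) (by rw [h1])
    (by rw [h2]), h7⟩, fun κ => ?_⟩
  rw [h1]
  exact h8 κ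

theorem InsInv.skip {i k : ℕ} (hi : i < Pl.N) {s : St α W} (h : InsInv D Pl T i k s)
    (hk : ∀ a, Pl.Match D i k a → Seen D Pl i k ((Pl.X i).map a)) :
    InsInv D Pl T i (k + 1) s := by
  obtain ⟨hc, ⟨T', h5, h6, h7⟩, h8⟩ := h
  refine ⟨hc, ⟨T', h5, h6, h7.skip hi fun a ha _ => ?_⟩, fun κ => ?_⟩
  · obtain ⟨k', hk', b, hb, hX⟩ := hk a ha
    exact ⟨k', hk', b, hb, List.map_inj_left.1 hX⟩
  · have : Seen D Pl i (k + 1) κ ↔ Seen D Pl i k κ := by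
      rw [seen_succ]
      refine ⟨?_, .inl⟩
      rintro (h | ⟨a, ha, rfl⟩)
      · exact h
      · exact hk a ha
    rw [this]
    exact h8 κ

theorem fetch_wr {i : ℕ} {a : Sc} (h : a ≠ .kid) (h' : a ≠ .t) :
    Reg.sc a ∉ (fetch Pl i).collect Prim.wr := by
  simp [fetch, loadVars, Cmd.mem_collect_seqs, Cmd.collect, Prim.wr, h, h']

theorem fetch_wt {i : ℕ} (t : Tag) : t ∉ (fetch Pl i).collect Prim.wt := by
  simp [fetch, loadVars, Cmd.mem_collect_seqs, Cmd.collect, Prim.wt]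

theorem fetch_wwt {i : ℕ} (t : Tag) : t ∉ (fetch Pl i).collect Prim.wwt := by
  simp [fetch, loadVars, Cmd.mem_collect_seqs, Cmd.collect, Prim.wwt]

theorem testTuple_wr {i : ℕ} {r : Reg} (h : r ≠ .sc .ok) (h' : r ≠ .sc .t) (h'' : r ≠ .sc .ia) :
    r ∉ (testTuple Pl i).collect Prim.wr := by
  simp [testTuple, checkVars, Cmd.mem_collect_seqs, seqs, Cmd.collect, Prim.wr, h, h', h'']

theorem testTuple_wt {i : ℕ} (t : Tag) : t ∉ (testTuple Pl i).collect Prim.wt := by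
  simp [testTuple, checkVars, Cmd.mem_collect_seqs, seqs, Cmd.collect, Prim.wt]

theorem testTuple_wwt {i : ℕ} (t : Tag) : t ∉ (testTuple Pl i).collect Prim.wwt := by
  simp [testTuple, checkVars, Cmd.mem_collect_seqs, seqs, Cmd.collect, Prim.wwt]

theorem addTuple_wr {i : ℕ} {r : Reg} (h : r ≠ .sc .cn) (h' : r ≠ .sc .ok) (h'' : r ≠ .sc .ia) :
    r ∉ (addTuple Pl i).collect Prim.wr := by
  have hb : (baseWeight Pl i).wr = ∅ := by unfold baseWeight; split_ifs <;> rfl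
  simp only [addTuple, appendTuple, seqs, Cmd.collect, hb]
  simp [Cmd.mem_collect_seqs, childStep, seqs, Cmd.collect, Prim.wr, h, h', h'']

/-- The tuple is inconsistent with repeated variables, or its projection was seen, or it is new.
Dropping repetitions cannot change weights: upper nodes contribute weight `1`, and at lower nodes
the projection is the whole tuple. -/
theorem insertTuple_spec {i k : ℕ} (hi : i < Pl.N) {s : St α W} (h : InsInv D Pl T i k s)
    (hk : s.reg (.sc .k) = .num k) :
    (insertTuple Pl i).wp (fun s' => InsInv D Pl T i (k + 1) s' ∧
      s'.reg (.sc .k) = .num (k + 1)) s := by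
  rw [insertTuple, seqs, Cmd.wp]
  refine Cmd.wp_use (fetch_spec (D := D) h.core.inp hk) fun s₁ ⟨hkid₁, hf⟩ hfr₁ => ?_
  have hk₁ : s₁.reg (.sc .k) = .num k := by rw [hfr₁.reg _ (fetch_wr (by simp) (by simp)), hk]
  have h₁ : InsInv D Pl T i k s₁ := h.congr (hfr₁.arr_eq fetch_wt) (hfr₁.warr_eq fetch_wwt)
    (hfr₁.reg _ (fetch_wr (by simp) (by simp))) (hfr₁.reg _ (fetch_wr (by simp) (by simp)))
  clear hfr₁ h hk
  rw [seqs, Cmd.wp]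
  refine Cmd.wp_use (testTuple_spec (D := D) (k := k) h₁.core.inp hkid₁ h₁.core.zero h₁.core.one)
    fun s₂ ht hfr₂ => ?_
  have hva : s₂.va = s₁.va := funext fun x => hfr₂.reg _ (testTuple_wr (by simp) (by simp) (by simp))
  have hk₂ : s₂.reg (.sc .k) = .num k := by
    rw [hfr₂.reg _ (testTuple_wr (by simp) (by simp) (by simp)), hk₁]
  have h₂ : InsInv D Pl T i k s₂ := h₁.congr (hfr₂.arr_eq testTuple_wt)
    (hfr₂.warr_eq testTuple_wwt) (hfr₂.reg _ (testTuple_wr (by simp) (by simp) (by simp)))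
    (hfr₂.reg _ (testTuple_wr (by simp) (by simp) (by simp)))
  rw [← hva] at hf ht
  clear hfr₂ h₁ hk₁ hva hkid₁
  rw [seqs, Cmd.wp]
  refine Cmd.wp_mono (Q := fun s' => InsInv D Pl T i (k + 1) s' ∧ s'.reg (.sc .k) = .num k) _ ?_ ?_
  · have hone := h₂.core.one
    simp only [Cmd.wp, Cond.holds, hone, seqs]
    rcases ht with ⟨hok, hM⟩ | ⟨hok, hM⟩
    · refine ⟨fun _ => ?_, fun h => absurd hok h⟩
      set s₃ := Prim.app (.load (.sc .cn) (.seen i) ((Pl.X i).map .var)) s₂.tick with hs₃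
      have h₃ : InsInv D Pl T i k s₃ := h₂.congr rfl rfl (by simp [hs₃, Prim.app])
        (by simp [hs₃, Prim.app])
      have hva₃ : s₃.va = s₂.va := by funext x; simp [St.va, hs₃, Prim.app]
      have hk₃ : s₃.reg (.sc .k) = .num k := by simp [hs₃, Prim.app, hk₂]
      have hok₃ : s₃.reg (.sc .ok) = .num 1 := by simp [hs₃, Prim.app, hok]
      have hcn : s₃.reg (.sc .cn) = s₃.arr (.seen i) ((Pl.X i).map s₃.va) := by
        rw [hva₃]
        simp [hs₃, Prim.app, Function.comp_def]
        rfl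
      rw [← hva₃] at hM
      clear_value s₃
      rw [h₃.core.zero, hcn]
      rcases h₃.seen ((Pl.X i).map s₃.va) with ⟨e, hs⟩ | ⟨e, hs⟩
      · refine ⟨fun h => (by rw [e] at h; cases h), fun _ => ⟨?_, hk₃⟩⟩
        refine (h₃.skip hi fun a ha => ?_).congr rfl rfl rfl rfl
        rwa [List.map_congr_left (ha.eq_on hi hM)]
      · refine ⟨fun _ => ?_, fun h => absurd e h⟩
        refine Cmd.wp_use (addTuple_spec (s := s₃.tick) hi (h₃.congr rfl rfl rfl rfl) hk₃ hok₃ hM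
          hs) fun s₄ h₄ hfr₄ => ⟨h₄, ?_⟩
        rw [hfr₄.reg _ (addTuple_wr (by simp) (by simp) (by simp))]
        exact hk₃
    · refine ⟨fun h => (by rw [hok] at h; cases h), fun _ => ⟨?_, hk₂⟩⟩
      exact (h₂.skip hi fun a ha => absurd (hf a ha) hM).congr rfl rfl rfl rfl
  · rintro s' ⟨h', hk'⟩
    simp only [seqs, Cmd.wp]
    refine ⟨h'.congr rfl rfl (by simp [Prim.app]) (by simp [Prim.app]), ?_⟩
    simp [Prim.app, hk', h'.core.one]

theorem insertTuple_loopFree {i : ℕ} : (insertTuple Pl i).loopFree := by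
  simp [insertTuple, fetch, testTuple, addTuple, appendTuple, childStep, loadVars, checkVars,
    Cmd.loopFree_seqs, seqs, Cmd.loopFree]

theorem insertTuple_wr {i : ℕ} : Reg.sc .sz ∉ (insertTuple Pl i).collect Prim.wr := by
  have h1 := fetch_wr (Pl := Pl) (i := i) (a := .sz) (by simp) (by simp)
  have h2 := testTuple_wr (Pl := Pl) (i := i) (r := .sc .sz) (by simp) (by simp) (by simp)
  have h3 := addTuple_wr (Pl := Pl) (i := i) (r := .sc .sz) (by simp) (by simp) (by simp)
  simp [insertTuple, seqs, Cmd.collect, Prim.wr, h1, h2, h3]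

theorem insertLoop_spec {i sz : ℕ} (hi : i < Pl.N) {s : St α W} (h : InsInv D Pl T i 0 s)
    (hk : s.reg (.sc .k) = .num 0) (hsz : s.reg (.sc .sz) = .num sz) :
    (Cmd.loop (.eq (.sc .k) (.sc .sz)) (insertTuple Pl i)).wp (fun s' => InsInv D Pl T i sz s' ∧
      s'.clock ≤ s.clock + 1 + ((insertTuple Pl i).cost + 2) * sz) s := by
  refine Cmd.wp_loop (fun n s' => ∃ k, k + n = sz ∧ InsInv D Pl T i k s' ∧
    s'.reg (.sc .k) = .num k ∧ s'.clock ≤ s.clock + ((insertTuple Pl i).cost + 2) * k) sz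
    ⟨0, by omega, h, hk, by omega⟩ ?_ ?_
  · rintro n s' hfr ⟨k, hkn, h1, h2, h3⟩ hb
    have hsz' : s'.reg (.sc .sz) = .num sz := by rw [hfr.reg _ insertTuple_wr, hsz]
    simp only [Cond.holds, h2, hsz', Word.num.injEq] at hb
    refine Cmd.wp_use_cost insertTuple_loopFree (insertTuple_spec (s := s'.tick) hi
      (h1.congr rfl rfl rfl rfl) h2) fun s'' ⟨h4, h5⟩ _ hclk => ?_
    refine ⟨n - 1, by omega, k + 1, by omega, h4.congr rfl rfl rfl rfl, h5, ?_⟩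
    simp only [St.tick_clock] at hclk ⊢
    rw [mul_add]
    omega
  · rintro n s' hfr ⟨k, hkn, h1, h2, h3⟩ hb
    have hsz' : s'.reg (.sc .sz) = .num sz := by rw [hfr.reg _ insertTuple_wr, hsz]
    simp only [Cond.holds, h2, hsz', Word.num.injEq] at hb
    subst hb
    refine ⟨h1.congr rfl rfl rfl rfl, ?_⟩
    simp only [St.tick_clock]
    omega

open Classical in
/-- The loop invariant of the second pass; the groups of the keys in `S` are heaps. -/
structure HeapInv (D : Database Q α W) (Pl : Plan Q) (T₀ : Tables α W) (i k : ℕ)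
    (S : Finset (List (Word α))) (T : Tables α W) (s : St α W) : Prop where
  core : BuildCore D Pl T₀ i s
  same : ∀ c, c ≠ i → T₀.SameAt T c
  at_ : NodeAt T i s
  ok : Pl.NodeOK D T i (D.size (Pl.rel i))
  hz : ∀ κ, s.arr (.hz i) κ = if κ ∈ S then .num 1 else .num 0
  heap : ∀ κ ∈ S, HeapFrom 1 (T.cnt i κ) fun p => T.ow i (T.hp i κ p)
  done : ∀ k' < k, ∀ a, Pl.Match D i k' a → (Pl.K i).map a ∈ S

theorem HeapInv.congr {i k : ℕ} {S : Finset (List (Word α))} {T' : Tables α W} {s s' : St α W}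
    (h : HeapInv D Pl T i k S T' s)
    (h1 : s'.arr = s.arr) (h2 : s'.warr = s.warr) (h3 : s'.reg (.sc .one) = s.reg (.sc .one))
    (h4 : s'.reg (.sc .zero) = s.reg (.sc .zero)) : HeapInv D Pl T i k S T' s' :=
  ⟨h.core.congr h1 h2 h3 h4, h.same, h.at_.congr (.refl _ _) (by rw [h1]) (by rw [h1])
    (by rw [h2]), h.ok, by rw [h1]; exact h.hz, h.heap, h.done⟩

theorem heapify_wr {h wt : Tag} {xs : List ℕ} {r : Reg} (hr : r ∈ (heapify h wt xs).collect Prim.wr) :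
    r = .sc .cur ∨ r = .sc .lp ∨
      r = .sc .ch ∨ r = .sc .ch1 ∨ r = .sc .ia ∨ r = .sc .ib ∨ r = .sc .ic := by
  simp [heapify, heapifyBody, siftDown, pickChild, exchangeChild, seqs, Cmd.collect, Prim.wr] at hr
  tauto

theorem heapify_wt {h wt t : Tag} {xs : List ℕ} (ht : t ≠ h) :
    t ∉ (heapify h wt xs).collect Prim.wt := by
  simp [heapify, heapifyBody, siftDown, pickChild, exchangeChild, seqs, Cmd.collect, Prim.wt, ht]

theorem heapify_wwt {h wt t : Tag} {xs : List ℕ} : t ∉ (heapify h wt xs).collect Prim.wwt := by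
  simp [heapify, heapifyBody, siftDown, pickChild, exchangeChild, seqs, Cmd.collect, Prim.wwt]

/-- Amortized bound: a group is heapified when the first of its tuples comes up, and the cost is
charged to the growth of the sum of group sizes over `S`. Every other tuple takes constant time. -/
theorem heapifyGroup_spec (hW : IsSelective W) {i k : ℕ} (hi : i < Pl.N)
    {S : Finset (List (Word α))} {T' : Tables α W} {s : St α W}
    (h : HeapInv D Pl T i k S T' s) (hk : s.reg (.sc .k) = .num k) :
    (heapifyGroup Pl i).wp (fun s' => ∃ S' T'', HeapInv D Pl T i (k + 1) S' T'' s' ∧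
      s'.reg (.sc .k) = .num (k + 1) ∧
      s'.clock + (6 + siftStep) * ∑ κ ∈ S, T'.cnt i κ ≤
        s.clock + ((fetch Pl i).cost + 10) + (6 + siftStep) * ∑ κ ∈ S', T''.cnt i κ) s := by
  classical
  rw [heapifyGroup, seqs, Cmd.wp]
  have hlf : (fetch Pl i).loopFree := by
    simp [fetch, loadVars, Cmd.loopFree_seqs, Cmd.loopFree]
  refine Cmd.wp_use_cost hlf (fetch_spec (D := D) h.core.inp hk) fun s₁ ⟨_, hf⟩ hfr₁ hclk₁ => ?_
  have hk₁ : s₁.reg (.sc .k) = .num k := by rw [hfr₁.reg _ (fetch_wr (by simp) (by simp)), hk]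
  have h₁ : HeapInv D Pl T i k S T' s₁ := h.congr (hfr₁.arr_eq fetch_wt) (hfr₁.warr_eq fetch_wwt)
    (hfr₁.reg _ (fetch_wr (by simp) (by simp))) (hfr₁.reg _ (fetch_wr (by simp) (by simp)))
  clear hfr₁ h hk
  rw [seqs, Cmd.wp, Cmd.wp]
  set s₂ := Prim.app (.load (.sc .cn) (.hz i) ((Pl.K i).map .var)) s₁ with hs₂
  have h₂ : HeapInv D Pl T i k S T' s₂ := h₁.congr rfl rfl (by simp [hs₂, Prim.app])
    (by simp [hs₂, Prim.app])
  have hva₂ : s₂.va = s₁.va := by funext x; simp [St.va, hs₂, Prim.app]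
  have hk₂ : s₂.reg (.sc .k) = .num k := by simp [hs₂, Prim.app, hk₁]
  have hcn : s₂.reg (.sc .cn) = s₂.arr (.hz i) ((Pl.K i).map s₂.va) := by
    rw [hva₂]
    simp [hs₂, Prim.app, Function.comp_def]
    rfl
  have hclk₂ : s₂.clock = s₁.clock + 1 := rfl
  rw [← hva₂] at hf
  clear_value s₂
  set κ := (Pl.K i).map s₂.va with hκ
  -- A matching tuple has the key in the registers. A tuple that matches nothing may yield a stray
  -- key, whose group is heapified without harm.
  have hdone : ∀ S', S ⊆ S' → κ ∈ S' → ∀ k' < k + 1, ∀ a, Pl.Match D i k' a →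
      (Pl.K i).map a ∈ S' := by
    intro S' hS hκS k' hk' a ha
    rcases Nat.lt_succ_iff_lt_or_eq.1 hk' with hk' | rfl
    · exact hS (h₂.done k' hk' a ha)
    · rwa [Plan.map_key_congr hi (ha.eq_on hi (hf a ha))]
  rw [seqs, Cmd.wp]
  refine Cmd.wp_mono (Q := fun s' => ∃ S' T'', HeapInv D Pl T i (k + 1) S' T'' s' ∧
      s'.reg (.sc .k) = .num k ∧
      s'.clock + (6 + siftStep) * ∑ κ ∈ S, T'.cnt i κ ≤
        s.clock + ((fetch Pl i).cost + 9) + (6 + siftStep) * ∑ κ ∈ S', T''.cnt i κ) _ ?_ ?_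
  · have hz := h₂.core.zero
    simp only [Cmd.wp, Cond.holds, seqs]
    rw [hz, hcn, h₂.hz]
    by_cases hκS : κ ∈ S
    · rw [if_pos hκS]
      refine ⟨fun h => (by cases h), fun _ => ⟨S, T', ?_, hk₂, ?_⟩⟩
      · exact ⟨h₂.core.congr rfl rfl rfl rfl, h₂.same, h₂.at_.congr (.refl _ _) rfl rfl rfl, h₂.ok,
          h₂.hz, h₂.heap, hdone S subset_rfl hκS⟩
      · simp only [St.tick_clock]
        omega
    · rw [if_neg hκS]
      refine ⟨fun _ => ?_, fun h => absurd rfl h⟩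
      set s₃ := Prim.app (.load (.sc .n) (.cnt i) ((Pl.K i).map .var))
        (Prim.app (.store (.hz i) ((Pl.K i).map .var) (.sc .one)) s₂.tick) with hs₃
      have hva₃ : s₃.va = s₂.va := by funext x; simp [St.va, hs₃, Prim.app]
      have hat₃ : NodeAt T' i s₃ := h₂.at_.congr (.refl _ _) (by simp [hs₃, Prim.app])
        (by simp [hs₃, Prim.app]) (by simp [hs₃, Prim.app])
      have hcore₃ : BuildCore D Pl T i s₃ := by
        refine ⟨⟨fun R key => ?_, fun R key => ?_⟩, ?_, ?_, fun c hc => ?_⟩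
        · rw [← h₂.core.inp.1]; simp [hs₃, Prim.app]
        · exact h₂.core.inp.2 R key
        · rw [← h₂.core.one]; simp [hs₃, Prim.app]
        · rw [← h₂.core.zero]; simp [hs₃, Prim.app]
        · exact (h₂.core.child c hc).congr (.refl _ _) (by simp [hs₃, Prim.app])
            (by simp [hs₃, Prim.app]) (by simp [hs₃, Prim.app])
      have hn₃ : s₃.reg (.sc .n) = .num (T'.cnt i κ) := by
        rw [← h₂.at_.cnt, hκ]
        simp [hs₃, Prim.app, Function.comp_def]
        rfl
      have hhz₃ : ∀ κ', s₃.arr (.hz i) κ' = if κ' ∈ insert κ S then .num 1 else .num 0 := by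
        intro κ'
        have : s₃.arr (.hz i) κ' = if κ' = κ then .num 1 else s₂.arr (.hz i) κ' := by
          simp only [hs₃, Prim.app, Function.update_self, List.map_map, Function.comp_def,
            Function.update_apply, St.tick_reg, St.tick_arr, h₂.core.one]
          rfl
        rw [this, h₂.hz]
        by_cases h : κ' = κ <;> simp [h]
      have hk₃ : s₃.reg (.sc .k) = .num k := by simp [hs₃, Prim.app, hk₂]
      have hclk₃ : s₃.clock = s₂.clock + 3 := rfl
      clear_value s₃
      refine Cmd.wp_use (heapify_spec (wt := .ow i) (xs := Pl.K i) (f := T'.hp i κ) hW hcore₃.one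
        hcore₃.zero hn₃
        (fun p hp hp' => by rw [St.vals_eq, hva₃]; exact hat₃.hp κ p hp hp')) ?_
      rintro s₄ ⟨f', hsh, hf', hheap, hother, hclk₄⟩ hfr₄
      rw [St.vals_eq, hva₃, ← hκ] at hf' hother
      have hreg : ∀ a : Sc, a ≠ .cur → a ≠ .lp → a ≠ .ch → a ≠ .ch1 → a ≠ .ia → a ≠ .ib →
          a ≠ .ic → s₄.reg (.sc a) = s₃.reg (.sc a) := fun a _ _ _ _ _ _ _ =>
        hfr₄.reg _ fun h => by have := heapify_wr h; simp_all
      let T'' : Tables α W := { T' with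
        hp := Function.update T'.hp i (Function.update (T'.hp i) κ f') }
      have hT'' : ∀ κ' p, T''.hp i κ' p = if κ' = κ then f' p else T'.hp i κ' p := by
        intro κ' p
        simp only [T'', Function.update_self, Function.update_apply]
        split_ifs <;> rfl
      have hsame : ∀ c, c ≠ i → T'.SameAt T'' c := fun c hc => ⟨rfl, by simp [T'', hc], rfl⟩
      have hidw : ∀ p, s₃.idw (.ow i) p = T'.ow i p := fun p => hat₃.ow p
      simp only [hidw] at hheap
      refine ⟨insert κ S, T'', ⟨?_, ?_, ?_, ?_, ?_, ?_, ?_⟩, ?_, ?_⟩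
      · exact hcore₃.of_fr hfr₄ (fun h => by have := heapify_wr h; simp_all)
          (fun h => by have := heapify_wr h; simp_all) (fun R => heapify_wt (by simp))
          (fun R => heapify_wwt) (fun c _ => heapify_wt (by simp))
          (fun c hc => heapify_wt (by simp [hc])) (fun c _ => heapify_wwt)
      · intro c hc
        obtain ⟨e1, e2, e3⟩ := h₂.same c hc
        obtain ⟨e4, e5, e6⟩ := hsame c hc
        exact ⟨e4.trans e1, e5.trans e2, e6.trans e3⟩
      · constructor
        · rw [hfr₄.arr _ (heapify_wt (by simp))]
          exact hat₃.cnt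
        · intro κ' p hp hp'
          rw [hT'']
          split_ifs with hκ'
          · subst hκ'
            exact hf' p hp hp'
          · rw [hother _ (by simp [hκ'])]
            exact hat₃.hp κ' p hp hp'
        · rw [hfr₄.warr _ heapify_wwt]
          exact hat₃.ow
      · refine h₂.ok.shuffle (fun c hc => hsame c fun e => Plan.not_mem_children_self (e ▸ hc))
          rfl rfl fun κ' => ?_
        by_cases hκ' : κ' = κ
        · subst hκ'
          simpa [T''] using hsh
        · simpa [T'', hκ'] using Shuffle.refl _ _
      · rw [hfr₄.arr _ (heapify_wt (by simp))]
        exact hhz₃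
      · intro κ' hκ'
        simp only [hT'']
        by_cases e : κ' = κ
        · subst e
          simpa using hheap
        · simpa [e] using h₂.heap κ' ((Finset.mem_insert.1 hκ').resolve_left e)
      · exact hdone _ (Finset.subset_insert _ _) (Finset.mem_insert_self _ _)
      · rw [hreg _ (by simp) (by simp) (by simp) (by simp) (by simp) (by simp) (by simp), hk₃]
      · have : ∑ κ ∈ insert κ S, T''.cnt i κ = T'.cnt i κ + ∑ κ ∈ S, T'.cnt i κ :=
          Finset.sum_insert hκS
        rw [this, mul_add]
        omega
  · rintro s' ⟨S', T'', h', hk', hclk'⟩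
    simp only [seqs, Cmd.wp]
    refine ⟨S', T'', h'.congr rfl rfl (by simp [Prim.app]) (by simp [Prim.app]), ?_, ?_⟩
    · simp [Prim.app, hk', h'.core.one]
    · simp only [Prim.app]
      omega

theorem heapifyGroup_wr {i : ℕ} : Reg.sc .sz ∉ (heapifyGroup Pl i).collect Prim.wr := by
  have h1 := fetch_wr (Pl := Pl) (i := i) (a := .sz) (by simp) (by simp)
  have h2 : Reg.sc .sz ∉ (heapify (.heap i) (.ow i) (Pl.K i)).collect Prim.wr := fun h => by
    have := heapify_wr h
    simp_all
  simp [heapifyGroup, seqs, Cmd.collect, Prim.wr, h1, h2]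

/-- The group sizes over any set of keys sum to at most the size of the relation, so the amortized
costs add up to linear time. -/
theorem heapifyLoop_spec (hW : IsSelective W) {i : ℕ} (hi : i < Pl.N) {T' : Tables α W}
    {s : St α W} (h : HeapInv D Pl T i 0 ∅ T' s) (hk : s.reg (.sc .k) = .num 0)
    (hsz : s.reg (.sc .sz) = .num (D.size (Pl.rel i))) :
    (Cmd.loop (.eq (.sc .k) (.sc .sz)) (heapifyGroup Pl i)).wp (fun s' =>
      (∃ S T'', HeapInv D Pl T i (D.size (Pl.rel i)) S T'' s') ∧
      s'.clock ≤ s.clock + 1 + ((fetch Pl i).cost + 18 + siftStep) * D.size (Pl.rel i)) s := by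
  refine Cmd.wp_loop (fun n s' => ∃ k S T'', k + n = D.size (Pl.rel i) ∧
    HeapInv D Pl T i k S T'' s' ∧ s'.reg (.sc .k) = .num k ∧
    s'.clock ≤ s.clock + ((fetch Pl i).cost + 12) * k +
      (6 + siftStep) * ∑ κ ∈ S, T''.cnt i κ) (D.size (Pl.rel i)) ⟨0, ∅, T', by omega, h, hk, by omega⟩ ?_ ?_
  · rintro n s' hfr ⟨k, S, T'', hkn, h1, h2, h3⟩ hb
    have hsz' : s'.reg (.sc .sz) = .num (D.size (Pl.rel i)) := by
      rw [hfr.reg _ heapifyGroup_wr, hsz]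
    simp only [Cond.holds, h2, hsz', Word.num.injEq] at hb
    refine Cmd.wp_mono _ (heapifyGroup_spec (s := s'.tick) hW hi (h1.congr rfl rfl rfl rfl) h2) ?_
    rintro s'' ⟨S', T₁, h4, h5, h6⟩
    refine ⟨n - 1, by omega, k + 1, S', T₁, by omega, h4.congr rfl rfl rfl rfl, h5, ?_⟩
    simp only [St.tick_clock] at h6 ⊢
    rw [mul_add ((fetch Pl i).cost + 12)]
    omega
  · rintro n s' hfr ⟨k, S, T'', hkn, h1, h2, h3⟩ hb
    have hsz' : s'.reg (.sc .sz) = .num (D.size (Pl.rel i)) := by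
      rw [hfr.reg _ heapifyGroup_wr, hsz]
    simp only [Cond.holds, h2, hsz', Word.num.injEq] at hb
    subst hb
    refine ⟨⟨S, T'', h1.congr rfl rfl rfl rfl⟩, ?_⟩
    have h4 := Nat.mul_le_mul_left (6 + siftStep) (h1.ok.sum_cnt_le hi S)
    have h5 : ((fetch Pl i).cost + 18 + siftStep) * D.size (Pl.rel i) =
      ((fetch Pl i).cost + 12) * D.size (Pl.rel i) + (6 + siftStep) * D.size (Pl.rel i) := by ring
    rw [h5, St.tick_clock]
    omega

/-- The table of node `i` is complete and in memory. -/
structure NodeDone (D : Database Q α W) (Pl : Plan Q) (T : Tables α W) (i : ℕ) (s : St α W) :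
    Prop where
  at_ : NodeAt T i s
  ok : Pl.NodeOK D T i (D.size (Pl.rel i))
  heap : ∀ κ, HeapFrom 1 (T.cnt i κ) fun p => T.ow i (T.hp i κ p)

/-- The constant in the time bound for node `i`. -/
def buildCost (Pl : Plan Q) (i : ℕ) : ℕ :=
  (insertTuple Pl i).cost + (fetch Pl i).cost + 30 + siftStep

/-- The arrays of node `i` are blank. -/
def Blank (i : ℕ) (s : St α W) : Prop :=
  ∀ κ, s.arr (.cnt i) κ = .num 0 ∧ s.arr (.seen i) κ = .num 0 ∧ s.arr (.hz i) κ = .num 0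

theorem insertTuple_wt {i : ℕ} {t : Tag} (h : t ≠ .cnt i) (h' : t ≠ .heap i) (h'' : t ≠ .seen i) :
    t ∉ (insertTuple Pl i).collect Prim.wt := by
  have hb : (baseWeight Pl i).wt = ∅ := by unfold baseWeight; split_ifs <;> rfl
  have h1 := fetch_wt (Pl := Pl) (i := i) t
  have h2 := testTuple_wt (Pl := Pl) (i := i) t
  simp only [insertTuple, addTuple, appendTuple, seqs, Cmd.collect, hb]
  simp [Cmd.mem_collect_seqs, childStep, seqs, Cmd.collect, Prim.wt, h1, h2, h, h', h'']

theorem insertTuple_wwt {i : ℕ} {t : Tag} (h : t ≠ .ow i) :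
    t ∉ (insertTuple Pl i).collect Prim.wwt := by
  have hb : (baseWeight Pl i).wwt = ∅ := by unfold baseWeight; split_ifs <;> rfl
  have h1 := fetch_wwt (Pl := Pl) (i := i) t
  have h2 := testTuple_wwt (Pl := Pl) (i := i) t
  simp only [insertTuple, addTuple, appendTuple, seqs, Cmd.collect, hb]
  simp [Cmd.mem_collect_seqs, childStep, seqs, Cmd.collect, Prim.wwt, h1, h2, h]

theorem heapifyGroup_wt {i : ℕ} {t : Tag} (h : t ≠ .heap i) (h' : t ≠ .hz i) :
    t ∉ (heapifyGroup Pl i).collect Prim.wt := by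
  have h1 := fetch_wt (Pl := Pl) (i := i) t
  have h2 := heapify_wt (wt := .ow i) (xs := Pl.K i) h
  simp [heapifyGroup, seqs, Cmd.collect, Prim.wt, h1, h2, h']

theorem heapifyGroup_wwt {i : ℕ} {t : Tag} : t ∉ (heapifyGroup Pl i).collect Prim.wwt := by
  have h1 := fetch_wwt (Pl := Pl) (i := i) t
  have h2 := heapify_wwt (h := .heap i) (wt := .ow i) (xs := Pl.K i) (t := t)
  simp [heapifyGroup, seqs, Cmd.collect, Prim.wwt, h1, h2]

theorem buildNode_wt {i : ℕ} {t : Tag} (h1 : t ≠ .cnt i) (h2 : t ≠ .heap i) (h3 : t ≠ .seen i)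
    (h4 : t ≠ .hz i) : t ∉ (buildNode Pl i).collect Prim.wt := by
  have e1 := insertTuple_wt (Pl := Pl) h1 h2 h3
  have e2 := heapifyGroup_wt (Pl := Pl) h2 h4
  simp [buildNode, seqs, Cmd.collect, Prim.wt, e1, e2]

theorem buildNode_wwt {i : ℕ} {t : Tag} (h : t ≠ .ow i) :
    t ∉ (buildNode Pl i).collect Prim.wwt := by
  have e1 := insertTuple_wwt (Pl := Pl) h
  have e2 := heapifyGroup_wwt (Pl := Pl) (i := i) (t := t)
  simp [buildNode, seqs, Cmd.collect, Prim.wwt, e1, e2]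

theorem buildNode_spec (hW : IsSelective W) {i : ℕ} (hi : i < Pl.N) {s : St α W}
    (h : BuildCore D Pl T i s) (hbl : Blank i s) :
    (buildNode Pl i).wp (fun s' => ∃ T', (∀ c, c ≠ i → T.SameAt T' c) ∧ BuildCore D Pl T i s' ∧
      NodeDone D Pl T' i s' ∧
      s'.clock ≤ s.clock + buildCost Pl i * max (D.size (Pl.rel i)) 1) s := by
  classical
  have hin : s.arr (.inp (Pl.rel i)) [] = .num (D.size (Pl.rel i)) := by
    rw [h.inp.1]
    simp [inputMem]
  rw [buildNode, seqs, Cmd.wp, Cmd.wp, seqs, Cmd.wp, Cmd.wp, seqs, Cmd.wp]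
  set s₁ := Prim.app (.const (.sc .k) 0) (Prim.app (.load (.sc .sz) (.inp (Pl.rel i)) []) s) with hs₁
  have hk₁ : s₁.reg (.sc .k) = .num 0 := by simp [hs₁, Prim.app]
  have hsz₁ : s₁.reg (.sc .sz) = .num (D.size (Pl.rel i)) := by simp [hs₁, Prim.app, hin]
  have hcore₁ : BuildCore D Pl T i s₁ := h.congr rfl rfl (by simp [hs₁, Prim.app])
    (by simp [hs₁, Prim.app])
  have hbl₁ : Blank i s₁ := hbl
  have hclk₁ : s₁.clock = s.clock + 2 := rfl
  clear_value s₁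
  have h₁ : InsInv D Pl T i 0 s₁ := by
    -- The table starts without entries. Its weights are read off the memory, since `NodeAt` makes a
    -- claim about every tuple number.
    refine ⟨hcore₁, ⟨{ cnt := Function.update T.cnt i fun _ => 0, hp := T.hp,
                       ow := Function.update T.ow i fun k => s₁.warr (.ow i) [.num k] },
      fun c hc => ⟨by simp [hc], rfl, by simp [hc]⟩, ⟨fun κ => ?_, fun κ p hp hp' => ?_,
        fun k => ?_⟩, .zero fun κ => ?_⟩, fun κ => .inr ⟨(hbl₁ κ).2.1, ?_⟩⟩
    · simp [(hbl₁ κ).1]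
    · simp at hp'
      omega
    · simp
    · simp
    · rintro ⟨k', hk', -⟩
      omega
  refine Cmd.wp_use (insertLoop_spec hi h₁ hk₁ hsz₁) fun s₂ ⟨h₂, hclk₂⟩ hfr₂ => ?_
  have hsz₂ : s₂.reg (.sc .sz) = .num (D.size (Pl.rel i)) := by
    rw [hfr₂.reg _ insertTuple_wr, hsz₁]
  have hz₂ : s₂.arr (.hz i) = s₁.arr (.hz i) :=
    hfr₂.arr _ (insertTuple_wt (by simp) (by simp) (by simp))
  rw [seqs, Cmd.wp, Cmd.wp]
  set s₃ := Prim.app (.const (.sc .k) 0) s₂ with hs₃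
  have hk₃ : s₃.reg (.sc .k) = .num 0 := by simp [hs₃, Prim.app]
  have hsz₃ : s₃.reg (.sc .sz) = .num (D.size (Pl.rel i)) := by simp [hs₃, Prim.app, hsz₂]
  have h₃ := h₂.congr (s' := s₃) rfl rfl (by simp [hs₃, Prim.app]) (by simp [hs₃, Prim.app])
  have hz₃ : s₃.arr (.hz i) = s₁.arr (.hz i) := hz₂
  have hclk₃ : s₃.clock = s₂.clock + 1 := rfl
  clear_value s₃
  obtain ⟨hcore₃, ⟨T', hsame, hat, hok⟩, -⟩ := h₃
  have h₄ : HeapInv D Pl T i 0 ∅ T' s₃ := by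
    refine ⟨hcore₃, hsame, hat, hok, fun κ => ?_, by simp, by simp⟩
    rw [hz₃, (hbl₁ κ).2.2]
    simp
  rw [seqs, seqs, Cmd.wp]
  refine Cmd.wp_mono _ (heapifyLoop_spec hW hi h₄ hk₃ hsz₃) ?_
  rintro s₅ ⟨⟨S, T'', h₅⟩, hclk₅⟩
  refine ⟨T'', h₅.same, h₅.core, ⟨h₅.at_, h₅.ok, fun κ => ?_⟩, ?_⟩
  · by_cases hκ : κ ∈ S
    · exact h₅.heap κ hκ
    -- A key outside `S` has an empty group: any entry would come from a tuple that the second pass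
    -- has handled.
    · intro c hc hc' _
      obtain ⟨h6, a, h7, h8, -⟩ := h₅.ok.sound κ c (by omega) hc'
      exact absurd (h8 ▸ h₅.done _ h6 a h7) hκ
  · set n := D.size (Pl.rel i)
    have h6 : n ≤ max n 1 := le_max_left _ _
    have h7 : 1 ≤ max n 1 := le_max_right _ _
    have e1 := Nat.mul_le_mul_left ((insertTuple Pl i).cost + 2) h6
    have e2 := Nat.mul_le_mul_left ((fetch Pl i).cost + 18 + siftStep) h6
    have e3 : buildCost Pl i * max n 1 = ((insertTuple Pl i).cost + 2) * max n 1 +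
      ((fetch Pl i).cost + 18 + siftStep) * max n 1 + 10 * max n 1 := by
      rw [buildCost]; ring
    rw [e3]
    omega

/-- Build the tables of the nodes below `n`, from the leaves to the root. -/
def buildBelow (Pl : Plan Q) : ℕ → Cmd
  | 0 => .skip
  | n + 1 => .seq (buildNode Pl n) (buildBelow Pl n)

/-- Children have larger numbers than their parents, so building in descending order finds the
tables of all children finished. -/
theorem buildBelow_spec (hW : IsSelective W) {n : ℕ} (hn : n ≤ Pl.N) {s : St α W}
    (hin : InpOK D s) (hone : s.reg (.sc .one) = .num 1) (hzero : s.reg (.sc .zero) = .num 0)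
    (hbl : ∀ i < n, Blank i s) (hd : ∀ i, n ≤ i → i < Pl.N → NodeDone D Pl T i s) :
    (buildBelow Pl n).wp (fun s' => (∃ T', ∀ i < Pl.N, NodeDone D Pl T' i s') ∧ InpOK D s' ∧
      s'.reg (.sc .one) = .num 1 ∧ s'.reg (.sc .zero) = .num 0 ∧
      s'.clock ≤ s.clock + (∑ i ∈ Finset.range n, buildCost Pl i) * max D.n 1) s := by
  induction n generalizing s T with
  | zero => exact ⟨⟨T, fun i hi => hd i (by omega) hi⟩, hin, hone, hzero, by simp⟩
  | succ n ih =>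
    rw [buildBelow, Cmd.wp]
    refine Cmd.wp_use (buildNode_spec (T := T) hW (i := n) (by omega)
      ⟨hin, hone, hzero, fun c hc => ?_⟩ (hbl n (by omega))) ?_
    · obtain ⟨h1, h2, -⟩ := Plan.mem_children.1 hc
      exact (hd c (by omega) h1).at_
    rintro s₁ ⟨T', hsame, hcore, hdone, hclk⟩ hfr
    refine Cmd.wp_mono _ (ih (T := T') (by omega) hcore.inp hcore.one hcore.zero ?_ ?_) ?_
    · intro i hi κ
      rw [hfr.arr _ (buildNode_wt (by simp; omega) (by simp) (by simp) (by simp)),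
        hfr.arr _ (buildNode_wt (by simp) (by simp) (by simp; omega) (by simp)),
        hfr.arr _ (buildNode_wt (by simp) (by simp) (by simp) (by simp; omega))]
      exact hbl i (by omega) κ
    · intro i hi hi'
      rcases Nat.eq_or_lt_of_le hi with rfl | hi
      · exact hdone
      · have hne : i ≠ n := by omega
        obtain ⟨h1, h2, h3⟩ := hd i hi hi'
        have hs := hsame i hne
        refine ⟨h1.congr hs (hfr.arr _ (buildNode_wt (by simp [hne]) (by simp) (by simp) (by simp)))
          (hfr.arr _ (buildNode_wt (by simp) (by simp [hne]) (by simp) (by simp)))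
          (hfr.warr _ (buildNode_wwt (by simp [hne]))), h2.congr hs fun c hc => hsame c ?_, ?_⟩
        · have := (Plan.mem_children.1 hc).2.1
          omega
        · rw [hs.1, hs.2.1, hs.2.2]
          exact h3
    · rintro s₂ ⟨h1, h2, h3, h4, h5⟩
      refine ⟨h1, h2, h3, h4, ?_⟩
      have h6 : D.size (Pl.rel n) ≤ D.n :=
        Finset.le_sup (f := fun i : Fin Q.numAtoms => D.size (Q.rel i)) (Finset.mem_univ _)
      have h7 : max (D.size (Pl.rel n)) 1 ≤ max D.n 1 := max_le_max h6 le_rfl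
      have h8 := Nat.mul_le_mul_left (buildCost Pl n) h7
      rw [Finset.sum_range_succ, add_mul]
      omega

end BuildLoops

/-! ### From a position vector to its valuation and weight -/

section Decode

variable {Q : CQ} {α : Type u} {W : Type v} [CommSemiring W]

/-- Follow the position at node `i`. -/
def decodeNode (Pl : Plan Q) (i : ℕ) : Cmd := seqs [
  .prim (.load (.sc .cn) (.cnt i) ((Pl.K i).map .var)),
  .ite (.lt (.sc .cn) (.pos i)) (.prim (.move (.sc .ok) (.sc .zero)))
    (seqs [
      .prim (.load (.sc .kid) (.heap i) (.pos i :: (Pl.K i).map .var)),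
      loadVars Q (Pl.atom i) ((List.finRange _).filter fun j => (Q.args (Pl.atom i) j : ℕ) ∈ Pl.X i)])]

def decodeBelow (Pl : Plan Q) : ℕ → Cmd
  | 0 => .skip
  | n + 1 => .seq (decodeBelow Pl n) (decodeNode Pl n)

/-- The nodes outside the head whose parent belongs to the head. -/
def Plan.border (Pl : Plan Q) : List ℕ :=
  (List.range Pl.N).filter fun c => Pl.m ≤ c ∧ Pl.par c < Pl.m

/-- Compute the valuation and the weight given by a position vector, and check its validity. -/
def decode (Pl : Plan Q) : Cmd := seqs [
  .prim (.move (.sc .ok) (.sc .one)),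
  decodeBelow Pl Pl.m,
  .prim (.wone 0),
  seqs (Pl.border.map (childStep Pl))]

variable {Pl : Plan Q} {D : Database Q α W} {T : Tables α W}

/-- The input and the tables are in memory. -/
structure Env (D : Database Q α W) (Pl : Plan Q) (T : Tables α W) (s : St α W) : Prop where
  inp : InpOK D s
  one : s.reg (.sc .one) = .num 1
  zero : s.reg (.sc .zero) = .num 0
  node : ∀ c < Pl.N, NodeAt T c s

theorem Env.of_fr {p : Cmd} {s s' : St α W} (h : Env D Pl T s) (hfr : Fr p s s')
    (h1 : .sc .one ∉ p.collect Prim.wr) (h2 : .sc .zero ∉ p.collect Prim.wr)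
    (h3 : ∀ t ∈ p.collect Prim.wt, t = .pv ∨ t = .pq)
    (h4 : ∀ t ∈ p.collect Prim.wwt, t = .pw) : Env D Pl T s' := by
  have h3' : ∀ t, t ≠ .pv → t ≠ .pq → s'.arr t = s.arr t := fun t ht ht' =>
    hfr.arr t fun h => (h3 t h).elim ht ht'
  have h4' : ∀ t, t ≠ .pw → s'.warr t = s.warr t := fun t ht => hfr.warr t fun h => ht (h4 t h)
  refine ⟨⟨fun R key => ?_, fun R key => ?_⟩, ?_, ?_, fun c hc => ?_⟩
  · rw [h3' _ (by simp) (by simp)]; exact h.inp.1 R key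
  · rw [h4' _ (by simp)]; exact h.inp.2 R key
  · rw [hfr.reg _ h1, h.one]
  · rw [hfr.reg _ h2, h.zero]
  · exact (h.node c hc).congr (.refl _ _) (h3' _ (by simp) (by simp)) (h3' _ (by simp) (by simp))
      (h4' _ (by simp))

theorem Env.congr {s s' : St α W} (h : Env D Pl T s) (h1 : s'.arr = s.arr) (h2 : s'.warr = s.warr)
    (h3 : s'.reg (.sc .one) = s.reg (.sc .one)) (h4 : s'.reg (.sc .zero) = s.reg (.sc .zero)) :
    Env D Pl T s' :=
  ⟨⟨by rw [h1]; exact h.inp.1, by rw [h2]; exact h.inp.2⟩, h3.trans h.one, h4.trans h.zero,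
    fun c hc => (h.node c hc).congr (.refl _ _) (by rw [h1]) (by rw [h1]) (by rw [h2])⟩

/-- The registers written by `decode`. -/
def DecodeReg (r : Reg) : Prop :=
  (∃ x, r = .var x) ∨ r = .sc .ok ∨ r = .sc .cn ∨ r = .sc .kid ∨ r = .sc .t ∨ r = .sc .ia

theorem decodeNode_wr {i : ℕ} {r : Reg} (h : r ∈ (decodeNode Pl i).collect Prim.wr) :
    DecodeReg r := by
  simp only [decodeNode, loadVars, seqs, Cmd.collect, Prim.wr, Cmd.mem_collect_seqs, Set.mem_union,
    List.mem_map, Set.mem_singleton_iff, Set.mem_empty_iff_false, or_false] at h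
  unfold DecodeReg
  rcases h with h | h | h | ⟨_, ⟨_, _, rfl⟩, h⟩
  · simp [h]
  · simp [h]
  · simp [h]
  · simp only [Cmd.collect, Prim.wr, Set.mem_union, Set.mem_singleton_iff] at h
    rcases h with h | h <;> simp [h]

theorem decodeNode_wt {i : ℕ} (t : Tag) : t ∉ (decodeNode Pl i).collect Prim.wt := by
  simp [decodeNode, loadVars, seqs, Cmd.collect, Prim.wt, Cmd.mem_collect_seqs]

theorem decodeNode_wwt {i : ℕ} (t : Tag) : t ∉ (decodeNode Pl i).collect Prim.wwt := by
  simp [decodeNode, loadVars, seqs, Cmd.collect, Prim.wwt, Cmd.mem_collect_seqs]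

theorem decodeNode_emits {i : ℕ} (t : Unit) : t ∉ (decodeNode Pl i).collect Prim.emits := by
  simp [decodeNode, loadVars, seqs, Cmd.collect, Prim.emits, Cmd.mem_collect_seqs]

theorem decodeNode_loopFree {i : ℕ} : (decodeNode Pl i).loopFree := by
  simp [decodeNode, loadVars, Cmd.loopFree_seqs, seqs, Cmd.loopFree]

theorem decodeBelow_wr {n : ℕ} {r : Reg} (h : r ∈ (decodeBelow Pl n).collect Prim.wr) :
    DecodeReg r := by
  induction n with
  | zero => simp [decodeBelow, Cmd.collect] at h
  | succ n ih =>
    rcases h with h | h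
    · exact ih h
    · exact decodeNode_wr h

theorem decodeBelow_wt {n : ℕ} (t : Tag) : t ∉ (decodeBelow Pl n).collect Prim.wt := by
  induction n with
  | zero => simp [decodeBelow, Cmd.collect]
  | succ n ih => simp [decodeBelow, Cmd.collect, ih, decodeNode_wt]

theorem decodeBelow_wwt {n : ℕ} (t : Tag) : t ∉ (decodeBelow Pl n).collect Prim.wwt := by
  induction n with
  | zero => simp [decodeBelow, Cmd.collect]
  | succ n ih => simp [decodeBelow, Cmd.collect, ih, decodeNode_wwt]

theorem decodeBelow_emits {n : ℕ} (t : Unit) : t ∉ (decodeBelow Pl n).collect Prim.emits := by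
  induction n with
  | zero => simp [decodeBelow, Cmd.collect]
  | succ n ih => simp [decodeBelow, Cmd.collect, ih, decodeNode_emits]

theorem decodeBelow_loopFree {n : ℕ} : (decodeBelow Pl n).loopFree := by
  induction n with
  | zero => trivial
  | succ n ih => exact ⟨ih, decodeNode_loopFree⟩

theorem decode_wr {r : Reg} (h : r ∈ (decode Pl).collect Prim.wr) : DecodeReg r := by
  simp only [decode, seqs, Cmd.collect, Prim.wr, Cmd.mem_collect_seqs, Set.mem_union,
    List.mem_map, Set.mem_singleton_iff, Set.mem_empty_iff_false, or_false, false_or] at h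
  rcases h with h | h | ⟨_, ⟨c, _, rfl⟩, h⟩
  · simp [DecodeReg, h]
  · exact decodeBelow_wr h
  · simp only [childStep, seqs, Cmd.collect, Prim.wr, Set.mem_union, Set.mem_singleton_iff,
      Set.mem_empty_iff_false, or_false] at h
    unfold DecodeReg
    tauto

theorem decode_wt (t : Tag) : t ∉ (decode Pl).collect Prim.wt := by
  simp [decode, childStep, seqs, Cmd.collect, Prim.wt, Cmd.mem_collect_seqs, decodeBelow_wt]

theorem decode_wwt (t : Tag) : t ∉ (decode Pl).collect Prim.wwt := by
  simp [decode, childStep, seqs, Cmd.collect, Prim.wwt, Cmd.mem_collect_seqs, decodeBelow_wwt]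

theorem decode_emits (t : Unit) : t ∉ (decode Pl).collect Prim.emits := by
  simp [decode, childStep, seqs, Cmd.collect, Prim.emits, Cmd.mem_collect_seqs, decodeBelow_emits]

theorem decode_loopFree : (decode Pl).loopFree := by
  simp [decode, childStep, seqs, Cmd.loopFree, Cmd.loopFree_seqs, decodeBelow_loopFree]

/-- A position beyond its group is recognized by the stored group size. The claim on the valuation
is conditional because decoding also continues after a failure at an earlier node. -/
theorem decodeNode_spec {i : ℕ} (hi : i < Pl.N) (hT : Pl.TablesOK D T) {v : ℕ → ℕ} {s : St α W}
    (h : Env D Pl T s) (hv : s.reg (.pos i) = .num (v i)) (h1 : 1 ≤ v i) :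
    (decodeNode Pl i).wp (fun s' =>
      (s'.reg (.sc .ok) = s.reg (.sc .ok) ∧ v i ≤ T.cnt i ((Pl.K i).map s.va) ∧
        (Pl.Rep D T i v s.va → Pl.Rep D T (i + 1) v s'.va)) ∨
      (s'.reg (.sc .ok) = .num 0 ∧ ¬ v i ≤ T.cnt i ((Pl.K i).map s.va))) s := by
  rw [decodeNode, seqs, Cmd.wp, Cmd.wp]
  set s₁ := Prim.app (.load (.sc .cn) (.cnt i) ((Pl.K i).map .var)) s with hs₁
  have hcn : s₁.reg (.sc .cn) = .num (T.cnt i ((Pl.K i).map s.va)) := by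
    rw [← (h.node i hi).cnt]
    simp [hs₁, Prim.app, Function.comp_def]
    rfl
  have hva₁ : s₁.va = s.va := by funext x; simp [St.va, hs₁, Prim.app]
  have hok₁ : s₁.reg (.sc .ok) = s.reg (.sc .ok) := by simp [hs₁, Prim.app]
  have hv₁ : s₁.reg (.pos i) = .num (v i) := by simp [hs₁, Prim.app, hv]
  have h₁ : Env D Pl T s₁ := h.congr rfl rfl (by simp [hs₁, Prim.app]) (by simp [hs₁, Prim.app])
  clear_value s₁
  simp only [seqs, Cmd.wp, Cond.holds, hcn, hv₁, Word.toNat_num]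
  refine ⟨fun hlt => .inr ⟨?_, by omega⟩, fun hlt => ?_⟩
  · simp [Prim.app, h₁.zero]
  · have hle : v i ≤ T.cnt i ((Pl.K i).map s.va) := by omega
    set s₂ := Prim.app (.load (.sc .kid) (.heap i) (.pos i :: (Pl.K i).map .var)) s₁.tick with hs₂
    have hva₂ : s₂.va = s.va := by rw [← hva₁]; funext x; simp [St.va, hs₂, Prim.app]
    have hok₂ : s₂.reg (.sc .ok) = s.reg (.sc .ok) := by rw [← hok₁]; simp [hs₂, Prim.app]
    have hkid : s₂.reg (.sc .kid) = .num (T.hp i ((Pl.K i).map s.va) (v i)) := by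
      rw [← hva₁] at hle ⊢
      rw [← (h₁.node i hi).hp _ _ h1 hle]
      simp [hs₂, Prim.app, Function.comp_def, hv₁]
      rfl
    have h₂ : InpOK D s₂ := h₁.inp
    clear_value s₂
    refine Cmd.wp_use (loadVars_spec (D := D) _ h₂ hkid) fun s₃ ⟨h3, h4⟩ hfr => .inl ⟨?_, hle, ?_⟩
    · rw [St.tick_reg, hfr.reg _ (by simp [loadVars, Cmd.mem_collect_seqs, Cmd.collect, Prim.wr]),
        hok₂]
    · intro hr
      obtain ⟨-, b, hb, hbK, -⟩ := (hT.node i hi).sound _ _ h1 hle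
      refine (hr.step_of hi h1 hle hb hbK (fun x hx => ?_) fun x hx => ?_).1
      · obtain ⟨j, rfl⟩ := Pl.X_sub i hi x hx
        obtain ⟨j', -, h6, h7⟩ := h4 _ ⟨j, List.mem_filter.2 ⟨List.mem_finRange _, by simpa using hx⟩, rfl⟩
        refine h7.trans ?_
        rw [← hb j', h6]
      · rw [← hva₂]
        refine h3 x fun j hj e => hx ?_
        rw [← e]
        simpa using (List.mem_filter.1 hj).2

theorem decodeBelow_spec (hT : Pl.TablesOK D T) {v : ℕ → ℕ} {n : ℕ} (hn : n ≤ Pl.N) {s : St α W}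
    (h : Env D Pl T s) (hok : s.reg (.sc .ok) = .num 1)
    (hv : ∀ i < n, s.reg (.pos i) = .num (v i)) (h1 : ∀ i < n, 1 ≤ v i) :
    (decodeBelow Pl n).wp (fun s' => (s'.reg (.sc .ok) = .num 1 ∧ Pl.Rep D T n v s'.va) ∨
      (s'.reg (.sc .ok) = .num 0 ∧ ¬ ∃ a, Pl.Rep D T n v a)) s := by
  induction n with
  | zero => exact .inl ⟨hok, fun j hj => by omega⟩
  | succ n ih =>
    rw [decodeBelow, Cmd.wp]
    refine Cmd.wp_use (ih (by omega) (fun i hi => hv i (by omega)) fun i hi => h1 i (by omega))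
      fun s₁ h₁ hfr => ?_
    have henv : Env D Pl T s₁ := h.of_fr hfr (fun h => by simpa [DecodeReg] using decodeBelow_wr h)
      (fun h => by simpa [DecodeReg] using decodeBelow_wr h)
      (fun t ht => absurd ht (decodeBelow_wt t)) (fun t ht => absurd ht (decodeBelow_wwt t))
    have hv₁ : s₁.reg (.pos n) = .num (v n) := by
      rw [hfr.reg _ fun h => by simpa [DecodeReg] using decodeBelow_wr h, hv n (by omega)]
    refine Cmd.wp_mono _ (decodeNode_spec (by omega) hT henv hv₁ (h1 n (by omega))) ?_
    rintro s₂ (⟨h2, h3, h4⟩ | ⟨h2, h3⟩) <;> rcases h₁ with ⟨h5, h6⟩ | ⟨h5, h6⟩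
    · exact .inl ⟨h2.trans h5, h4 h6⟩
    · exact .inr ⟨h2.trans h5, fun ⟨a, ha⟩ => h6 ⟨a, ha.mono (by omega)⟩⟩
    -- The prefix is valid and fixes the values of its variables. So any valuation for the longer
    -- prefix has the same key at `n`, and the position is too large for it as well.
    · refine .inr ⟨h2, fun ⟨a, ha⟩ => h3 ?_⟩
      have := (ha n (by omega)).2.1
      rwa [Plan.map_key_congr_par (b := s₁.va) (by omega) fun h0 =>
        (ha.mono (by omega)).eq_on (by omega) h6 _ (Pl.par_lt n h0 (by omega))] at this
    · exact .inr ⟨h2, fun ⟨a, ha⟩ => h6 ⟨a, ha.mono (by omega)⟩⟩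

theorem Plan.prod_border (Pl : Plan Q) (f : ℕ → W) : (Pl.border.map f).prod =
    ∏ c ∈ (Finset.Ico Pl.m Pl.N).filter (fun c => Pl.par c < Pl.m), f c := by
  have hn : Pl.border.Nodup := List.nodup_range.filter _
  rw [← List.prod_toFinset f hn]
  refine Finset.prod_congr ?_ fun _ _ => rfl
  ext c
  simp only [border, List.mem_toFinset, List.mem_filter, List.mem_range, Finset.mem_filter,
    Finset.mem_Ico, decide_eq_true_eq]
  tauto

theorem decode_spec (hT : Pl.TablesOK D T) {v : ℕ → ℕ} {s : St α W}
    (h : Env D Pl T s) (hv : ∀ i < Pl.m, s.reg (.pos i) = .num (v i)) (h1 : ∀ i < Pl.m, 1 ≤ v i) :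
    (decode Pl).wp (fun s' =>
      (s'.reg (.sc .ok) = .num 1 ∧ Pl.Rep D T Pl.m v s'.va ∧
        s'.wreg 0 = Pl.answerWeight T s'.va) ∨
      (s'.reg (.sc .ok) = .num 0 ∧ ¬ ∃ a, Pl.Rep D T Pl.m v a)) s := by
  have hm := Pl.m_le
  rw [decode, seqs, Cmd.wp, Cmd.wp, seqs, Cmd.wp]
  have h₀ : Env D Pl T (Prim.app (.move (.sc .ok) (.sc .one)) s) :=
    h.congr rfl rfl (by simp [Prim.app]) (by simp [Prim.app])
  refine Cmd.wp_use (decodeBelow_spec (v := v) hT hm h₀ (by simp [Prim.app, h.one])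
    (fun i hi => by simp [Prim.app, hv i hi]) h1) fun s₁ h₁ hfr => ?_
  have henv : Env D Pl T s₁ := h₀.of_fr hfr (fun h => by simpa [DecodeReg] using decodeBelow_wr h)
    (fun h => by simpa [DecodeReg] using decodeBelow_wr h)
    (fun t ht => absurd ht (decodeBelow_wt t)) (fun t ht => absurd ht (decodeBelow_wwt t))
  rw [seqs, Cmd.wp, Cmd.wp, seqs, seqs, Cmd.wp]
  refine Cmd.wp_use (childSteps_spec (T := T) (Pl := Pl) _ (s := Prim.app (.wone 0) s₁) henv.zero
    henv.one fun c hc => ?_) fun s₂ h₂ hfr₂ => ?_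
  · simp only [Plan.border, List.mem_filter, List.mem_range] at hc
    exact (henv.node c hc.1).congr (.refl _ _) rfl rfl rfl
  · have hva : s₂.va = s₁.va := funext fun x => (hfr₂.reg _ (by
      simp [childStep, seqs, Cmd.collect, Prim.wr, Cmd.mem_collect_seqs]))
    have hva' : (Prim.app (.wone 0) s₁).va = s₁.va := rfl
    have hok' : (Prim.app (.wone 0) s₁).reg = s₁.reg := rfl
    have hw : (Prim.app (.wone 0) s₁).wreg 0 = 1 := by simp [Prim.app]
    rw [hva', hw, hok', one_mul, Plan.prod_border] at h₂
    rw [Cmd.wp, hva]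
    rcases h₁ with ⟨h3, h4⟩ | ⟨h3, h4⟩ <;> rcases h₂ with ⟨h5, h6, h7⟩ | ⟨h5, h6⟩
    · exact .inl ⟨h5.trans h3, h4, h7⟩
    -- Stored tuples have partners in all children, so a valid vector cannot fail at the border.
    · refine absurd (fun c hc => ?_) h6
      simp only [Plan.border, List.mem_filter, List.mem_range, decide_eq_true_eq] at hc
      have hpm := Pl.m_pos
      exact ((h4 _ hc.2.2).spec (by omega) (hT.node _ (by omega))).1 c
        (Plan.mem_children.2 ⟨hc.1, Pl.par_lt c (by omega) hc.1, rfl⟩)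
    · exact .inr ⟨h5.trans h3, h4⟩
    · exact .inr ⟨h5, h4⟩

end Decode

/-! ### The search tree of position vectors -/

section Vectors

/-- All coordinates after `i` are `1`. -/
def Legal (v : ℕ → ℕ) (i : ℕ) : Prop := ∀ j, i < j → v j = 1

/-- For bits `b = 0, 1` these are the two heap children at coordinate `i`. Under `Legal v i`, no
coordinate after `i` differs from `1`. -/
def childVec (v : ℕ → ℕ) (i b : ℕ) : ℕ → ℕ := Function.update v i (2 * v i + b)

theorem childVec_self (v : ℕ → ℕ) (i b : ℕ) : childVec v i b i = 2 * v i + b :=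
  Function.update_self ..

theorem childVec_of_ne {v : ℕ → ℕ} {i b j : ℕ} (h : j ≠ i) : childVec v i b j = v j :=
  Function.update_of_ne h ..

theorem childVec_ne_root {v : ℕ → ℕ} {i b : ℕ} (h : 1 ≤ v i) : childVec v i b ≠ fun _ => 1 :=
  fun e => by
    have := congrFun e i
    simp only [childVec_self] at this
    omega

/-- The first vector has a value of at least `2` at `i`, while the second is `1` after `i'`. -/
theorem childVec_index {v v' : ℕ → ℕ} {i i' b b' : ℕ} (h : 1 ≤ v i) (hl' : Legal v' i')
    (e : childVec v i b = childVec v' i' b') : i ≤ i' := by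
  by_contra hlt
  have := congrFun e i
  rw [childVec_self, childVec_of_ne (by omega), hl' i (by omega)] at this
  omega

/-- The changed coordinate is the last one that differs from `1`; quotient and remainder by `2`
recover its old value and the bit. Unique parents spare the search any test for duplicates. -/
theorem childVec_inj {v v' : ℕ → ℕ} {i i' b b' : ℕ} (hb : b < 2) (hb' : b' < 2) (h : 1 ≤ v i)
    (h' : 1 ≤ v' i') (hl : Legal v i) (hl' : Legal v' i')
    (e : childVec v i b = childVec v' i' b') : v = v' ∧ i = i' ∧ b = b' := by
  have hi : i = i' := le_antisymm (childVec_index h hl' e) (childVec_index h' hl e.symm)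
  subst hi
  have h1 := congrFun e i
  rw [childVec_self, childVec_self] at h1
  refine ⟨funext fun j => ?_, rfl, by omega⟩
  by_cases hj : j = i
  · subst hj
    omega
  · have := congrFun e j
    rwa [childVec_of_ne hj, childVec_of_ne hj] at this

variable {Q : CQ} {α : Type u} {W : Type v} [CommSemiring W]
variable (Pl : Plan Q) (D : Database Q α W) (T : Tables α W)

/-- The position vectors of the answers. -/
structure Valid (v : ℕ → ℕ) : Prop where
  rep : ∃ a, Pl.Rep D T Pl.m v a
  tail : ∀ j, Pl.m ≤ j → v j = 1

open Classical in
/-- The weight of the answer given by a position vector. -/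
noncomputable def vecWeight (v : ℕ → ℕ) : W :=
  if h : ∃ a, Pl.Rep D T Pl.m v a then Pl.answerWeight T h.choose else 1

variable {Pl D T}

theorem vecWeight_eq {v : ℕ → ℕ} {a : ℕ → Word α} (h : Pl.Rep D T Pl.m v a) :
    vecWeight Pl D T v = Pl.answerWeight T a := by
  have h' : ∃ a, Pl.Rep D T Pl.m v a := ⟨a, h⟩
  rw [vecWeight, dif_pos h']
  exact Plan.answerWeight_congr (h'.choose_spec.eq_on Pl.m_le h)

theorem Valid.pos {v : ℕ → ℕ} (h : Valid Pl D T v) (i : ℕ) : 1 ≤ v i := by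
  obtain ⟨⟨a, ha⟩, h2⟩ := h
  rcases lt_or_ge i Pl.m with hi | hi
  · exact (ha i hi).1
  · rw [h2 i hi]

theorem Valid.ne_one_lt {v : ℕ → ℕ} (h : Valid Pl D T v) {i : ℕ} (hi : v i ≠ 1) : i < Pl.m := by
  by_contra hlt
  exact hi (h.tail i (by omega))

/-- A vector other than the root is a child of a vector of smaller or equal weight. -/
theorem Valid.exists_parent (hT : Pl.TablesOK D T) {v : ℕ → ℕ} (h : Valid Pl D T v)
    (hr : v ≠ fun _ => 1) : ∃ u i b, i < Pl.m ∧ b < 2 ∧ Legal u i ∧ v = childVec u i b ∧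
      Valid Pl D T u ∧ DLe (vecWeight Pl D T u) (vecWeight Pl D T v) ∧ u i < v i := by
  have hex : ∃ i, v i ≠ 1 := by
    by_contra hne
    push Not at hne
    exact hr (funext hne)
  -- The parent is obtained by halving the last coordinate that is not `1`; only then do all later
  -- nodes sit at their optimum, as `Rep.halve` requires.
  obtain ⟨i, hi, hmax⟩ : ∃ i, v i ≠ 1 ∧ ∀ j, i < j → v j = 1 := by
    classical
    obtain ⟨i₀, hi₀⟩ := hex
    let S := (Finset.range Pl.m).filter fun i => v i ≠ 1
    have hS : S.Nonempty := ⟨i₀, by simp [S, hi₀, h.ne_one_lt hi₀]⟩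
    refine ⟨S.max' hS, ?_, fun j hj => ?_⟩
    · exact (Finset.mem_filter.1 (S.max'_mem hS)).2
    · by_contra hne
      have := S.le_max' j (by simp [S, hne, h.ne_one_lt hne])
      omega
  have him := h.ne_one_lt hi
  have hpos := h.pos i
  obtain ⟨a, ha⟩ := h.rep
  obtain ⟨a', ha', hle⟩ := ha.halve hT him (by omega) fun j hj _ => hmax j hj
  refine ⟨Function.update v i (v i / 2), i, v i % 2, him, Nat.mod_lt _ (by omega),
    fun j hj => ?_, ?_, ⟨⟨a', ha'⟩, fun j hj => ?_⟩, ?_, ?_⟩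
  · rw [Function.update_of_ne (by omega), hmax j hj]
  · funext j
    by_cases hj : j = i
    · subst hj
      rw [childVec_self, Function.update_self]
      omega
    · rw [childVec_of_ne hj, Function.update_of_ne hj]
  · rw [Function.update_of_ne (by omega), h.tail j hj]
  · rw [vecWeight_eq ha, vecWeight_eq ha']
    exact hle
  · rw [Function.update_self]
    omega

/-- The vector `v` is the only parent of its child, so it is the one that `exists_parent` provides.
-/
theorem Valid.le_child (hT : Pl.TablesOK D T) {v : ℕ → ℕ} {i b : ℕ} (hb : b < 2) (hv : 1 ≤ v i)
    (hl : Legal v i) (h : Valid Pl D T (childVec v i b)) :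
    DLe (vecWeight Pl D T v) (vecWeight Pl D T (childVec v i b)) := by
  obtain ⟨u, i', b', -, hb', hl', e, hu, hle, -⟩ := h.exists_parent hT (childVec_ne_root hv)
  obtain ⟨rfl, -, -⟩ := childVec_inj hb hb' hv (hu.pos i') hl hl' e
  exact hle

/-- A set of vectors that is closed under valid children contains all valid vectors. -/
theorem Valid.mem_of_closed (hT : Pl.TablesOK D T) {S : Set (ℕ → ℕ)}
    (hroot : Valid Pl D T (fun _ => 1) → (fun _ => 1) ∈ S)
    (hclosed : ∀ v ∈ S, ∀ i < Pl.m, ∀ b < 2, Legal v i → Valid Pl D T (childVec v i b) →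
      childVec v i b ∈ S) {v : ℕ → ℕ} (h : Valid Pl D T v) : v ∈ S := by
  -- The sum of the coordinates decreases from a vector to its parent.
  obtain ⟨n, hn⟩ : ∃ n, ∑ j ∈ Finset.range Pl.m, v j = n := ⟨_, rfl⟩
  induction n using Nat.strong_induction_on generalizing v with
  | _ n ih =>
    by_cases hr : v = fun _ => 1
    · rw [hr] at h ⊢
      exact hroot h
    · obtain ⟨u, i, b, hi, hb, hl, rfl, hu, -, hlt⟩ := h.exists_parent hT hr
      refine hclosed u (ih _ ?_ hu rfl) i hi b hb hl h
      rw [← hn]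
      refine Finset.sum_lt_sum (fun j _ => ?_) ⟨i, Finset.mem_range.2 hi, hlt⟩
      by_cases hj : j = i
      · rw [hj]; exact hlt.le
      · rw [childVec_of_ne hj]

/-- Positions are bounded by group sizes, hence by `D.n`. The number of valid vectors bounds the
number of rounds of the main loop. -/
theorem finite_valid (hT : Pl.TablesOK D T) : {v | Valid Pl D T v}.Finite := by
  have hm := Pl.m_le
  let B := D.n + 1
  refine (Set.finite_range fun (g : Fin Pl.m → Fin B) (j : ℕ) =>
    if h : j < Pl.m then (g ⟨j, h⟩ : ℕ) else 1).subset ?_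
  rintro v ⟨⟨a, ha⟩, h2⟩
  have hlt : ∀ j < Pl.m, v j < B := fun j hj => by
    have h3 := (hT.node j (by omega)).sum_cnt_le (by omega) {(Pl.K j).map a}
    rw [Finset.sum_singleton] at h3
    have h4 := (ha j hj).2.1
    have h6 : D.size (Pl.rel j) ≤ D.n :=
      Finset.le_sup (f := fun i : Fin Q.numAtoms => D.size (Q.rel i)) (Finset.mem_univ _)
    simp only [B]
    omega
  refine ⟨fun j => ⟨v j, hlt j j.2⟩, funext fun j => ?_⟩
  by_cases hj : j < Pl.m
  · simp [hj]
  · simp [hj, h2 j (by omega)]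

end Vectors

/-! ### The priority queue -/

section Queue

variable {α : Type u} {W : Type v} [CommSemiring W]

/-- Load the position vector of the entry `cid`. -/
def loadPos (m : ℕ) : Cmd := seqs ((List.range m).map fun i =>
  .seq (.prim (.const (.sc .t) i)) (.prim (.load (.pos i) .pv [.sc .cid, .sc .t])))

/-- Store the position vector in the entry `next`. -/
def storePos (m : ℕ) : Cmd := seqs ((List.range m).map fun i =>
  .seq (.prim (.const (.sc .t) i)) (.prim (.store .pv [.sc .next, .sc .t] (.pos i))))

/-- Add the position vector to the queue. -/
def push (m : ℕ) : Cmd := seqs [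
  storePos m,
  .prim (.wstore .pw [.sc .next] 0),
  .prim (.add (.sc .hs) (.sc .hs) (.sc .one)),
  .prim (.store .pq [.sc .hs] (.sc .next)),
  .prim (.add (.sc .next) (.sc .next) (.sc .one)),
  .prim (.move (.sc .cur) (.sc .hs)),
  siftUp .pq .pw]

/-- Remove an entry of minimum weight from the queue. -/
def pop : Cmd := seqs [
  .prim (.load (.sc .cid) .pq [.sc .one]),
  .prim (.load (.sc .ia) .pq [.sc .hs]),
  .prim (.store .pq [.sc .one] (.sc .ia)),
  .prim (.sub (.sc .hs) (.sc .hs) (.sc .one)),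
  .prim (.move (.sc .n) (.sc .hs)),
  .prim (.move (.sc .cur) (.sc .one)),
  siftDown .pq .pw []]

/-- The queue holds the entries in `F`; the entries below `nx` have been created, and the entry
`id` stands for the position vector `vec id`. -/
structure QueueAt (m : ℕ) (ω : (ℕ → ℕ) → W) (vec : ℕ → ℕ → ℕ) (nx : ℕ) (F : Set ℕ)
    (s : St α W) : Prop where
  next : s.reg (.sc .next) = .num nx
  pv : ∀ id < nx, ∀ i < m, s.arr .pv [.num id, .num i] = .num (vec id i)
  pw : ∀ id < nx, s.warr .pw [.num id] = ω (vec id)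
  lt : ∀ id ∈ F, id < nx
  heap : ∃ n f, s.reg (.sc .hs) = .num n ∧
    (∀ p, 1 ≤ p → p ≤ n → s.arr .pq [.num p] = .num (f p)) ∧
    HeapFrom 1 n (fun p => ω (vec (f p))) ∧ Set.InjOn f (Set.Icc 1 n) ∧ f '' Set.Icc 1 n = F

theorem QueueAt.congr {m : ℕ} {ω : (ℕ → ℕ) → W} {vec : ℕ → ℕ → ℕ} {nx : ℕ} {F : Set ℕ}
    {s s' : St α W} (h : QueueAt m ω vec nx F s) (h1 : s'.arr = s.arr) (h2 : s'.warr = s.warr)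
    (h3 : s'.reg (.sc .next) = s.reg (.sc .next)) (h4 : s'.reg (.sc .hs) = s.reg (.sc .hs)) :
    QueueAt m ω vec nx F s' :=
  ⟨h3.trans h.next, by rw [h1]; exact h.pv, by rw [h2]; exact h.pw, h.lt, by
    rw [h1, h4]; exact h.heap⟩

theorem Shuffle.image_eq {n : ℕ} {f f' : ℕ → ℕ} (h : Shuffle n f f') :
    f' '' Set.Icc 1 n = f '' Set.Icc 1 n := by
  ext x
  constructor
  · rintro ⟨p, hp, rfl⟩
    obtain ⟨q, hq, e⟩ := h.exists_pos' hp
    exact ⟨q, hq, e.symm⟩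
  · rintro ⟨p, hp, rfl⟩
    obtain ⟨q, hq, e⟩ := h.exists_pos hp
    exact ⟨q, hq, e⟩

/-- The queue holds distinct entries, so its size is at most the number of entries created so far;
this bounds the time of a queue operation. -/
theorem card_le_of_image {n nx : ℕ} {f : ℕ → ℕ} (hf : Set.InjOn f (Set.Icc 1 n))
    (h : ∀ id ∈ f '' Set.Icc 1 n, id < nx) : n ≤ nx := by
  have := Finset.card_le_card_of_injOn (s := Finset.Icc 1 n) (t := Finset.range nx) f
    (fun p hp => by
      have := h (f p) ⟨p, by simpa using hp, rfl⟩
      simpa using this) (by simpa using hf)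
  simpa using this

theorem loadPos_spec {m : ℕ} {s : St α W} {id : ℕ} (hc : s.reg (.sc .cid) = .num id) :
    (loadPos m).wp (fun s' => ∀ i < m, s'.reg (.pos i) = s.arr .pv [.num id, .num i]) s := by
  suffices ∀ l : List ℕ, ∀ s : St α W, s.reg (.sc .cid) = .num id →
      (seqs (l.map fun i => .seq (.prim (.const (.sc .t) i))
        (.prim (.load (.pos i) .pv [.sc .cid, .sc .t])))).wp (fun s' =>
        (∀ i ∈ l, s'.reg (.pos i) = s.arr .pv [.num id, .num i]) ∧
          ∀ i, i ∉ l → s'.reg (.pos i) = s.reg (.pos i)) s from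
    Cmd.wp_mono _ (this (List.range m) s hc) fun s' h i hi => h.1 i (List.mem_range.2 hi)
  intro l
  induction l with
  | nil => intro s _; simp [seqs, Cmd.wp]
  | cons i l ih =>
    intro s hc
    simp only [List.map_cons, seqs, Cmd.wp]
    refine Cmd.wp_mono _ (ih _ (by simp [Prim.app, hc])) fun s' ⟨h1, h2⟩ => ⟨fun j hj => ?_,
      fun j hj => ?_⟩
    · by_cases hjl : j ∈ l
      · rw [h1 j hjl]
        simp [Prim.app]
      · obtain rfl : j = i := (List.mem_cons.1 hj).resolve_right hjl
        rw [h2 j hjl]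
        simp [Prim.app, hc]
    · simp only [List.mem_cons, not_or] at hj
      rw [h2 j hj.2]
      simp [Prim.app, hj.1]

theorem storePos_spec {m : ℕ} {s : St α W} {id : ℕ} (hc : s.reg (.sc .next) = .num id) :
    (storePos m).wp (fun s' => (∀ i < m, s'.arr .pv [.num id, .num i] = s.reg (.pos i)) ∧
      ∀ id' i, id' ≠ id → s'.arr .pv [.num id', .num i] = s.arr .pv [.num id', .num i]) s := by
  suffices ∀ l : List ℕ, ∀ s : St α W, s.reg (.sc .next) = .num id →
      (seqs (l.map fun i => .seq (.prim (.const (.sc .t) i))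
        (.prim (.store .pv [.sc .next, .sc .t] (.pos i))))).wp (fun s' =>
        (∀ i ∈ l, s'.arr .pv [.num id, .num i] = s.reg (.pos i)) ∧
        (∀ i, i ∉ l → s'.arr .pv [.num id, .num i] = s.arr .pv [.num id, .num i]) ∧
          ∀ id' i, id' ≠ id →
            s'.arr .pv [.num id', .num i] = s.arr .pv [.num id', .num i]) s from
    Cmd.wp_mono _ (this (List.range m) s hc) fun s' h =>
      ⟨fun i hi => h.1 i (List.mem_range.2 hi), h.2.2⟩
  intro l
  induction l with
  | nil => intro s _; simp [seqs, Cmd.wp]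
  | cons i l ih =>
    intro s hc
    simp only [List.map_cons, seqs, Cmd.wp]
    refine Cmd.wp_mono _ (ih _ (by simp [Prim.app, hc])) fun s' ⟨h1, h2, h3⟩ =>
      ⟨fun j hj => ?_, fun j hj => ?_, fun id' j hid => ?_⟩
    · by_cases hjl : j ∈ l
      · rw [h1 j hjl]
        simp [Prim.app]
      · obtain rfl : j = i := (List.mem_cons.1 hj).resolve_right hjl
        rw [h2 j hjl]
        simp [Prim.app, hc]
    · simp only [List.mem_cons, not_or] at hj
      rw [h2 j hj.2]
      simp [Prim.app, hj.1]
    · rw [h3 id' j hid]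
      simp [Prim.app, hc, hid]

theorem storePos_wr {m : ℕ} {r : Reg} (h : r ≠ .sc .t) : r ∉ (storePos m).collect Prim.wr := by
  simp [storePos, Cmd.mem_collect_seqs, Cmd.collect, Prim.wr, h]

theorem storePos_loopFree {m : ℕ} : (storePos m).loopFree := by
  simp [storePos, Cmd.loopFree_seqs, Cmd.loopFree]

theorem push_spec (hW : IsSelective W) {m : ℕ} {ω : (ℕ → ℕ) → W} {vec : ℕ → ℕ → ℕ} {nx : ℕ}
    {F : Set ℕ} {s : St α W} {v : ℕ → ℕ} (h : QueueAt m ω vec nx F s)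
    (hone : s.reg (.sc .one) = .num 1) (hv : ∀ i < m, s.reg (.pos i) = .num (v i))
    (hw : s.wreg 0 = ω v) :
    (push m).wp (fun s' => QueueAt m ω (Function.update vec nx v) (nx + 1) (insert nx F) s' ∧
      s'.clock ≤ s.clock + ((storePos m).cost + 10) + siftStep * Nat.log 2 (nx + 1)) s := by
  obtain ⟨hnx, hpv, hpw, hlt, n, f, hn, hf, hheap, hinj, himg⟩ := h
  have hnle : n ≤ nx := card_le_of_image hinj (by rw [himg]; exact hlt)
  have hfnx : ∀ p, 1 ≤ p → p ≤ n → f p < nx := fun p h1 h2 => hlt _ (himg ▸ ⟨p, ⟨h1, h2⟩, rfl⟩)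
  set vec' := Function.update vec nx v with hvec'
  have hvec : ∀ id, id ≠ nx → vec' id = vec id := fun id hid => Function.update_of_ne hid ..
  have hvnx : vec' nx = v := Function.update_self ..
  rw [push, seqs, Cmd.wp]
  refine Cmd.wp_use_cost storePos_loopFree (storePos_spec hnx) fun s₁ ⟨h1, h2⟩ hfr₁ hclk₁ => ?_
  have hreg : ∀ r, r ≠ .sc .t → s₁.reg r = s.reg r := fun r hr => hfr₁.reg r (storePos_wr hr)
  have hwreg : s₁.wreg 0 = s.wreg 0 := hfr₁.wreg _ (by
    simp [storePos, Cmd.mem_collect_seqs, Cmd.collect, Prim.wwr])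
  have hpq : s₁.arr .pq = s.arr .pq := hfr₁.arr _ (by
    simp [storePos, Cmd.mem_collect_seqs, Cmd.collect, Prim.wt])
  have hwarr : s₁.warr = s.warr := hfr₁.warr_eq (by
    simp [storePos, Cmd.mem_collect_seqs, Cmd.collect, Prim.wwt])
  have hnx₁ := (hreg (.sc .next) (by simp)).trans hnx
  have hone₁ := (hreg (.sc .one) (by simp)).trans hone
  have hn₁ := (hreg (.sc .hs) (by simp)).trans hn
  clear hfr₁
  simp only [seqs, Cmd.wp]
  set s₂ := Prim.app (.move (.sc .cur) (.sc .hs)) (Prim.app (.add (.sc .next) (.sc .next) (.sc .one))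
    (Prim.app (.store .pq [.sc .hs] (.sc .next)) (Prim.app (.add (.sc .hs) (.sc .hs) (.sc .one))
    (Prim.app (.wstore .pw [.sc .next] 0) s₁)))) with hs₂
  have hnx₂ : s₂.reg (.sc .next) = .num (nx + 1) := by simp [hs₂, Prim.app, hnx₁, hone₁]
  have hone₂ : s₂.reg (.sc .one) = .num 1 := by simp [hs₂, Prim.app, hone₁]
  have hn₂ : s₂.reg (.sc .hs) = .num (n + 1) := by simp [hs₂, Prim.app, hn₁, hone₁]
  have hcur₂ : s₂.reg (.sc .cur) = .num (n + 1) := by simp [hs₂, Prim.app, hn₁, hone₁]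
  have hpv₂ : s₂.arr .pv = s₁.arr .pv := by simp [hs₂, Prim.app]
  have hpw₂ : ∀ id < nx + 1, s₂.warr .pw [.num id] = ω (vec' id) := by
    intro id hid
    by_cases e : id = nx
    · subst e
      rw [hvnx, ← hw, ← hwreg]
      simp [hs₂, Prim.app, hnx₁]
    · rw [hvec id e, ← hpw id (by omega)]
      simp [hs₂, Prim.app, hnx₁, e, hwarr]
  have hpq₂ : ∀ p, 1 ≤ p → p ≤ n + 1 →
      s₂.arr .pq [.num p] = .num (Function.update f (n + 1) nx p) := by
    intro p hp hp'
    by_cases e : p = n + 1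
    · subst e
      simp [hs₂, Prim.app, hn₁, hone₁, hnx₁]
    · rw [Function.update_of_ne e, ← hf p hp (by omega)]
      simp [hs₂, Prim.app, hn₁, hone₁, e, hpq]
  have hclk₂ : s₂.clock = s₁.clock + 5 := rfl
  clear_value s₂
  have hidw : ∀ p, 1 ≤ p → p ≤ n + 1 → s₂.idw .pw (Function.update f (n + 1) nx p) =
      ω (vec' (Function.update f (n + 1) nx p)) := by
    intro p hp hp'
    refine hpw₂ _ ?_
    by_cases e : p = n + 1
    · rw [e, Function.update_self]; omega
    · rw [Function.update_of_ne e]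
      have := hfnx p hp (by omega)
      omega
  -- The new entry at the end is the only possible violation of the heap order.
  have hup : UpInv (n + 1) (n + 1) fun p => s₂.idw .pw (Function.update f (n + 1) nx p) := by
    constructor
    · intro c hc hc' hne
      have e1 := hfnx (c / 2) (by omega) (by omega)
      have e2 := hfnx c (by omega) (by omega)
      rw [hidw _ (by omega) (by omega), hidw _ (by omega) (by omega),
        Function.update_of_ne (by omega), Function.update_of_ne (by omega), hvec _ (by omega),
        hvec _ (by omega)]
      exact hheap c hc (by omega) (by omega)
    · intro c hc hc' he
      omega
  refine Cmd.wp_use (siftUp_spec hW hone₂ hcur₂ (by omega) le_rfl hpq₂ hup) ?_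
  rintro s₃ ⟨f', hsh, hf', hheap', hclk₃⟩ hfr₃
  have hinj' : Set.InjOn (Function.update f (n + 1) nx) (Set.Icc 1 (n + 1)) := by
    intro p hp q hq e
    simp only [Set.mem_Icc] at hp hq
    by_cases h1 : p = n + 1 <;> by_cases h2 : q = n + 1
    · omega
    · rw [h1, Function.update_self, Function.update_of_ne h2] at e
      have := hfnx q hq.1 (by omega)
      omega
    · rw [h2, Function.update_self, Function.update_of_ne h1] at e
      have := hfnx p hp.1 (by omega)
      omega
    · rw [Function.update_of_ne h1, Function.update_of_ne h2] at e
      exact hinj ⟨hp.1, by omega⟩ ⟨hq.1, by omega⟩ e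
  have himg' : Function.update f (n + 1) nx '' Set.Icc 1 (n + 1) = insert nx F := by
    ext x
    simp only [Set.mem_image, Set.mem_Icc, Set.mem_insert_iff]
    constructor
    · rintro ⟨p, hp, rfl⟩
      by_cases e : p = n + 1
      · exact .inl (by rw [e, Function.update_self])
      · rw [Function.update_of_ne e]
        exact .inr (himg ▸ ⟨p, ⟨hp.1, by omega⟩, rfl⟩)
    · rintro (rfl | hx)
      · exact ⟨n + 1, ⟨by omega, le_rfl⟩, Function.update_self ..⟩
      · rw [← himg] at hx
        obtain ⟨p, hp, rfl⟩ := hx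
        exact ⟨p, ⟨hp.1, by have := hp.2; omega⟩, Function.update_of_ne (by have := hp.2; omega) ..⟩
  refine ⟨⟨?_, ?_, ?_, ?_, n + 1, f', ?_, hf', ?_, hsh.injOn hinj', by rw [hsh.image_eq, himg']⟩, ?_⟩
  · rw [hfr₃.reg _ (by simp [siftUp, siftUpBody, seqs, Cmd.collect, Prim.wr]), hnx₂]
  · intro id hid i hi
    rw [hfr₃.arr _ (by simp [siftUp, siftUpBody, seqs, Cmd.collect, Prim.wt]), hpv₂]
    by_cases e : id = nx
    · subst e
      rw [h1 i hi, hvnx, hv i hi]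
    · rw [h2 id i e, hvec id e, hpv id (by omega) i hi]
  · intro id hid
    rw [hfr₃.warr _ (by simp [siftUp, siftUpBody, seqs, Cmd.collect, Prim.wwt])]
    exact hpw₂ id hid
  · rintro id (rfl | hid)
    · omega
    · exact (hlt id hid).trans (Nat.lt_succ_self _)
  · rw [hfr₃.reg _ (by simp [siftUp, siftUpBody, seqs, Cmd.collect, Prim.wr]), hn₂]
  · have h' : ∀ p, 1 ≤ p → p ≤ n + 1 → s₂.idw .pw (f' p) = ω (vec' (f' p)) := by
      intro p hp hp'
      obtain ⟨q, hq, e⟩ := hsh.exists_pos' ⟨hp, hp'⟩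
      rw [e]
      exact hidw q hq.1 hq.2
    intro c hc hc' hlo
    have := hheap' c hc hc' hlo
    simp only at this ⊢
    rwa [h' _ (by omega) (by omega), h' _ (by omega) (by omega)] at this
  · have := Nat.mul_le_mul_left siftStep (Nat.log_mono_right (b := 2) (show n + 1 ≤ nx + 1 by omega))
    omega

theorem pop_spec (hW : IsSelective W) {m : ℕ} {ω : (ℕ → ℕ) → W} {vec : ℕ → ℕ → ℕ} {nx : ℕ}
    {F : Set ℕ} {s : St α W} (h : QueueAt m ω vec nx F s)
    (hone : s.reg (.sc .one) = .num 1) (hne : s.reg (.sc .hs) ≠ .num 0) :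
    pop.wp (fun s' => ∃ id ∈ F, s'.reg (.sc .cid) = .num id ∧
      (∀ id' ∈ F, DLe (ω (vec id)) (ω (vec id'))) ∧
      QueueAt m ω vec nx (F \ {id}) s' ∧
      s'.clock ≤ s.clock + 10 + siftStep * Nat.log 2 nx) s := by
  obtain ⟨hnx, hpv, hpw, hlt, n, f, hn, hf, hheap, hinj, himg⟩ := h
  have hn1 : 1 ≤ n := by
    rw [hn] at hne
    by_contra h0
    exact hne (by rw [show n = 0 by omega])
  have hnle : n ≤ nx := card_le_of_image hinj (by rw [himg]; exact hlt)
  have hfnx : ∀ p, 1 ≤ p → p ≤ n → f p < nx := fun p h1 h2 => hlt _ (himg ▸ ⟨p, ⟨h1, h2⟩, rfl⟩)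
  simp only [pop, seqs, Cmd.wp]
  set s₂ := Prim.app (.move (.sc .cur) (.sc .one)) (Prim.app (.move (.sc .n) (.sc .hs))
    (Prim.app (.sub (.sc .hs) (.sc .hs) (.sc .one)) (Prim.app (.store .pq [.sc .one] (.sc .ia))
    (Prim.app (.load (.sc .ia) .pq [.sc .hs])
    (Prim.app (.load (.sc .cid) .pq [.sc .one]) s))))) with hs₂
  have hnx₂ : s₂.reg (.sc .next) = .num nx := by simp [hs₂, Prim.app, hnx]
  have hone₂ : s₂.reg (.sc .one) = .num 1 := by simp [hs₂, Prim.app, hone]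
  have hhs₂ : s₂.reg (.sc .hs) = .num (n - 1) := by simp [hs₂, Prim.app, hn, hone]
  have hn₂ : s₂.reg (.sc .n) = .num (n - 1) := by simp [hs₂, Prim.app, hn, hone]
  have hcur₂ : s₂.reg (.sc .cur) = .num 1 := by simp [hs₂, Prim.app, hone]
  have hcid₂ : s₂.reg (.sc .cid) = .num (f 1) := by
    simp [hs₂, Prim.app, hone, hf 1 le_rfl hn1]
  have hpv₂ : s₂.arr .pv = s.arr .pv := by simp [hs₂, Prim.app]
  have hpw₂ : s₂.warr .pw = s.warr .pw := by simp [hs₂, Prim.app]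
  have hpq₂ : ∀ p, 1 ≤ p → p ≤ n - 1 →
      s₂.arr .pq [.num p] = .num (Function.update f 1 (f n) p) := by
    intro p hp hp'
    by_cases e : p = 1
    · subst e
      simp [hs₂, Prim.app, hn, hone, hf n hn1 le_rfl]
    · rw [Function.update_of_ne e, ← hf p hp (by omega)]
      simp [hs₂, Prim.app, hone, e]
  have hclk₂ : s₂.clock = s.clock + 6 := rfl
  clear_value s₂
  -- The last entry moves to the root. If it is the root itself, the remaining range of positions is
  -- empty and the value does not matter.
  set g := Function.update f 1 (f n) with hg
  have hg1 : g 1 = f n := Function.update_self ..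
  have hgp : ∀ p, p ≠ 1 → g p = f p := fun p hp => Function.update_of_ne hp ..
  have hgnx : ∀ p, 1 ≤ p → p ≤ n - 1 → g p < nx := by
    intro p hp hp'
    by_cases e : p = 1
    · rw [e, hg1]; exact hfnx n hn1 le_rfl
    · rw [hgp p e]; exact hfnx p hp (by omega)
  have hidw : ∀ id < nx, s₂.idw .pw id = ω (vec id) := by
    intro id hid
    rw [St.idw, hpw₂, hpw id hid]
  have hdown : DownInv 1 (n - 1) 1 fun p => s₂.idw .pw (g p) := by
    constructor
    · intro c hc hc' hlo hne
      rw [hidw _ (hgnx _ (by omega) (by omega)), hidw _ (hgnx _ (by omega) (by omega)),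
        hgp _ hne, hgp c (by omega)]
      exact hheap c hc (by omega) hlo
    · intro c _ _ _ h0
      omega
  refine Cmd.wp_use (siftDown_spec (xs := []) hW hone₂ hn₂ hcur₂ le_rfl le_rfl hpq₂ hdown) ?_
  rintro s₃ ⟨f', hsh, hf', hheap', -, hclk₃⟩ hfr₃
  have hwr : ∀ a : Sc, a ≠ .ch → a ≠ .ch1 → a ≠ .ia → a ≠ .ib → a ≠ .ic → a ≠ .cur →
      s₃.reg (.sc a) = s₂.reg (.sc a) := fun a _ _ _ _ _ _ => hfr₃.reg _ (by
    simp [siftDown, pickChild, exchangeChild, seqs, Cmd.collect, Prim.wr, *])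
  have hinj' : Set.InjOn g (Set.Icc 1 (n - 1)) := by
    intro p hp q hq e
    simp only [Set.mem_Icc] at hp hq
    have hgi : ∀ p, g p = f (if p = 1 then n else p) := fun p => by
      split_ifs with h
      · rw [h, hg1]
      · rw [hgp p h]
    rw [hgi, hgi] at e
    have := hinj (by split_ifs <;> constructor <;> omega) (by split_ifs <;> constructor <;> omega) e
    split_ifs at this <;> omega
  have himg' : g '' Set.Icc 1 (n - 1) = F \ {f 1} := by
    rw [← himg]
    ext x
    simp only [Set.mem_image, Set.mem_Icc, Set.mem_sdiff, Set.mem_singleton_iff]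
    constructor
    · rintro ⟨p, hp, rfl⟩
      by_cases e : p = 1
      · subst e
        rw [hg1]
        refine ⟨⟨n, ⟨hn1, le_rfl⟩, rfl⟩, fun e => ?_⟩
        have := hinj (x₁ := n) (x₂ := 1) ⟨hn1, le_rfl⟩ ⟨le_rfl, hn1⟩ e
        omega
      · rw [hgp p e]
        refine ⟨⟨p, ⟨hp.1, by omega⟩, rfl⟩, fun e' => ?_⟩
        exact e (hinj (x₁ := p) (x₂ := 1) ⟨hp.1, by omega⟩ ⟨le_rfl, hn1⟩ e')
    · rintro ⟨⟨p, hp, rfl⟩, hne⟩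
      have hp1 : p ≠ 1 := by rintro rfl; exact hne rfl
      by_cases e : p = n
      · exact ⟨1, ⟨le_rfl, by omega⟩, by rw [hg1, e]⟩
      · exact ⟨p, ⟨hp.1, by omega⟩, hgp p hp1⟩
  have hroot := hheap.root_le hW
  refine ⟨f 1, himg ▸ ⟨1, ⟨le_rfl, hn1⟩, rfl⟩, ?_, ?_, ⟨?_, ?_, ?_, ?_, n - 1, f', ?_, hf', ?_,
    hsh.injOn hinj', by rw [hsh.image_eq, himg']⟩, ?_⟩
  · rw [hwr _ (by simp) (by simp) (by simp) (by simp) (by simp) (by simp), hcid₂]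
  · intro id' hid'
    rw [← himg] at hid'
    obtain ⟨p, hp, rfl⟩ := hid'
    exact hroot p hp.1 hp.2
  · rw [hwr _ (by simp) (by simp) (by simp) (by simp) (by simp) (by simp), hnx₂]
  · rw [hfr₃.arr _ (by simp [siftDown, pickChild, exchangeChild, seqs, Cmd.collect, Prim.wt]), hpv₂]
    exact hpv
  · rw [hfr₃.warr _ (by simp [siftDown, pickChild, exchangeChild, seqs, Cmd.collect, Prim.wwt]),
      hpw₂]
    exact hpw
  · exact fun id hid => hlt id hid.1
  · rw [hwr _ (by simp) (by simp) (by simp) (by simp) (by simp) (by simp), hhs₂]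
  · have h' : ∀ p, 1 ≤ p → p ≤ n - 1 → s₂.idw .pw (f' p) = ω (vec (f' p)) := by
      intro p hp hp'
      obtain ⟨q, hq, e⟩ := hsh.exists_pos' ⟨hp, hp'⟩
      rw [e]
      exact hidw _ (hgnx q hq.1 hq.2)
    intro c hc hc' hlo
    have := hheap' c hc hc' hlo
    simp only at this ⊢
    rwa [h' _ (by omega) (by omega), h' _ (by omega) (by omega)] at this
  · have := Nat.mul_le_mul_left siftStep
      (Nat.log_mono_right (b := 2) (show (n - 1) / 1 ≤ nx by omega))
    omega

end Queue

/-! ### Best-first search -/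

section Search

variable {Q : CQ} {α : Type u} {W : Type v} [CommSemiring W]

/-- All pairs of a coordinate of the head and a bit. -/
def allPairs (m : ℕ) : List (ℕ × ℕ) := List.range m ×ˢ [0, 1]

theorem mem_allPairs {m : ℕ} {q : ℕ × ℕ} : q ∈ allPairs m ↔ q.1 < m ∧ q.2 < 2 := by
  obtain ⟨i, b⟩ := q
  rw [allPairs, List.mem_product]
  simp only [List.mem_range, List.mem_cons, List.not_mem_nil, or_false]
  omega

theorem nodup_allPairs (m : ℕ) : (allPairs m).Nodup := List.nodup_range.product (by simp)

theorem length_allPairs (m : ℕ) : (allPairs m).length = 2 * m := by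
  rw [allPairs, List.length_product]
  simp [mul_comm]

/-- The invariant of the search. The entries `pl` have been removed from the queue in this order,
and the children `todo` of the entry `cid` have not been considered yet. -/
structure SearchInv (D : Database Q α W) (Pl : Plan Q) (T : Tables α W) (todo : List (ℕ × ℕ))
    (pl : List ℕ) (cid : ℕ) (vec : ℕ → ℕ → ℕ) (nx : ℕ) : Prop where
  inj : ∀ id < nx, ∀ id' < nx, vec id = vec id' → id = id'
  valid : ∀ id < nx, Valid Pl D T (vec id)
  lt : ∀ id ∈ pl, id < nx
  nodup : pl.Nodup
  root : Valid Pl D T (fun _ => 1) → ∃ id < nx, vec id = fun _ => 1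
  origin : ∀ id < nx, vec id ≠ (fun _ => 1) → ∃ id' ∈ pl, ∃ i b, b < 2 ∧ Legal (vec id') i ∧
    vec id = childVec (vec id') i b ∧ (id' = cid → (i, b) ∉ todo)
  closed : ∀ id' ∈ pl, ∀ i < Pl.m, ∀ b < 2, Legal (vec id') i →
    Valid Pl D T (childVec (vec id') i b) →
    (∃ id < nx, vec id = childVec (vec id') i b) ∨ (id' = cid ∧ (i, b) ∈ todo)
  sorted : pl.Pairwise fun id id' =>
    DLe (vecWeight Pl D T (vec id)) (vecWeight Pl D T (vec id'))
  front : ∀ id ∈ pl, ∀ id' < nx, id' ∉ pl →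
    DLe (vecWeight Pl D T (vec id)) (vecWeight Pl D T (vec id'))
  bound : nx + todo.length ≤ 1 + 2 * Pl.m * pl.length
  last : todo ≠ [] → cid ∈ pl ∧ ∀ id ∈ pl,
    DLe (vecWeight Pl D T (vec id)) (vecWeight Pl D T (vec cid))

variable {Pl : Plan Q} {D : Database Q α W} {T : Tables α W}
  {todo : List (ℕ × ℕ)} {pl : List ℕ} {cid nx : ℕ} {vec : ℕ → ℕ → ℕ}

/-- By `front`, the minimum of the queue is at least as heavy as everything popped before. All `2 *
m` candidates for its children become due, which is what `bound` allows per popped entry. -/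
theorem SearchInv.select (h : SearchInv D Pl T [] pl cid vec nx) (hW : IsSelective W) {id : ℕ}
    (hid : id < nx) (hpl : id ∉ pl)
    (hmin : ∀ id' < nx, id' ∉ pl →
      DLe (vecWeight Pl D T (vec id)) (vecWeight Pl D T (vec id'))) :
    SearchInv D Pl T (allPairs Pl.m) (pl ++ [id]) id vec nx := by
  have hlast : ∀ id' ∈ pl ++ [id], DLe (vecWeight Pl D T (vec id')) (vecWeight Pl D T (vec id)) := by
    intro id' h'
    rcases List.mem_append.1 h' with h' | h'
    · exact h.front id' h' id hid hpl
    · rw [List.mem_singleton.1 h']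
      exact hW.refl _
  refine ⟨h.inj, h.valid, ?_, ?_, h.root, ?_, ?_, ?_, ?_, ?_, fun _ => ⟨by simp, hlast⟩⟩
  · intro id' h'
    rcases List.mem_append.1 h' with h' | h'
    · exact h.lt id' h'
    · rwa [List.mem_singleton.1 h']
  · rw [List.nodup_append]
    refine ⟨h.nodup, by simp, ?_⟩
    rintro a ha b hb rfl
    rw [List.mem_singleton.1 hb] at ha
    exact hpl ha
  · intro id₁ h1 h2
    obtain ⟨id', h3, i, b, h4, h5, h6, -⟩ := h.origin id₁ h1 h2
    exact ⟨id', List.mem_append_left _ h3, i, b, h4, h5, h6, fun e => absurd (e ▸ h3) hpl⟩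
  · intro id' h' i hi b hb hl hv
    rcases List.mem_append.1 h' with h' | h'
    · rcases h.closed id' h' i hi b hb hl hv with h1 | ⟨-, h1⟩
      · exact .inl h1
      · simp at h1
    · exact .inr ⟨List.mem_singleton.1 h', mem_allPairs.2 ⟨hi, hb⟩⟩
  · rw [List.pairwise_append]
    refine ⟨h.sorted, by simp, ?_⟩
    intro a ha b hb
    rw [List.mem_singleton.1 hb]
    exact hlast a (List.mem_append_left _ ha)
  · intro id₁ h1 id₂ h2 h3
    have h4 : id₂ ∉ pl := fun h => h3 (List.mem_append_left _ h)
    exact (hlast id₁ h1).trans (hmin id₂ h2 h4)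
  · have := h.bound
    rw [length_allPairs, List.length_append]
    simp only [List.length_nil, List.length_singleton] at this ⊢
    rw [mul_add]
    omega

theorem SearchInv.drop {i b : ℕ} (h : SearchInv D Pl T ((i, b) :: todo) pl cid vec nx)
    (hn : ¬ (Legal (vec cid) i ∧ Valid Pl D T (childVec (vec cid) i b))) :
    SearchInv D Pl T todo pl cid vec nx := by
  refine ⟨h.inj, h.valid, h.lt, h.nodup, h.root, ?_, ?_, h.sorted, h.front, ?_,
    fun _ => h.last (by simp)⟩
  · intro id₁ h1 h2
    obtain ⟨id', h3, i', b', h4, h5, h6, h7⟩ := h.origin id₁ h1 h2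
    exact ⟨id', h3, i', b', h4, h5, h6, fun e => fun h => h7 e (List.mem_cons_of_mem _ h)⟩
  · intro id' h' i' hi b' hb hl hv
    rcases h.closed id' h' i' hi b' hb hl hv with h1 | ⟨rfl, h1⟩
    · exact .inl h1
    · rcases List.mem_cons.1 h1 with h1 | h1
      · obtain ⟨rfl, rfl⟩ := Prod.mk.inj h1
        exact absurd ⟨hl, hv⟩ hn
      · exact .inr ⟨rfl, h1⟩
  · have := h.bound
    simp only [List.length_cons] at this
    omega

/-- If the child had been created before, unique parents would make its origin the same candidate,
which is still due. Its weight is at least that of `cid`, which by `last` is the largest weight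
popped so far, so the order of the output is safe. -/
theorem SearchInv.push {i b : ℕ} (h : SearchInv D Pl T ((i, b) :: todo) pl cid vec nx)
    (hT : Pl.TablesOK D T) (hnd : ((i, b) :: todo).Nodup) (hb : b < 2) (hl : Legal (vec cid) i)
    (hv : Valid Pl D T (childVec (vec cid) i b)) :
    SearchInv D Pl T todo pl cid (Function.update vec nx (childVec (vec cid) i b)) (nx + 1) := by
  obtain ⟨hcp, hlast⟩ := h.last (by simp)
  have hc := h.lt cid hcp
  have hpos := (h.valid cid hc).pos
  set u := childVec (vec cid) i b with hu
  have hold : ∀ id < nx, Function.update vec nx u id = vec id := fun id hid =>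
    Function.update_of_ne (by omega) ..
  have hnew : Function.update vec nx u nx = u := Function.update_self ..
  have hcases : ∀ id < nx + 1, id < nx ∨ id = nx := fun id hid => by omega
  have hfresh : ∀ id < nx, vec id ≠ u := by
    intro id hid e
    obtain ⟨id', h3, i', b', h4, h5, h6, h7⟩ := h.origin id hid
      (by rw [e]; exact childVec_ne_root (hpos i))
    rw [e] at h6
    obtain ⟨e1, rfl, rfl⟩ := childVec_inj hb h4 (hpos i) ((h.valid id' (h.lt id' h3)).pos _) hl h5 h6
    exact h7 (h.inj _ (h.lt id' h3) _ hc e1.symm) List.mem_cons_self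
  have hle : DLe (vecWeight Pl D T (vec cid)) (vecWeight Pl D T u) := hv.le_child hT hb (hpos i) hl
  refine ⟨?_, ?_, fun id hid => (h.lt id hid).trans (Nat.lt_succ_self _), h.nodup, ?_, ?_, ?_, ?_,
    ?_, ?_, fun _ => ⟨hcp, ?_⟩⟩
  · intro id h1 id' h2 e
    rcases hcases id h1 with h1 | rfl <;> rcases hcases id' h2 with h2 | rfl
    · rw [hold id h1, hold id' h2] at e
      exact h.inj id h1 id' h2 e
    · rw [hold id h1, hnew] at e
      exact absurd e (hfresh id h1)
    · rw [hold id' h2, hnew] at e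
      exact absurd e.symm (hfresh id' h2)
    · rfl
  · intro id h1
    rcases hcases id h1 with h1 | rfl
    · rw [hold id h1]; exact h.valid id h1
    · rw [hnew]; exact hv
  · intro hr
    obtain ⟨id, h1, h2⟩ := h.root hr
    exact ⟨id, by omega, by rw [hold id h1, h2]⟩
  · intro id h1 h2
    rcases hcases id h1 with h1 | rfl
    · rw [hold id h1] at h2 ⊢
      obtain ⟨id', h3, i', b', h4, h5, h6, h7⟩ := h.origin id h1 h2
      refine ⟨id', h3, i', b', h4, ?_, ?_, fun e => fun h => h7 e (List.mem_cons_of_mem _ h)⟩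
      · rw [hold id' (h.lt id' h3)]; exact h5
      · rw [hold id' (h.lt id' h3)]; exact h6
    · refine ⟨cid, hcp, i, b, hb, ?_, ?_, fun _ => (List.nodup_cons.1 hnd).1⟩
      · rw [hold cid hc]; exact hl
      · rw [hold cid hc, hnew]
  · intro id' h' i' hi b' hb' hl' hv'
    rw [hold id' (h.lt id' h')] at hl' hv' ⊢
    rcases h.closed id' h' i' hi b' hb' hl' hv' with ⟨id, h1, h2⟩ | ⟨rfl, h1⟩
    · exact .inl ⟨id, by omega, by rw [hold id h1, h2]⟩
    · rcases List.mem_cons.1 h1 with h1 | h1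
      · obtain ⟨rfl, rfl⟩ := Prod.mk.inj h1
        exact .inl ⟨nx, by omega, hnew⟩
      · exact .inr ⟨rfl, h1⟩
  · refine h.sorted.imp_of_mem fun {a b} ha hb hab => ?_
    rwa [hold a (h.lt a ha), hold b (h.lt b hb)]
  · intro id h1 id' h2 h3
    rw [hold id (h.lt id h1)]
    rcases hcases id' h2 with h2 | rfl
    · rw [hold id' h2]
      exact h.front id h1 id' h2 h3
    · rw [hnew]
      exact (hlast id h1).trans hle
  · have := h.bound
    simp only [List.length_cons] at this
    omega
  · intro id h1
    rw [hold id (h.lt id h1), hold cid hc]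
    exact hlast id h1

/-- Popped entries stand for distinct valid vectors; this yields termination. -/
theorem SearchInv.length_le (h : SearchInv D Pl T todo pl cid vec nx) (hT : Pl.TablesOK D T) :
    pl.length ≤ (finite_valid hT).toFinset.card := by
  classical
  rw [← List.toFinset_card_of_nodup h.nodup]
  refine Finset.card_le_card_of_injOn vec (fun id hid => ?_) fun id hid id' hid' e => ?_
  · simpa using h.valid id (h.lt id (by simpa using hid))
  · exact h.inj id (h.lt id (by simpa using hid)) id' (h.lt id' (by simpa using hid')) e

/-- With an empty queue and nothing due, the popped vectors contain the root, if it is valid, and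
are closed under valid children. -/
theorem SearchInv.complete (h : SearchInv D Pl T [] pl cid vec nx) (hT : Pl.TablesOK D T)
    (hall : ∀ id < nx, id ∈ pl) {v : ℕ → ℕ} : v ∈ pl.map vec ↔ Valid Pl D T v := by
  rw [List.mem_map]
  constructor
  · rintro ⟨id, hid, rfl⟩
    exact h.valid id (h.lt id hid)
  · refine Valid.mem_of_closed hT (S := {v | ∃ id ∈ pl, vec id = v}) (fun hr => ?_) ?_
    · obtain ⟨id, h1, h2⟩ := h.root hr
      exact ⟨id, hall id h1, h2⟩
    · rintro _ ⟨id', h', rfl⟩ i hi b hb hl hv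
      rcases h.closed id' h' i hi b hb hl hv with ⟨id, h1, h2⟩ | ⟨-, h1⟩
      · exact ⟨id, hall id h1, h2⟩
      · simp at h1

/-! ### Expanding an entry of the queue -/

/-- Check that the coordinates after `i` are `1`. -/
def checkOnes (m i : ℕ) : Cmd := seqs (((List.range m).filter fun j => i < j).map fun j =>
  .ite (.eq (.pos j) (.sc .one)) .skip (.prim (.move (.sc .ok) (.sc .zero))))

/-- Push a child of the entry `cid`, if it is valid. -/
def tryPush (Pl : Plan Q) (q : ℕ × ℕ) : Cmd := seqs [
  loadPos Pl.m,
  .prim (.move (.sc .ok) (.sc .one)),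
  checkOnes Pl.m q.1,
  .ite (.eq (.sc .ok) (.sc .one))
    (seqs [
      .prim (.add (.pos q.1) (.pos q.1) (.pos q.1)),
      .prim (.const (.sc .t) q.2),
      .prim (.add (.pos q.1) (.pos q.1) (.sc .t)),
      decode Pl,
      .ite (.eq (.sc .ok) (.sc .one)) (push Pl.m) .skip])
    .skip]

theorem checkOnes_spec {m i : ℕ} {s : St α W} {v : ℕ → ℕ}
    (hv : ∀ j < m, s.reg (.pos j) = .num (v j)) (hone : s.reg (.sc .one) = .num 1)
    (hz : s.reg (.sc .zero) = .num 0) :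
    (checkOnes m i).wp (fun s' =>
      (s'.reg (.sc .ok) = s.reg (.sc .ok) ∧ ∀ j, i < j → j < m → v j = 1) ∨
      (s'.reg (.sc .ok) = .num 0 ∧ ¬ ∀ j, i < j → j < m → v j = 1)) s := by
  suffices ∀ l : List ℕ, (∀ j ∈ l, j < m) → ∀ s : St α W,
      (∀ j < m, s.reg (.pos j) = .num (v j)) → s.reg (.sc .one) = .num 1 →
      s.reg (.sc .zero) = .num 0 →
      (seqs (l.map fun j => .ite (.eq (.pos j) (.sc .one)) .skip
        (.prim (.move (.sc .ok) (.sc .zero))))).wp (fun s' =>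
        (s'.reg (.sc .ok) = s.reg (.sc .ok) ∧ ∀ j ∈ l, v j = 1) ∨
        (s'.reg (.sc .ok) = .num 0 ∧ ¬ ∀ j ∈ l, v j = 1)) s by
    refine Cmd.wp_mono _ (this _ (fun j hj => ?_) s hv hone hz) fun s' h => ?_
    · simpa using (List.mem_filter.1 hj).1
    · have e : (∀ j ∈ (List.range m).filter fun j => i < j, v j = 1) ↔
          ∀ j, i < j → j < m → v j = 1 := by
        simp only [List.mem_filter, List.mem_range, decide_eq_true_eq]
        exact forall_congr' fun j => by tauto
      rwa [e] at h
  intro l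
  induction l with
  | nil => intro _ s _ _ _; simp [seqs, Cmd.wp]
  | cons j l ih =>
    intro hl s hv hone hz
    simp only [List.map_cons, seqs, Cmd.wp, Cond.holds, hv j (hl j List.mem_cons_self), hone,
      Word.num.injEq, List.mem_cons, forall_eq_or_imp]
    refine ⟨fun h1 => Cmd.wp_mono _ (ih (fun j hj => hl j (List.mem_cons_of_mem _ hj)) s.tick hv
      hone hz) fun s' h => ?_, fun h1 => Cmd.wp_mono _ (ih (fun j hj => hl j
        (List.mem_cons_of_mem _ hj)) (Prim.app (.move (.sc .ok) (.sc .zero)) s.tick).tick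
          (by simpa [Prim.app] using hv)
      (by simp [Prim.app, hone]) (by simp [Prim.app, hz])) fun s' h => ?_⟩
    · exact h.imp (fun h => ⟨h.1, h1, h.2⟩) fun h => ⟨h.1, fun h' => h.2 h'.2⟩
    · refine .inr ⟨?_, fun h' => h1 h'.1⟩
      rcases h with h | h
      · rw [h.1]
        simp [Prim.app, hz]
      · exact h.1

theorem loadPos_loopFree {m : ℕ} : (loadPos m).loopFree := by
  simp [loadPos, Cmd.loopFree_seqs, Cmd.loopFree]

theorem checkOnes_loopFree {m i : ℕ} : (checkOnes m i).loopFree := by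
  rw [checkOnes, Cmd.loopFree_seqs]
  intro p hp
  obtain ⟨j, -, rfl⟩ := List.mem_map.1 hp
  exact ⟨trivial, trivial⟩

theorem loadPos_wr {m : ℕ} {a : Sc} (h : a ≠ .t) : Reg.sc a ∉ (loadPos m).collect Prim.wr := by
  simp [loadPos, Cmd.mem_collect_seqs, Cmd.collect, Prim.wr, h]

theorem loadPos_wt {m : ℕ} (t : Tag) : t ∉ (loadPos m).collect Prim.wt := by
  simp [loadPos, Cmd.mem_collect_seqs, Cmd.collect, Prim.wt]

theorem loadPos_wwt {m : ℕ} (t : Tag) : t ∉ (loadPos m).collect Prim.wwt := by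
  simp [loadPos, Cmd.mem_collect_seqs, Cmd.collect, Prim.wwt]

theorem checkOnes_wr {m i : ℕ} {r : Reg} (h : r ≠ .sc .ok) :
    r ∉ (checkOnes m i).collect Prim.wr := by
  simp [checkOnes, Cmd.mem_collect_seqs, Cmd.collect, Prim.wr, h]

theorem checkOnes_wt {m i : ℕ} (t : Tag) : t ∉ (checkOnes m i).collect Prim.wt := by
  simp [checkOnes, Cmd.mem_collect_seqs, Cmd.collect, Prim.wt]

theorem checkOnes_wwt {m i : ℕ} (t : Tag) : t ∉ (checkOnes m i).collect Prim.wwt := by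
  simp [checkOnes, Cmd.mem_collect_seqs, Cmd.collect, Prim.wwt]

theorem push_wr {m : ℕ} {r : Reg} (h : r ∈ (push m).collect Prim.wr) :
    r = .sc .t ∨ r = .sc .hs ∨ r = .sc .next ∨ r = .sc .cur ∨ r = .sc .ch ∨ r = .sc .ia ∨
      r = .sc .ic := by
  by_cases ht : r = .sc .t
  · exact .inl ht
  · have := storePos_wr (m := m) ht
    simp [push, siftUp, siftUpBody, seqs, Cmd.collect, Prim.wr, this] at h
    tauto

theorem push_wt {m : ℕ} {t : Tag} (h : t ∈ (push m).collect Prim.wt) : t = .pv ∨ t = .pq := by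
  simp [push, storePos, siftUp, siftUpBody, seqs, Cmd.collect, Prim.wt, Cmd.mem_collect_seqs] at h
  tauto

theorem push_wwt {m : ℕ} {t : Tag} (h : t ∈ (push m).collect Prim.wwt) : t = .pw := by
  simpa [push, storePos, siftUp, siftUpBody, seqs, Cmd.collect, Prim.wwt,
    Cmd.mem_collect_seqs] using h

/-- The state of the machine during the search. -/
structure SearchAt (D : Database Q α W) (Pl : Plan Q) (T : Tables α W) (todo : List (ℕ × ℕ))
    (pl : List ℕ) (cid : ℕ) (vec : ℕ → ℕ → ℕ) (nx : ℕ) (s : St α W) : Prop where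
  env : Env D Pl T s
  queue : QueueAt Pl.m (vecWeight Pl D T) vec nx {id | id < nx ∧ id ∉ pl} s
  inv : SearchInv D Pl T todo pl cid vec nx

theorem SearchAt.congr {s s' : St α W} (h : SearchAt D Pl T todo pl cid vec nx s)
    (h1 : s'.arr = s.arr) (h2 : s'.warr = s.warr)
    (h3 : ∀ a : Sc, a = .one ∨ a = .zero ∨ a = .next ∨ a = .hs → s'.reg (.sc a) = s.reg (.sc a)) :
    SearchAt D Pl T todo pl cid vec nx s' :=
  ⟨h.env.congr h1 h2 (h3 _ (by simp)) (h3 _ (by simp)),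
    h.queue.congr h1 h2 (h3 _ (by simp)) (h3 _ (by simp)), h.inv⟩

def tryCost (Pl : Plan Q) (q : ℕ × ℕ) : ℕ :=
  (loadPos Pl.m).cost + (checkOnes Pl.m q.1).cost + (decode Pl).cost + (storePos Pl.m).cost + 30

/-- The vector is loaded anew for each candidate because the preceding one has altered it. The
clause `bound` counts the candidate as due, so there is room for one more entry and the push takes
time logarithmic in `1 + 2 * m * pl.length`. -/
theorem tryPush_spec (hW : IsSelective W) (hT : Pl.TablesOK D T) {q : ℕ × ℕ} {s : St α W}
    (hq : q.1 < Pl.m ∧ q.2 < 2) (h : SearchAt D Pl T (q :: todo) pl cid vec nx s)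
    (hnd : (q :: todo).Nodup) (hcid : s.reg (.sc .cid) = .num cid) :
    (tryPush Pl q).wp (fun s' => ∃ vec' nx', SearchAt D Pl T todo pl cid vec' nx' s' ∧
      pl.map vec' = pl.map vec ∧ s'.reg (.sc .cid) = .num cid ∧
      s'.clock ≤ s.clock + tryCost Pl q + siftStep * Nat.log 2 (1 + 2 * Pl.m * pl.length)) s := by
  obtain ⟨i, b⟩ := q
  obtain ⟨hi, hb⟩ := hq
  have hc := h.inv.lt cid (h.inv.last (by simp)).1
  have hval := h.inv.valid cid hc
  have hpos := hval.pos
  rw [tryPush, seqs, Cmd.wp]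
  refine Cmd.wp_use_cost loadPos_loopFree (loadPos_spec hcid) fun s₁ hv₁ hfr₁ hclk₁ => ?_
  have h₁ : SearchAt D Pl T ((i, b) :: todo) pl cid vec nx s₁ :=
    h.congr (hfr₁.arr_eq loadPos_wt) (hfr₁.warr_eq loadPos_wwt) (by
      rintro a (rfl | rfl | rfl | rfl) <;> exact hfr₁.reg _ (loadPos_wr (by simp)))
  have hcid₁ : s₁.reg (.sc .cid) = .num cid := by rw [hfr₁.reg _ (loadPos_wr (by simp)), hcid]
  have hv₁' : ∀ j < Pl.m, s₁.reg (.pos j) = .num (vec cid j) := fun j hj => by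
    rw [hv₁ j hj, h.queue.pv cid hc j hj]
  clear hfr₁ hv₁ hcid h
  rw [seqs, Cmd.wp, Cmd.wp]
  set s₂ := Prim.app (.move (.sc .ok) (.sc .one)) s₁ with hs₂
  have h₂ : SearchAt D Pl T ((i, b) :: todo) pl cid vec nx s₂ :=
    h₁.congr rfl rfl (by rintro a (rfl | rfl | rfl | rfl) <;> simp [hs₂, Prim.app])
  have hcid₂ : s₂.reg (.sc .cid) = .num cid := by simp [hs₂, Prim.app, hcid₁]
  have hv₂ : ∀ j < Pl.m, s₂.reg (.pos j) = .num (vec cid j) := fun j hj => by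
    simp [hs₂, Prim.app, hv₁' j hj]
  have hok₂ : s₂.reg (.sc .ok) = .num 1 := by simp [hs₂, Prim.app, h₁.env.one]
  have hclk₂ : s₂.clock = s₁.clock + 1 := rfl
  clear_value s₂
  rw [seqs, Cmd.wp]
  refine Cmd.wp_use_cost checkOnes_loopFree (checkOnes_spec hv₂ h₂.env.one h₂.env.zero)
    fun s₃ hch hfr₃ hclk₃ => ?_
  simp only at hclk₃
  have h₃ : SearchAt D Pl T ((i, b) :: todo) pl cid vec nx s₃ :=
    h₂.congr (hfr₃.arr_eq checkOnes_wt) (hfr₃.warr_eq checkOnes_wwt) (by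
      rintro a (rfl | rfl | rfl | rfl) <;> exact hfr₃.reg _ (checkOnes_wr (by simp)))
  have hcid₃ : s₃.reg (.sc .cid) = .num cid := by rw [hfr₃.reg _ (checkOnes_wr (by simp)), hcid₂]
  have hv₃ : ∀ j < Pl.m, s₃.reg (.pos j) = .num (vec cid j) := fun j hj => by
    rw [hfr₃.reg _ (checkOnes_wr (by simp)), hv₂ j hj]
  rw [hok₂] at hch
  clear hfr₃
  simp only [seqs, Cmd.wp, Cond.holds]
  rw [h₃.env.one]
  rcases hch with ⟨hok, hones⟩ | ⟨hok, hones⟩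
  swap
  · refine ⟨fun h => (by rw [hok] at h; cases h), fun _ => ⟨vec, nx, ?_, rfl, hcid₃, ?_⟩⟩
    · have := h₃.congr (s' := s₃.tick.tick) rfl rfl fun _ _ => rfl
      exact ⟨this.env, this.queue, this.inv.drop fun h => hones fun j hj _ => h.1 j hj⟩
    · simp only [St.tick_clock, tryCost]
      omega
  have hl : Legal (vec cid) i := fun j hj => by
    rcases lt_or_ge j Pl.m with h | h
    · exact hones j hj h
    · exact hval.tail j h
  refine ⟨fun _ => ?_, fun h => absurd hok h⟩
  set s₄ := Prim.app (.add (.pos i) (.pos i) (.sc .t)) (Prim.app (.const (.sc .t) b)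
    (Prim.app (.add (.pos i) (.pos i) (.pos i)) s₃.tick)) with hs₄
  have h₄ : SearchAt D Pl T ((i, b) :: todo) pl cid vec nx s₄ :=
    h₃.congr rfl rfl (by rintro a (rfl | rfl | rfl | rfl) <;> simp [hs₄, Prim.app])
  have hcid₄ : s₄.reg (.sc .cid) = .num cid := by simp [hs₄, Prim.app, hcid₃]
  have hv₄ : ∀ j < Pl.m, s₄.reg (.pos j) = .num (childVec (vec cid) i b j) := fun j hj => by
    by_cases e : j = i
    · subst e
      rw [childVec_self]
      simp [hs₄, Prim.app, hv₃ j hj, two_mul]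
    · rw [childVec_of_ne e, ← hv₃ j hj]
      simp [hs₄, Prim.app, e]
  have hclk₄ : s₄.clock = s₃.clock + 4 := rfl
  clear_value s₄
  have hpos' : ∀ j, 1 ≤ childVec (vec cid) i b j := fun j => by
    have := hpos j
    by_cases e : j = i
    · subst e
      rw [childVec_self]
      omega
    · rw [childVec_of_ne e]
      exact this
  refine Cmd.wp_use_cost decode_loopFree (decode_spec hT h₄.env hv₄ fun j _ => hpos' j)
    fun s₅ hdec hfr₅ hclk₅ => ?_
  have hreg₅ : ∀ r, ¬ DecodeReg r → s₅.reg r = s₄.reg r := fun r hr =>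
    hfr₅.reg r fun h => hr (decode_wr h)
  have h₅ : SearchAt D Pl T ((i, b) :: todo) pl cid vec nx s₅ :=
    h₄.congr (hfr₅.arr_eq decode_wt) (hfr₅.warr_eq decode_wwt) (by
      rintro a (rfl | rfl | rfl | rfl) <;> exact hreg₅ _ (by simp [DecodeReg]))
  have hcid₅ : s₅.reg (.sc .cid) = .num cid := by rw [hreg₅ _ (by simp [DecodeReg]), hcid₄]
  have hv₅ : ∀ j < Pl.m, s₅.reg (.pos j) = .num (childVec (vec cid) i b j) := fun j hj => by
    rw [hreg₅ _ (by simp [DecodeReg]), hv₄ j hj]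
  clear hfr₅
  rw [h₅.env.one]
  rcases hdec with ⟨hok, hrep, hw⟩ | ⟨hok, hrep⟩
  swap
  · refine ⟨fun h => (by rw [hok] at h; cases h), fun _ => ⟨vec, nx, ?_, rfl, hcid₅, ?_⟩⟩
    · have := h₅.congr (s' := s₅.tick.tick) rfl rfl fun _ _ => rfl
      exact ⟨this.env, this.queue, this.inv.drop fun h => hrep h.2.rep⟩
    · simp only [St.tick_clock, tryCost]
      omega
  refine ⟨fun _ => ?_, fun h => absurd hok h⟩
  have hvalid : Valid Pl D T (childVec (vec cid) i b) := ⟨⟨_, hrep⟩, fun j hj => by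
    rw [childVec_of_ne (by omega), hval.tail j hj]⟩
  have hinv := h₅.inv.push hT hnd hb hl hvalid
  have hF : insert nx {id | id < nx ∧ id ∉ pl} = {id | id < nx + 1 ∧ id ∉ pl} := by
    ext id
    simp only [Set.mem_insert_iff, Set.mem_ofPred_eq]
    constructor
    · rintro (rfl | h)
      · exact ⟨by omega, fun h => absurd (h₅.inv.lt _ h) (by omega)⟩
      · exact ⟨by omega, h.2⟩
    · rintro ⟨h1, h2⟩
      by_cases e : id = nx
      · exact .inl e
      · exact .inr ⟨by omega, h2⟩
  refine Cmd.wp_use (push_spec (s := s₅.tick) hW (h₅.queue.congr rfl rfl rfl rfl) h₅.env.one hv₅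
    (hw.trans (vecWeight_eq hrep).symm)) fun s₆ ⟨hqu, hclk₆⟩ hfr₆ => ?_
  rw [hF] at hqu
  refine ⟨_, nx + 1, ⟨?_, hqu, hinv⟩, ?_, ?_, ?_⟩
  · refine h₅.env.of_fr hfr₆.tick_left (fun h => ?_) (fun h => ?_) (fun t ht => push_wt ht)
      fun t ht => push_wwt ht
    · simpa using push_wr h
    · simpa using push_wr h
  · exact List.map_congr_left fun id hid => Function.update_of_ne (by
      have := h₅.inv.lt id hid
      omega) ..
  · rw [hfr₆.reg _ fun h => by simpa using push_wr h]
    exact hcid₅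
  · have hbd := h₅.inv.bound
    simp only [List.length_cons] at hbd
    have := Nat.mul_le_mul_left siftStep (Nat.log_mono_right (b := 2)
      (show nx + 1 ≤ 1 + 2 * Pl.m * pl.length by omega))
    simp only [St.tick_clock] at hclk₆
    simp only [tryCost]
    omega

theorem tryPushes_spec (hW : IsSelective W) (hT : Pl.TablesOK D T) {s : St α W}
    (hq : ∀ q ∈ todo, q.1 < Pl.m ∧ q.2 < 2) (h : SearchAt D Pl T todo pl cid vec nx s)
    (hnd : todo.Nodup) (hcid : s.reg (.sc .cid) = .num cid) :
    (seqs (todo.map (tryPush Pl))).wp (fun s' => ∃ vec' nx', SearchAt D Pl T [] pl cid vec' nx' s' ∧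
      pl.map vec' = pl.map vec ∧
      s'.clock ≤ s.clock + (todo.map (tryCost Pl)).sum +
        todo.length * (siftStep * Nat.log 2 (1 + 2 * Pl.m * pl.length))) s := by
  induction todo generalizing s vec nx with
  | nil => exact ⟨vec, nx, h, rfl, by simp⟩
  | cons q todo ih =>
    rw [List.map_cons, seqs, Cmd.wp]
    refine Cmd.wp_mono _ (tryPush_spec hW hT (hq q List.mem_cons_self) h hnd hcid) ?_
    rintro s₁ ⟨vec₁, nx₁, h1, h2, h3, h4⟩
    refine Cmd.wp_mono _ (ih (fun q hq' => hq q (List.mem_cons_of_mem _ hq')) h1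
      (List.nodup_cons.1 hnd).2 h3) ?_
    rintro s₂ ⟨vec₂, nx₂, h5, h6, h7⟩
    refine ⟨vec₂, nx₂, h5, h6.trans h2, ?_⟩
    rw [List.map_cons, List.sum_cons, List.length_cons, add_mul]
    omega

end Search

/-! ### The enumeration program -/

section Main

variable {Q : CQ} {α : Type u} {W : Type v} [CommSemiring W]

def initPos (m : ℕ) : Cmd := seqs ((List.range m).map fun i => .prim (.const (.pos i) 1))

/-- Build the tables and put the first answer into the queue. -/
def prepare (Pl : Plan Q) : Cmd := seqs [
  .prim (.const (.sc .one) 1),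
  .prim (.const (.sc .zero) 0),
  buildBelow Pl Pl.N,
  .prim (.const (.sc .hs) 0),
  .prim (.const (.sc .next) 0),
  initPos Pl.m,
  decode Pl,
  .ite (.eq (.sc .ok) (.sc .one)) (push Pl.m) .skip]

/-- Output the next answer. -/
def outputNext (Pl : Plan Q) : Cmd := seqs [
  pop,
  loadPos Pl.m,
  decode Pl,
  .prim (.emit (Q.head.map fun x : Fin Q.numVars => Reg.var x) 0),
  seqs ((allPairs Pl.m).map (tryPush Pl))]

def enumerate (Pl : Plan Q) : Cmd :=
  .seq (prepare Pl) (.loop (.eq (.sc .hs) (.sc .zero)) (outputNext Pl))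

variable {Pl : Plan Q} {D : Database Q α W} {T : Tables α W}

theorem initPos_spec {m : ℕ} {s : St α W} :
    (initPos m).wp (fun s' => ∀ i < m, s'.reg (.pos i) = .num 1) s := by
  suffices ∀ l : List ℕ, ∀ s : St α W,
      (seqs (l.map fun i => .prim (.const (.pos i) 1))).wp (fun s' =>
        (∀ i ∈ l, s'.reg (.pos i) = .num 1) ∧
          ∀ i, i ∉ l → s'.reg (.pos i) = s.reg (.pos i)) s from
    Cmd.wp_mono _ (this (List.range m) s) fun s' h i hi => h.1 i (List.mem_range.2 hi)
  intro l
  induction l with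
  | nil => intro s; simp [seqs, Cmd.wp]
  | cons i l ih =>
    intro s
    simp only [List.map_cons, seqs, Cmd.wp]
    refine Cmd.wp_mono _ (ih _) fun s' ⟨h1, h2⟩ => ⟨fun j hj => ?_, fun j hj => ?_⟩
    · by_cases hjl : j ∈ l
      · exact h1 j hjl
      · obtain rfl : j = i := (List.mem_cons.1 hj).resolve_right hjl
        rw [h2 j hjl]
        simp [Prim.app]
    · simp only [List.mem_cons, not_or] at hj
      rw [h2 j hj.2]
      simp [Prim.app, hj.1]

theorem initPos_loopFree {m : ℕ} : (initPos m).loopFree := by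
  rw [initPos, Cmd.loopFree_seqs]
  intro p hp
  obtain ⟨j, -, rfl⟩ := List.mem_map.1 hp
  trivial

theorem initPos_wr {m : ℕ} {a : Sc} : Reg.sc a ∉ (initPos m).collect Prim.wr := by
  simp [initPos, Cmd.mem_collect_seqs, Cmd.collect, Prim.wr]

theorem initPos_wt {m : ℕ} (t : Tag) : t ∉ (initPos m).collect Prim.wt := by
  simp [initPos, Cmd.mem_collect_seqs, Cmd.collect, Prim.wt]

theorem initPos_wwt {m : ℕ} (t : Tag) : t ∉ (initPos m).collect Prim.wwt := by
  simp [initPos, Cmd.mem_collect_seqs, Cmd.collect, Prim.wwt]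

/-- The state in which the program starts. -/
structure Start (D : Database Q α W) (s : St α W) : Prop where
  inp : InpOK D s
  blank : ∀ i, Blank i s
  clock : s.clock = 0
  log : s.log = []

def prepareCost (Pl : Plan Q) : ℕ :=
  (∑ i ∈ Finset.range Pl.N, buildCost Pl i) + (initPos Pl.m).cost + (decode Pl).cost +
    (storePos Pl.m).cost + 30

theorem buildBelow_emits : ∀ n, () ∉ (buildBelow Pl n).collect Prim.emits := by
  intro n
  induction n with
  | zero => simp [buildBelow, Cmd.collect]
  | succ n ih =>
    have hb : (baseWeight Pl n).emits = ∅ := by unfold baseWeight; split_ifs <;> rfl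
    rw [buildBelow, Cmd.collect]
    refine fun h => h.elim ?_ ih
    simp only [buildNode, insertTuple, addTuple, appendTuple, seqs, Cmd.collect, hb, fetch,
      testTuple, heapifyGroup, heapify, heapifyBody, siftDown, pickChild, exchangeChild]
    simp [Cmd.mem_collect_seqs, childStep, loadVars, checkVars, seqs, Cmd.collect, Prim.emits]

/-- If the vector `1, ..., 1` is not valid, there are no answers at all and the queue stays empty.
The push into the empty queue has logarithm `0`, so only the tables take time depending on the data.
-/
theorem prepare_spec (hW : IsSelective W) {s : St α W} (h : Start D s) :
    (prepare Pl).wp (fun s' => ∃ T vec nx, Pl.TablesOK D T ∧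
      SearchAt D Pl T [] [] 0 vec nx s' ∧ s'.log = [] ∧
      s'.clock ≤ prepareCost Pl * max D.n 1) s := by
  have hm := Pl.m_le
  rw [prepare, seqs, Cmd.wp, Cmd.wp, seqs, Cmd.wp, Cmd.wp, seqs, Cmd.wp]
  set s₁ := Prim.app (.const (.sc .zero) 0) (Prim.app (.const (.sc .one) 1) s) with hs₁
  have hone₁ : s₁.reg (.sc .one) = .num 1 := by simp [hs₁, Prim.app]
  have hzero₁ : s₁.reg (.sc .zero) = .num 0 := by simp [hs₁, Prim.app]
  have hinp₁ : InpOK D s₁ := h.inp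
  have hbl₁ : ∀ i, Blank i s₁ := h.blank
  have hclk₁ : s₁.clock = 2 := by simp [hs₁, Prim.app, h.clock]
  have hlog₁ : s₁.log = [] := h.log
  clear_value s₁
  refine Cmd.wp_use (buildBelow_spec (T := ⟨fun _ _ => 0, fun _ _ _ => 0, fun _ _ => 0⟩) (Pl := Pl)
    hW le_rfl hinp₁ hone₁ hzero₁ (fun i _ => hbl₁ i) fun i h1 h2 => absurd h1 (by omega)) ?_
  rintro s₂ ⟨⟨T, hT⟩, hinp₂, hone₂, hzero₂, hclk₂⟩ hfr₂
  have hlog₂ : s₂.log = [] := by rw [hfr₂.log (buildBelow_emits _), hlog₁]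
  have hTok : Pl.TablesOK D T := ⟨fun i hi => (hT i hi).ok, fun i hi => (hT i hi).heap⟩
  have henv₂ : Env D Pl T s₂ := ⟨hinp₂, hone₂, hzero₂, fun c hc => (hT c hc).at_⟩
  clear hfr₂
  rw [seqs, Cmd.wp, Cmd.wp, seqs, Cmd.wp, Cmd.wp, seqs, Cmd.wp]
  set s₃ := Prim.app (.const (.sc .next) 0) (Prim.app (.const (.sc .hs) 0) s₂) with hs₃
  have henv₃ : Env D Pl T s₃ := henv₂.congr rfl rfl (by simp [hs₃, Prim.app])
    (by simp [hs₃, Prim.app])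
  have hhs₃ : s₃.reg (.sc .hs) = .num 0 := by simp [hs₃, Prim.app]
  have hnx₃ : s₃.reg (.sc .next) = .num 0 := by simp [hs₃, Prim.app]
  have hclk₃ : s₃.clock = s₂.clock + 2 := rfl
  have hlog₃ : s₃.log = [] := hlog₂
  clear_value s₃
  have hqu₃ : QueueAt Pl.m (vecWeight Pl D T) (fun _ _ => 1) 0 ∅ s₃ := by
    refine ⟨hnx₃, by omega, by omega, by simp, 0, fun _ => 0, hhs₃, by omega, ?_, by simp, by simp⟩
    intro c _ _
    omega
  refine Cmd.wp_use_cost initPos_loopFree initPos_spec fun s₄ hv₄ hfr₄ hclk₄ => ?_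
  have henv₄ : Env D Pl T s₄ := henv₃.congr (hfr₄.arr_eq initPos_wt) (hfr₄.warr_eq initPos_wwt)
    (hfr₄.reg _ initPos_wr) (hfr₄.reg _ initPos_wr)
  have hqu₄ : QueueAt Pl.m (vecWeight Pl D T) (fun _ _ => 1) 0 ∅ s₄ :=
    hqu₃.congr (hfr₄.arr_eq initPos_wt) (hfr₄.warr_eq initPos_wwt)
      (hfr₄.reg _ initPos_wr) (hfr₄.reg _ initPos_wr)
  have hlog₄ : s₄.log = [] := by
    rw [hfr₄.log (by simp [initPos, Cmd.mem_collect_seqs, Cmd.collect, Prim.emits]), hlog₃]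
  clear hfr₄
  rw [seqs, Cmd.wp]
  refine Cmd.wp_use_cost decode_loopFree (decode_spec (v := fun _ => 1) hTok henv₄ hv₄
    fun _ _ => le_rfl) fun s₅ hdec hfr₅ hclk₅ => ?_
  have hreg₅ : ∀ r, ¬ DecodeReg r → s₅.reg r = s₄.reg r := fun r hr =>
    hfr₅.reg r fun h => hr (decode_wr h)
  have henv₅ : Env D Pl T s₅ := henv₄.congr (hfr₅.arr_eq decode_wt) (hfr₅.warr_eq decode_wwt)
    (hreg₅ _ (by simp [DecodeReg])) (hreg₅ _ (by simp [DecodeReg]))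
  have hqu₅ : QueueAt Pl.m (vecWeight Pl D T) (fun _ _ => 1) 0 ∅ s₅ :=
    hqu₄.congr (hfr₅.arr_eq decode_wt) (hfr₅.warr_eq decode_wwt)
      (hreg₅ _ (by simp [DecodeReg])) (hreg₅ _ (by simp [DecodeReg]))
  have hv₅ : ∀ i < Pl.m, s₅.reg (.pos i) = .num 1 := fun i hi => by
    rw [hreg₅ _ (by simp [DecodeReg]), hv₄ i hi]
  have hlog₅ : s₅.log = [] := by rw [hfr₅.log (decode_emits _), hlog₄]
  clear hfr₅
  have hcost : (∑ i ∈ Finset.range Pl.N, buildCost Pl i) * max D.n 1 + (initPos Pl.m).cost +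
      (decode Pl).cost + (storePos Pl.m).cost + 30 ≤ prepareCost Pl * max D.n 1 := by
    have h1 : 1 ≤ max D.n 1 := le_max_right _ _
    have h2 := Nat.mul_le_mul_left ((initPos Pl.m).cost + (decode Pl).cost +
      (storePos Pl.m).cost + 30) h1
    have h3 : prepareCost Pl * max D.n 1 =
      (∑ i ∈ Finset.range Pl.N, buildCost Pl i) * max D.n 1 + ((initPos Pl.m).cost +
        (decode Pl).cost + (storePos Pl.m).cost + 30) * max D.n 1 := by rw [prepareCost]; ring
    omega
  simp only [seqs, Cmd.wp, Cond.holds]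
  rw [henv₅.one]
  rcases hdec with ⟨hok, hrep, hw⟩ | ⟨hok, hrep⟩
  · refine ⟨fun _ => ?_, fun h => absurd hok h⟩
    have hvalid : Valid Pl D T fun _ => 1 := ⟨⟨_, hrep⟩, fun _ _ => rfl⟩
    refine Cmd.wp_use (push_spec (s := s₅.tick) hW (hqu₅.congr rfl rfl rfl rfl) henv₅.one hv₅
      (hw.trans (vecWeight_eq hrep).symm)) fun s₆ ⟨hqu, hclk₆⟩ hfr₆ => ?_
    have hvec : Function.update (fun _ _ => 1 : ℕ → ℕ → ℕ) 0 (fun _ => 1) = fun _ _ => 1 :=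
      Function.update_eq_self (f := (fun _ _ => 1 : ℕ → ℕ → ℕ)) 0
    rw [hvec] at hqu
    refine ⟨T, fun _ _ => 1, 1, hTok, ⟨?_, ?_, ?_⟩, ?_, ?_⟩
    · refine henv₅.of_fr hfr₆.tick_left (fun h => ?_) (fun h => ?_) (fun t ht => push_wt ht)
        fun t ht => push_wwt ht
      · simpa using push_wr h
      · simpa using push_wr h
    · have : (insert 0 ∅ : Set ℕ) = {id | id < 1 ∧ id ∉ ([] : List ℕ)} := by
        ext id
        simp
      rw [← this]
      exact hqu
    · constructor
      · intro id h1 id' h2 _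
        omega
      · exact fun _ _ => hvalid
      · simp
      · simp
      · exact fun _ => ⟨0, by omega, rfl⟩
      · exact fun _ _ h => absurd rfl h
      · simp
      · simp
      · simp
      · simp
      · simp
    · rw [hfr₆.log (by simp [push, storePos, siftUp, siftUpBody, seqs, Cmd.mem_collect_seqs,
        Cmd.collect, Prim.emits])]
      exact hlog₅
    · simp only [St.tick_clock, zero_add, Nat.log_one_right, mul_zero, add_zero] at hclk₆
      omega
  · refine ⟨fun h => (by rw [hok] at h; cases h), fun _ => ⟨T, fun _ _ => 1, 0, hTok, ⟨?_, ?_, ?_⟩,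
      hlog₅, ?_⟩⟩
    · exact henv₅.congr rfl rfl rfl rfl
    · have : (∅ : Set ℕ) = {id | id < 0 ∧ id ∉ ([] : List ℕ)} := by
        ext id
        simp
      rw [← this]
      exact hqu₅.congr rfl rfl rfl rfl
    · constructor
      · intro id h1
        omega
      · intro id h1
        omega
      · simp
      · simp
      · exact fun h => absurd h.rep hrep
      · intro id h1
        omega
      · simp
      · simp
      · simp
      · simp
      · simp
    · simp only [St.tick_clock]
      omega

/-! ### Time bounds and the main loop -/

/-- The output `o` is the answer given by the position vector `v`. -/
def IsOutput (D : Database Q α W) (Pl : Plan Q) (T : Tables α W) (v : ℕ → ℕ) (o : Output α W) :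
    Prop :=
  ∃ a, Pl.Rep D T Pl.m v a ∧ o.tuple = Q.head.map (fun x : Fin Q.numVars => a x) ∧
    o.weight = Pl.answerWeight T a

/-- The bound on the time between two events. -/
def gapBound (C n j : ℕ) : ℕ := if j = 0 then C * max n 1 else C * Nat.log 2 (j + 1)

/-- The number of entries is linear in the number of outputs. The factor adds a constant to the
logarithm, and `log (j + 1) ≥ 1` turns this constant into a factor. -/
theorem log_le {m j : ℕ} (hj : 1 ≤ j) :
    Nat.log 2 (1 + 2 * m * j) ≤ (2 * m + 1) * Nat.log 2 (j + 1) := by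
  have h1 : 1 ≤ Nat.log 2 (j + 1) := Nat.log_pos (by omega) (by omega)
  have h2 : j + 1 < 2 ^ (Nat.log 2 (j + 1) + 1) := Nat.lt_pow_succ_log_self (by omega) _
  have h3 : 1 + 2 * m ≤ 2 ^ (2 * m) := by
    have := Nat.lt_two_pow_self (n := 2 * m)
    omega
  have h4 : 1 + 2 * m * j < 2 ^ (2 * m + Nat.log 2 (j + 1) + 1) := by
    calc 1 + 2 * m * j ≤ (1 + 2 * m) * (j + 1) := by ring_nf; omega
      _ < (1 + 2 * m) * 2 ^ (Nat.log 2 (j + 1) + 1) := Nat.mul_lt_mul_of_pos_left h2 (by omega)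
      _ ≤ 2 ^ (2 * m) * 2 ^ (Nat.log 2 (j + 1) + 1) := Nat.mul_le_mul_right _ h3
      _ = 2 ^ (2 * m + Nat.log 2 (j + 1) + 1) := by rw [← pow_add, add_assoc]
  have h5 : Nat.log 2 (1 + 2 * m * j) < 2 * m + Nat.log 2 (j + 1) + 1 :=
    Nat.log_lt_of_lt_pow (by omega) h4
  have h6 : 2 * m ≤ 2 * m * Nat.log 2 (j + 1) := Nat.le_mul_of_pos_right _ h1
  rw [add_mul, one_mul]
  omega

/-- The time from the start of an iteration to its output. -/
def outputTime (Pl : Plan Q) (j : ℕ) : ℕ :=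
  (loadPos Pl.m).cost + (decode Pl).cost + 20 + siftStep * Nat.log 2 (1 + 2 * Pl.m * j)

/-- The time from an output to the next iteration. -/
def expandTime (Pl : Plan Q) (j : ℕ) : ℕ :=
  ((allPairs Pl.m).map (tryCost Pl)).sum + 1 +
    2 * Pl.m * (siftStep * Nat.log 2 (1 + 2 * Pl.m * j))

/-- One constant for both bounds: `first_le` uses the preparation and the fixed costs, `next_le` the
fixed costs and `2 * m` pushes and one pop, with the factor from `log_le`. -/
def delayConst (Pl : Plan Q) : ℕ :=
  prepareCost Pl + (loadPos Pl.m).cost + (decode Pl).cost + 20 +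
    ((allPairs Pl.m).map (tryCost Pl)).sum + 1 +
    (2 * Pl.m + 1) * (siftStep * (2 * Pl.m + 1))

theorem first_le (n : ℕ) :
    prepareCost Pl * max n 1 + outputTime Pl 0 ≤ gapBound (delayConst Pl) n 0 := by
  have h1 : 1 ≤ max n 1 := le_max_right _ _
  have h2 := Nat.mul_le_mul_left (delayConst Pl - prepareCost Pl) h1
  have h3 : delayConst Pl * max n 1 = (delayConst Pl - prepareCost Pl) * max n 1 +
      prepareCost Pl * max n 1 := by
    rw [← add_mul]
    congr 1
    simp only [delayConst]
    omega
  have h4 : outputTime Pl 0 ≤ delayConst Pl - prepareCost Pl := by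
    simp only [outputTime, delayConst, mul_zero, add_zero, Nat.log_one_right]
    omega
  rw [gapBound, if_pos rfl, h3]
  omega

theorem next_le (n : ℕ) {j : ℕ} (hj : 1 ≤ j) :
    expandTime Pl j + outputTime Pl j ≤ gapBound (delayConst Pl) n j := by
  have h1 : 1 ≤ Nat.log 2 (j + 1) := Nat.log_pos (by omega) (by omega)
  have h2 := log_le (m := Pl.m) hj
  set l := Nat.log 2 (j + 1)
  set l' := Nat.log 2 (1 + 2 * Pl.m * j)
  set A := (loadPos Pl.m).cost + (decode Pl).cost + 20 +
    ((allPairs Pl.m).map (tryCost Pl)).sum + 1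
  have e1 : expandTime Pl j + outputTime Pl j = A + (2 * Pl.m + 1) * (siftStep * l') := by
    simp only [expandTime, outputTime, A, l']
    ring
  have e2 : delayConst Pl = prepareCost Pl + A + (2 * Pl.m + 1) * (siftStep * (2 * Pl.m + 1)) := by
    simp only [delayConst, A]
    ring
  rw [gapBound, if_neg (by omega), e1, e2]
  calc A + (2 * Pl.m + 1) * (siftStep * l')
      ≤ A * l + (2 * Pl.m + 1) * (siftStep * ((2 * Pl.m + 1) * l)) := by
        gcongr
        exact Nat.le_mul_of_pos_right _ h1
    _ = (A + (2 * Pl.m + 1) * (siftStep * (2 * Pl.m + 1))) * l := by ring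
    _ ≤ _ := by gcongr; omega

/-- The loop invariant of the enumeration. -/
structure EnumInv (D : Database Q α W) (Pl : Plan Q) (T : Tables α W) (pl : List ℕ)
    (vec : ℕ → ℕ → ℕ) (nx : ℕ) (s : St α W) : Prop where
  search : ∃ cid, SearchAt D Pl T [] pl cid vec nx s
  log : List.Forall₂ (IsOutput D Pl T) (pl.map vec) s.log
  gaps : ∀ j o, s.log[j]? = some o → o.time ≤ gapBound (delayConst Pl) D.n j
  clock : s.clock + outputTime Pl pl.length ≤ gapBound (delayConst Pl) D.n pl.length

theorem pop_wr {a : Sc} (h : a = .one ∨ a = .zero) : Reg.sc a ∉ pop.collect Prim.wr := by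
  rcases h with rfl | rfl <;>
    simp [pop, siftDown, pickChild, exchangeChild, seqs, Cmd.collect, Prim.wr]

theorem pop_wt {t : Tag} (h : t ∈ pop.collect Prim.wt) : t = .pv ∨ t = .pq := by
  simp [pop, siftDown, pickChild, exchangeChild, seqs, Cmd.collect, Prim.wt] at h
  exact .inr h

theorem pop_wwt {t : Tag} (h : t ∈ pop.collect Prim.wwt) : t = .pw := by
  simp [pop, siftDown, pickChild, exchangeChild, seqs, Cmd.collect, Prim.wwt] at h

/-- An answer is output before its children are pushed; their cost falls into the next gap. The
invariant keeps `outputTime` in reserve for the output that is to come. -/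
theorem outputNext_spec (hW : IsSelective W) (hT : Pl.TablesOK D T) {pl : List ℕ} {nx : ℕ}
    {vec : ℕ → ℕ → ℕ} {s : St α W} (h : EnumInv D Pl T pl vec nx s)
    (hne : s.reg (.sc .hs) ≠ .num 0) :
    (outputNext Pl).wp (fun s' => ∃ id vec' nx', EnumInv D Pl T (pl ++ [id]) vec' nx' s'.tick)
      s.tick := by
  obtain ⟨⟨cid, hs⟩, hlog, hgaps, hclk⟩ := h
  rw [outputNext, seqs, Cmd.wp]
  refine Cmd.wp_use (pop_spec (s := s.tick) hW (hs.queue.congr rfl rfl rfl rfl) hs.env.one hne) ?_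
  rintro s₁ ⟨id, hid, hcid₁, hmin, hqu₁, hclk₁⟩ hfr₁
  have henv₁ : Env D Pl T s₁ := hs.env.of_fr hfr₁.tick_left (pop_wr (.inl rfl)) (pop_wr (.inr rfl))
    (fun t ht => pop_wt ht) fun t ht => pop_wwt ht
  have hlog₁ : s₁.log = s.log := hfr₁.log (by
    simp [pop, siftDown, pickChild, exchangeChild, seqs, Cmd.collect, Prim.emits])
  have hF : {id | id < nx ∧ id ∉ pl} \ {id} = {id' | id' < nx ∧ id' ∉ pl ++ [id]} := by
    ext id'
    simp
    tauto
  rw [hF] at hqu₁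
  have h₁ : SearchAt D Pl T (allPairs Pl.m) (pl ++ [id]) id vec nx s₁ :=
    ⟨henv₁, hqu₁, hs.inv.select hW hid.1 hid.2 fun id' h1 h2 => hmin id' ⟨h1, h2⟩⟩
  clear hfr₁
  rw [seqs, Cmd.wp]
  refine Cmd.wp_use_cost loadPos_loopFree (loadPos_spec hcid₁) fun s₂ hv₂ hfr₂ hclk₂ => ?_
  have h₂ : SearchAt D Pl T (allPairs Pl.m) (pl ++ [id]) id vec nx s₂ :=
    h₁.congr (hfr₂.arr_eq loadPos_wt) (hfr₂.warr_eq loadPos_wwt) (by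
      rintro a (rfl | rfl | rfl | rfl) <;> exact hfr₂.reg _ (loadPos_wr (by simp)))
  have hcid₂ : s₂.reg (.sc .cid) = .num id := by rw [hfr₂.reg _ (loadPos_wr (by simp)), hcid₁]
  have hlog₂ : s₂.log = s.log := by
    rw [hfr₂.log (by simp [loadPos, Cmd.mem_collect_seqs, Cmd.collect, Prim.emits]), hlog₁]
  have hv₂' : ∀ j < Pl.m, s₂.reg (.pos j) = .num (vec id j) := fun j hj => by
    rw [hv₂ j hj, h₁.queue.pv id hid.1 j hj]
  have hval := h₂.inv.valid id hid.1
  clear hfr₂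
  rw [seqs, Cmd.wp]
  refine Cmd.wp_use_cost decode_loopFree (decode_spec hT h₂.env hv₂' fun j _ => hval.pos j)
    fun s₃ hdec hfr₃ hclk₃ => ?_
  have hreg₃ : ∀ r, ¬ DecodeReg r → s₃.reg r = s₂.reg r := fun r hr =>
    hfr₃.reg r fun h => hr (decode_wr h)
  have h₃ : SearchAt D Pl T (allPairs Pl.m) (pl ++ [id]) id vec nx s₃ :=
    h₂.congr (hfr₃.arr_eq decode_wt) (hfr₃.warr_eq decode_wwt) (by
      rintro a (rfl | rfl | rfl | rfl) <;> exact hreg₃ _ (by simp [DecodeReg]))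
  have hcid₃ : s₃.reg (.sc .cid) = .num id := by rw [hreg₃ _ (by simp [DecodeReg]), hcid₂]
  have hlog₃ : s₃.log = s.log := by rw [hfr₃.log (decode_emits _), hlog₂]
  clear hfr₃
  rcases hdec with ⟨-, hrep, hw⟩ | ⟨-, hrep⟩
  swap
  · exact absurd hval.rep hrep
  rw [seqs, Cmd.wp, Cmd.wp]
  set s₄ := Prim.app (.emit (Q.head.map fun x : Fin Q.numVars => Reg.var x) 0) s₃ with hs₄
  have h₄ : SearchAt D Pl T (allPairs Pl.m) (pl ++ [id]) id vec nx s₄ :=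
    h₃.congr rfl rfl fun _ _ => rfl
  have hcid₄ : s₄.reg (.sc .cid) = .num id := hcid₃
  have hclk₄ : s₄.clock = 0 := rfl
  obtain ⟨o, ho, hlog₄⟩ : ∃ o : Output α W, (IsOutput D Pl T (vec id) o ∧ o.time = s₃.clock + 1) ∧
      s₄.log = s.log ++ [o] := by
    refine ⟨⟨s₃.clock + 1, (Q.head.map fun x : Fin Q.numVars => Reg.var x).map s₃.reg, s₃.wreg 0⟩,
      ⟨⟨s₃.va, hrep, ?_, hw⟩, rfl⟩, ?_⟩
    · simp [St.va]
    · simp only [hs₄, Prim.app, hlog₃]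
  clear_value s₄
  rw [seqs, seqs, Cmd.wp]
  refine Cmd.wp_use (tryPushes_spec hW hT (fun q hq => mem_allPairs.1 hq) h₄ (nodup_allPairs _)
    hcid₄) ?_
  rintro s₅ ⟨vec', nx', h₅, hmap, hclk₅⟩ hfr₅
  have hlog₅ : s₅.log = s.log ++ [o] := by
    rw [hfr₅.log ?_, hlog₄]
    simp [Cmd.mem_collect_seqs, tryPush, loadPos, checkOnes, push, storePos, siftUp, siftUpBody,
      seqs, Cmd.collect, Prim.emits, decode_emits]
  have hlen : s.log.length = pl.length := by
    rw [← hlog.length_eq, List.length_map]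
  have hnx : nx ≤ 1 + 2 * Pl.m * pl.length := by simpa using hs.inv.bound
  refine ⟨id, vec', nx', ⟨id, h₅.congr rfl rfl fun _ _ => rfl⟩, ?_, ?_, ?_⟩
  · rw [hmap, St.tick_log, hlog₅, List.map_append]
    exact List.rel_append hlog (.cons ho.1 .nil)
  · intro j o' hj
    rw [St.tick_log, hlog₅] at hj
    rcases lt_trichotomy j s.log.length with h | h | h
    · rw [List.getElem?_append_left h] at hj
      exact hgaps j o' hj
    · rw [h, List.getElem?_concat_length] at hj
      obtain rfl := Option.some.inj hj
      rw [ho.2, h, hlen]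
      refine le_trans ?_ hclk
      have := Nat.mul_le_mul_left siftStep (Nat.log_mono_right (b := 2) hnx)
      simp only [outputTime]
      simp only [St.tick_clock] at hclk₁
      omega
    · rw [List.getElem?_eq_none (by simp; omega)] at hj
      cases hj
  · refine le_trans ?_ (next_le (Pl := Pl) D.n (j := (pl ++ [id]).length) (by simp))
    rw [length_allPairs, hclk₄] at hclk₅
    simp only [expandTime, St.tick_clock]
    omega

/-- The result of the enumeration. -/
structure EnumDone (D : Database Q α W) (Pl : Plan Q) (T : Tables α W) (L : List (ℕ → ℕ))
    (s : St α W) : Prop where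
  log : List.Forall₂ (IsOutput D Pl T) L s.log
  nodup : L.Nodup
  mem : ∀ v, v ∈ L ↔ Valid Pl D T v
  sorted : L.Pairwise fun v v' => DLe (vecWeight Pl D T v) (vecWeight Pl D T v')
  gaps : ∀ j o, s.log[j]? = some o → o.time ≤ gapBound (delayConst Pl) D.n j
  clock : s.clock ≤ gapBound (delayConst Pl) D.n s.log.length

/-- The variant is the number of valid vectors that have not been output. -/
theorem enumerate_spec (hW : IsSelective W) {s : St α W} (h : Start D s) :
    (enumerate Pl).wp (fun s' => ∃ T L, Pl.TablesOK D T ∧ EnumDone D Pl T L s') s := by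
  rw [enumerate, Cmd.wp]
  refine Cmd.wp_mono _ (prepare_spec (Pl := Pl) hW h) ?_
  rintro s₁ ⟨T, vec, nx, hT, h₁, hlog, hclk⟩
  refine Cmd.wp_loop (fun n s' => ∃ pl vec nx, EnumInv D Pl T pl vec nx s' ∧
    n + pl.length = (finite_valid hT).toFinset.card) _ ⟨[], vec, nx, ⟨⟨0, h₁⟩, ?_, ?_, ?_⟩, rfl⟩
    ?_ ?_
  · rw [hlog]
    exact .nil
  · simp [hlog]
  · exact le_trans (Nat.add_le_add_right hclk _) (first_le _)
  · rintro n s' - ⟨pl, vec, nx, hinv, hn⟩ hb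
    obtain ⟨⟨cid, hs⟩, -⟩ := id hinv
    rw [Cond.holds, hs.env.zero] at hb
    refine Cmd.wp_mono _ (outputNext_spec hW hT hinv hb) ?_
    rintro s'' ⟨id, vec', nx', h'⟩
    obtain ⟨cid', hs'⟩ := h'.search
    have hle := hs'.inv.length_le hT
    rw [List.length_append, List.length_singleton] at hle
    exact ⟨n - 1, by omega, pl ++ [id], vec', nx', h', by simp; omega⟩
  · rintro n s' - ⟨pl, vec, nx, ⟨⟨cid, hs⟩, hlog, hgaps, hclk⟩, hn⟩ hb
    rw [Cond.holds, hs.env.zero] at hb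
    -- The queue consists of all entries created but not popped, and it is empty.
    have hall : ∀ id < nx, id ∈ pl := by
      intro id hid
      by_contra hpl
      obtain ⟨n', f, h1, -, -, -, himg⟩ := hs.queue.heap
      have h2 : id ∈ f '' Set.Icc 1 n' := by rw [himg]; exact ⟨hid, hpl⟩
      obtain ⟨p, hp, -⟩ := h2
      rw [h1, Word.num.injEq] at hb
      have := hp.1
      have := hp.2
      omega
    refine ⟨T, pl.map vec, hT, hlog, ?_, fun v => hs.inv.complete hT hall, ?_, hgaps, ?_⟩
    · refine List.Nodup.map_on (fun id h1 id' h2 e => ?_) hs.inv.nodup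
      exact hs.inv.inj id (hs.inv.lt id h1) id' (hs.inv.lt id' h2) e
    · rw [List.pairwise_map]
      exact hs.inv.sorted
    · have hlen : s'.log.length = pl.length := by
        rw [← hlog.length_eq, List.length_map]
      rw [St.tick_log, hlen, St.tick_clock]
      -- The final test of the loop is paid from the time reserved for a further output, so halting
      -- obeys the bound of the next event.
      refine le_trans ?_ hclk
      simp only [outputTime]
      omega

end Main

/-! ### From position vectors to answers, and from commands to the machine -/

section Final

variable {Q : CQ} {α : Type u} {W : Type v} [CommSemiring W]
variable {Pl : Plan Q} {D : Database Q α W} {T : Tables α W}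

theorem forall₂_isOutput_congr {L : List (ℕ → ℕ)} {l l' : List (Output α W)}
    (h : List.Forall₂ (IsOutput D Pl T) L l) (h1 : l'.map Output.tuple = l.map Output.tuple)
    (h2 : l'.map Output.weight = l.map Output.weight) : List.Forall₂ (IsOutput D Pl T) L l' := by
  induction h generalizing l' with
  | nil =>
    rw [List.map_nil, List.map_eq_nil_iff] at h1
    rw [h1]
    exact .nil
  | cons ho _ ih =>
    cases l' with
    | nil => simp at h1
    | cons o' l' =>
      simp only [List.map_cons, List.cons.injEq] at h1 h2
      obtain ⟨a, h3, h4, h5⟩ := ho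
      exact .cons ⟨a, h3, h1.1.trans h4, h2.1.trans h5⟩ (ih h1.2 h2.2)

theorem map_eq_of_forall₂ {β γ δ : Type*} {R : β → γ → Prop} {f : β → δ} {g : γ → δ}
    {L : List β} {l : List γ} (h : List.Forall₂ R L l) (hR : ∀ b ∈ L, ∀ c, R b c → g c = f b) :
    l.map g = L.map f := by
  induction h with
  | nil => rfl
  | cons h _ ih =>
    rw [List.map_cons, List.map_cons, hR _ List.mem_cons_self _ h,
      ih fun b hb => hR b (List.mem_cons_of_mem _ hb)]

theorem map_val_injective : Function.Injective (List.map (Word.val : α → Word α)) :=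
  List.map_injective_iff.2 fun _ _ h => Word.val.inj h

/-- Valid vectors and answers correspond one to one: `Rep.isMinWeight` gives the answer and its
weight, `pos_eq_of_head` injectivity, and `exists_rep_of_isAnswer` surjectivity. -/
theorem isRankedEnumeration_of_forall₂ (hW : IsSelective W) (hT : Pl.TablesOK D T)
    {L : List (ℕ → ℕ)} {log : List (Output α W)} (h : List.Forall₂ (IsOutput D Pl T) L log)
    (hnd : L.Nodup) (hmem : ∀ v, v ∈ L ↔ Valid Pl D T v)
    (hsort : L.Pairwise fun v v' => DLe (vecWeight Pl D T v) (vecWeight Pl D T v')) :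
    IsRankedEnumeration D log := by
  have hex : ∀ v, ∃ r : List α, Valid Pl D T v → D.IsAnswer r ∧
      D.IsMinWeight r (vecWeight Pl D T v) ∧
      ∀ a, Pl.Rep D T Pl.m v a → Q.head.map (fun x : Fin Q.numVars => a x) = r.map .val := by
    intro v
    by_cases hv : Valid Pl D T v
    · obtain ⟨a, ha⟩ := hv.rep
      obtain ⟨r, h1, h2, h3⟩ := ha.isMinWeight hW hT
      refine ⟨r, fun _ => ⟨h2, by rwa [vecWeight_eq ha], fun b hb => ?_⟩⟩
      rw [← h1]
      refine List.map_congr_left fun x hx => ?_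
      obtain ⟨i, hi, hxi⟩ := (Pl.head_iff x).1 hx
      exact hb.eq_on Pl.m_le ha i hi x hxi
    · exact ⟨[], fun h => absurd h hv⟩
  choose ans hans using hex
  have htuple : ∀ v ∈ L, ∀ o : Output α W, IsOutput D Pl T v o →
      o.tuple = (ans v).map .val ∧ o.weight = vecWeight Pl D T v := by
    rintro v hv o ⟨a, h1, h2, h3⟩
    exact ⟨h2.trans ((hans v ((hmem v).1 hv)).2.2 a h1), h3.trans (vecWeight_eq h1).symm⟩
  refine ⟨⟨L.map ans, ?_, ?_, fun r => ⟨fun hr => ?_, fun hr => ?_⟩⟩, fun o ho r hr => ?_, ?_⟩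
  · rw [List.map_map]
    exact map_eq_of_forall₂ h fun v hv o hvo => (htuple v hv o hvo).1
  · refine hnd.map_on fun v hv v' hv' e => ?_
    have h1 := (hmem v).1 hv
    have h2 := (hmem v').1 hv'
    obtain ⟨a, ha⟩ := h1.rep
    obtain ⟨a', ha'⟩ := h2.rep
    have h3 := ha.pos_eq_of_head hT ha'
      (((hans v h1).2.2 a ha).trans (e ▸ ((hans v' h2).2.2 a' ha').symm))
    funext j
    rcases lt_or_ge j Pl.m with hj | hj
    · exact h3 j hj
    · rw [h1.tail j hj, h2.tail j hj]
  · obtain ⟨v, hv, rfl⟩ := List.mem_map.1 hr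
    exact (hans v ((hmem v).1 hv)).1
  · obtain ⟨v, a, hva, hr'⟩ := Plan.exists_rep_of_isAnswer hT hr
    -- Coordinates from `m` on are set to `1`, the normal form demanded by `Valid`.
    have hrep : Pl.Rep D T Pl.m (fun j => if j < Pl.m then v j else 1) a := fun j hj => by
      simp only [if_pos hj]
      exact hva j hj
    have hv : Valid Pl D T fun j => if j < Pl.m then v j else 1 :=
      ⟨⟨a, hrep⟩, fun j hj => if_neg (by omega)⟩
    refine List.mem_map.2 ⟨_, (hmem _).2 hv, map_val_injective ?_⟩
    rw [← (hans _ hv).2.2 a hrep, hr']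
  · obtain ⟨v, hv, hvo⟩ : ∃ v ∈ L, IsOutput D Pl T v o := by
      clear hnd hmem hsort htuple
      induction h with
      | nil => simp at ho
      | cons h _ ih =>
        rcases List.mem_cons.1 ho with rfl | ho
        · exact ⟨_, List.mem_cons_self, h⟩
        · obtain ⟨v, hv, h'⟩ := ih ho
          exact ⟨v, List.mem_cons_of_mem _ hv, h'⟩
    obtain ⟨h1, h2⟩ := htuple v hv o hvo
    rw [hr] at h1
    rw [map_val_injective h1, h2]
    exact (hans v ((hmem v).1 hv)).2.1
  · have hw : log.map Output.weight = L.map (vecWeight Pl D T) :=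
      map_eq_of_forall₂ h fun v hv o hvo => (htuple v hv o hvo).2
    rw [← List.pairwise_map (f := Output.weight) (R := DLe), hw, List.pairwise_map]
    exact hsort

/-- The initial state. -/
def startState (D : Database Q α W) : St α W where
  reg _ := .num 0
  wreg _ := 0
  arr t key := inputMem D (.num (t.code Q.numRels) :: key)
  warr t key := inputWMem D (.num (t.code Q.numRels) :: key)
  clock := 0
  log := []

/-- Working arrays are named by numbers outside the input, so their cells contain `0` from the start
and initializing them takes no time. -/
theorem inputMem_of_le {R : ℕ} (hR : Q.numRels ≤ R) (key : List (Word α)) :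
    inputMem D (.num R :: key) = .num 0 := by
  unfold inputMem
  split
  · rename_i h
    simp only [List.cons.injEq, Word.num.injEq] at h
    rw [dif_neg (by omega)]
  · rename_i h
    simp only [List.cons.injEq, Word.num.injEq] at h
    rw [dif_neg (by omega)]
  · rfl

theorem start_startState (D : Database Q α W) : Start D (startState D) := by
  refine ⟨⟨fun R key => ?_, fun R key => ?_⟩, fun i κ => ⟨?_, ?_, ?_⟩, rfl, rfl⟩
  · simp [startState, Tag.code, R.2]
  · simp [startState, Tag.code, R.2]
  all_goals exact inputMem_of_le (by simp [Tag.code]) κ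

theorem sim_startState (D : Database Q α W) (B : ℕ) :
    Sim Q.numRels B (startState D) (initial D) :=
  ⟨fun _ => rfl, rfl, fun _ _ => rfl, fun _ _ => rfl, rfl, rfl, by
    simp [startState, initial, GapsBound]⟩

/-- Gaps on the machine are at most `B` times the structured ones. The gap with index `j` belongs to
event `j + 1`, whence `Nat.log 2 (j + 1)` in `gapBound` is the logarithm of the event's number. -/
theorem enumerates_enumerate (Pl : Plan Q) (hW : IsSelective W) (D : Database Q α W) :
    Enumerates D ((enumerate Pl).code Q.numRels 0)
      (max 1 (enumerate Pl).width * delayConst Pl) := by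
  set P := (enumerate Pl).code Q.numRels 0 with hP
  set B := max 1 (enumerate Pl).width with hB
  obtain ⟨k, s, ⟨T, L, hT, hdone⟩, hsim, hpc⟩ := Cmd.sim (P := P) (le_max_left 1 _)
    (enumerate Pl) (le_max_right 1 _) (c := initial D) ⟨[], [], by simp [hP, initial], rfl⟩
    (sim_startState D B) (enumerate_spec hW (start_startState D))
  set c := (step P)^[k] (initial D) with hc
  have hgap : ∀ j g, (s.log.map Output.time ++ [s.clock])[j]? = some g →
      g ≤ gapBound (delayConst Pl) D.n j := by
    intro j g hg
    rcases lt_trichotomy j s.log.length with h | h | h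
    · rw [List.getElem?_append_left (by simpa using h), List.getElem?_map,
        Option.map_eq_some_iff] at hg
      obtain ⟨o, ho, rfl⟩ := hg
      exact hdone.gaps j o ho
    · rw [List.getElem?_append_right (by simp [h])] at hg
      simp only [h, List.length_map, Nat.sub_self, List.getElem?_cons_zero,
        Option.some.injEq] at hg
      rw [← hg, h]
      exact hdone.clock
    · rw [List.getElem?_eq_none (by simp; omega)] at hg
      cases hg
  refine ⟨c, ⟨?_, k, rfl⟩, ?_, ?_, ?_⟩
  · rw [hpc, hP, Cmd.length_code]
    exact Nat.le_add_left _ _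
  · exact isRankedEnumeration_of_forall₂ hW hT
      (forall₂_isOutput_congr hdone.log hsim.tuples hsim.weights) hdone.nodup hdone.mem hdone.sorted
  · intro t ht
    obtain ⟨g, hg, hle⟩ := hsim.gaps.first ht
    have h1 := hgap 0 g hg
    rw [gapBound, if_pos rfl] at h1
    calc t ≤ B * g := by rwa [zero_add] at hle
      _ ≤ B * (delayConst Pl * max D.n 1) := Nat.mul_le_mul_left _ h1
      _ = _ := by rw [mul_assoc]
  · intro j t t' hj ht ht'
    obtain ⟨j, rfl⟩ : ∃ i, j = i + 2 := ⟨j - 2, by omega⟩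
    obtain ⟨g, hg, hle⟩ := hsim.gaps.next (k := j) (by simpa [Config.eventTimes] using ht)
      (by simpa [Config.eventTimes] using ht')
    have h1 := hgap (j + 1) g hg
    rw [gapBound, if_neg (by omega)] at h1
    calc t' ≤ t + B * g := hle
      _ ≤ t + B * (delayConst Pl * Nat.log 2 (j + 1 + 1)) := by gcongr
      _ = _ := by rw [mul_assoc]

end Final

end RankedEnum

theorem mainTheorem3 (Q : RankedEnum.CQ) (hQ : Q.FreeConnexAcyclic) :
    ∃ (P : RankedEnum.Program) (C : ℕ),
      ∀ (α : Type u) (W : Type v) [CommSemiring W], RankedEnum.IsSelective W →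
        ∀ D : RankedEnum.Database Q α W, RankedEnum.Enumerates D P C := by
  obtain ⟨Pl⟩ := hQ.nonempty_plan
  -- Program and constant are built from the plan, so they depend on the query alone.
  exact ⟨_, _, fun α W _ hW D => RankedEnum.enumerates_enumerate Pl hW D⟩
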